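/- Let $n\ge 2$ and let $\theta$ be a real antisymmetric $n\times n$ matrix with columns $\theta_1,\dots,\theta_n$. Let $\mathbb T^n=\mathbb R^n/2\pi\mathbb Z^n$, and let $A_\theta$ be the $C^*$-algebra of operators on $L^2(\mathbb T^n)$ (normalized measure $(2\pi)^{-n}dx$) generated by the unitaries $(U_jf)(x)=e^{ix_j}f(x+\pi\theta_j)$, $1\le j\le n$. Let $\tau(T)=\langle T1,1\rangle$, and let $\mathscr H_\theta$ be the Hilbert space obtained by completing $A_\theta$ with respect to the pre-inner product $\langle u,v\rangle=\tau(uv^*)$. Let $\alpha_s(T)=V_sTV_s^{-1}$ with $(V_sf)(x)=f(x+s)$, let $\mathscr A_\theta=\{u\in A_\theta:\ s\mapsto\alpha_s(u)\ \text{is}\ C^\infty\}$, let $\delta_j(u)=\frac1i\partial_{s_j}\alpha_s(u)|_{s=0}$ and $\delta^\alpha=\delta_1^{\alpha_1}\cdots\delta_n^{\alpha_n}$, and give $\mathscr A_\theta$ the Fréchet topology defined by the semi-norms $\|\delta^\alpha(u)\|$. For $q\in\mathbb C$, let $S^q(\mathbb R^n;\mathscr A_\theta)$ be the space of classical symbols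 of order $q$, i.e. of maps $\rho\in C^\infty(\mathbb R^n;\mathscr A_\theta)$ for which there are $\rho_{q-j}\in C^\infty(\mathbb R^n\setminus 0;\mathscr A_\theta)$, $j\geq 0$, homogeneous of degree $q-j$, such that for all $N,\alpha,\beta$ there is a constant $C$ with $\|\delta^\alpha\partial_\xi^\beta(\rho-\sum_{j<N}\rho_{q-j})(\xi)\|\le C|\xi|^{\Re q-N-|\beta|}$ for $|\xi|\ge1$. Let $\Psi^q(\mathscr A_\theta)$ be the set of linear operators $P:\mathscr A_\theta\to\mathscr A_\theta$ of the form $P=P_\rho$ with $\rho\in S^q(\mathbb R^n;\mathscr A_\theta)$, where $$P_\rho u=(2\pi)^{-n}\iint e^{is\cdot\xi}\rho(\xi)\alpha_{-s}(u)\,ds\,d\xi\qquad(u\in\mathscr A_\theta)$$ as an oscillating integral; such a $\rho$ is called a symbol of $P$. A symbol $\rho$ is called *normalized* when $\int_{\mathbb R^n}\rho(\xi)\,d\xi=\sum_{k\in\mathbb Z^n}\rho(k)$, both sides being convergent. A *Meyer-type function* is a Schwartz function $\phi:\mathbb R^n\to\mathbb C$ such that (i) $\phi(0)=1$ and $\phi(k)=0$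 for $k\in\mathbb Z^n\setminus0$; (ii) for every multi-order $\beta$ there is a Schwartz function $\phi_\beta$ with $\partial^\beta\phi=\overline\Delta^\beta\phi_\beta$, where $\overline\Delta^\beta=\overline\Delta_1^{\beta_1}\cdots\overline\Delta_n^{\beta_n}$ and $\overline\Delta_jf(\xi)=f(\xi)-f(\xi-e_j)$; (iii) $\int\phi(\xi)\,d\xi=1$. Let $P\in\Psi^q(\mathscr A_\theta)$ with $\Re q<-n$. Then: 1. Meyer-type functions exist, and for every Meyer-type function $\phi$ and every symbol $\rho\in S^q(\mathbb R^n;\mathscr A_\theta)$ of $P$, the series $\tilde\rho(\xi)=\sum_{k\in\mathbb Z^n}\phi(\xi-k)\rho(k)$ converges for all $\xi$ and defines a normalized symbol $\tilde\rho\in S^q(\mathbb R^n;\mathscr A_\theta)$ of $P$. In particular, $P$ admits a normalized symbol in $S^q(\mathbb R^n;\mathscr A_\theta)$. 2. $P$ extends uniquely to a bounded operator on $\mathscr H_\theta$, this extension is trace-class, and for every normalized symbol $\rho\in S^q(\mathbb R^n;\mathscr A_\theta)$ of $P$, the function $\tau[\rho(\xi)]$ is integrable and $$\operatorname{Trace}(P)=\int_{\mathbb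 R^n}\tau[\rho(\xi)]\,d\xi .$$ -/

import Mathlib

open MeasureTheory Filter Topology Real
open scoped ContDiff SchwartzMap Matrix ENNReal

noncomputable section

namespace NCTorus

/-! ## Multi-index calculus on `ℝⁿ` -/

/-- `ℝⁿ` with its Euclidean norm and Lebesgue measure. -/
abbrev E (n : ℕ) : Type := EuclideanSpace ℝ (Fin n)

/-- The canonical basis vector `e_j` of `ℝⁿ`. -/
def basisVec {n : ℕ} (j : Fin n) : E n := EuclideanSpace.single j (1 : ℝ)

/-- The inclusion of `ℤⁿ` into `ℝⁿ`. -/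
def latt {n : ℕ} (k : Fin n → ℤ) : E n := WithLp.toLp 2 fun i => (k i : ℝ)

/-- For operators `D₁, …, Dₙ` on `X` and a multi-order `β`, the composite `D₁^{β₁} ⋯ Dₙ^{βₙ}`. -/
def multiPow {n : ℕ} {X : Type*} (D : Fin n → X → X) (β : Fin n → ℕ) (x : X) : X :=
  (List.finRange n).foldr (fun j y => (D j)^[β j] y) x

/-- The partial derivative `∂_{ξ_j} f`. -/
def partialD {n : ℕ} (j : Fin n) (f : E n → ℂ) : E n → ℂ :=
  fun ξ => lineDeriv ℝ f ξ (basisVec j)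

/-- The backward difference `f(ξ) - f(ξ - e_j)`. -/
def backDiff {n : ℕ} (j : Fin n) (f : E n → ℂ) : E n → ℂ :=
  fun ξ => f ξ - f (ξ - basisVec j)

/-- The Meyer-type interpolating functions: Schwartz functions `φ` with `φ(0) = 1` and `φ(k) = 0`
for `k ∈ ℤⁿ \ 0`, all of whose partial derivatives `∂^β φ` are iterated backward differences
of Schwartz functions, and which have integral one. -/
structure IsMeyer {n : ℕ} (φ : 𝓢(E n, ℂ)) : Prop where
  map_zero : φ 0 = 1
  map_latt : ∀ k : Fin n → ℤ, k ≠ 0 → φ (latt k) = 0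
  derivs : ∀ β : Fin n → ℕ, ∃ ψ : 𝓢(E n, ℂ),
    multiPow partialD β (φ : E n → ℂ) = multiPow backDiff β (ψ : E n → ℂ)
  integral_eq : ∫ ξ, φ ξ = 1

/-! ## The noncommutative torus -/

instance instFactTwoPi : Fact (0 < 2 * π) := ⟨two_pi_pos⟩

/-- The ordinary torus `𝕋ⁿ = ℝⁿ / 2πℤⁿ`. -/
abbrev Torus (n : ℕ) : Type := Fin n → AddCircle (2 * π)

/-- The normalized Lebesgue measure `(2π)⁻ⁿ dx` on `𝕋ⁿ`. -/
abbrev torusMeasure (n : ℕ) : Measure (Torus n) :=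
  Measure.pi fun _ => (AddCircle.haarAddCircle : Measure (AddCircle (2 * π)))

/-- `L²(𝕋ⁿ)`. -/
abbrev L2 (n : ℕ) : Type := Lp ℂ 2 (torusMeasure n)

/-- The bounded operators on `L²(𝕋ⁿ)`; the involution is the adjoint. -/
abbrev B (n : ℕ) : Type := L2 n →L[ℂ] L2 n

/-- Translation on `L²(𝕋ⁿ)`: `ξ ↦ ξ(· + a)`. -/
def translate {n : ℕ} (a : Torus n) : B n :=
  (Lp.compMeasurePreservingₗᵢ (p := 2) (μ := torusMeasure n) (μb := torusMeasure n) (E := ℂ) ℂ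
    (fun x => x + a) (measurePreserving_add_right (torusMeasure n) a)).toContinuousLinearMap

/-- The function `e^{i x_j}` on `𝕋ⁿ`. -/
def expCoord {n : ℕ} (j : Fin n) : C(Torus n, ℂ) where
  toFun x := fourier 1 (x j)
  continuous_toFun := by fun_prop

/-- Multiplication by a continuous function on `L²(𝕋ⁿ)`. -/
def mulOp {n : ℕ} (f : C(Torus n, ℂ)) : B n :=
  (ContinuousLinearMap.mul ℂ ℂ).holderL (torusMeasure n) ∞ 2 2
    (ContinuousMap.toLp ∞ (torusMeasure n) ℂ f)

/-- `(U_j ξ)(x) = e^{i x_j} ξ(x + π θ_j)`, where `θ_j` is the `j`-th column of `θ`. -/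
def U {n : ℕ} (θ : Matrix (Fin n) (Fin n) ℝ) (j : Fin n) : B n :=
  mulOp (expCoord j) ∘L translate fun i => ((π * θ i j : ℝ) : AddCircle (2 * π))

/-- The noncommutative torus `A_θ`: the `C*`-algebra generated by `U₁, …, Uₙ`. -/
def A {n : ℕ} (θ : Matrix (Fin n) (Fin n) ℝ) : StarSubalgebra ℂ (B n) :=
  (StarAlgebra.adjoin ℂ (Set.range (U θ))).topologicalClosure

/-- The constant function `1` in `L²(𝕋ⁿ)`. -/
def oneL2 (n : ℕ) : L2 n := Lp.const 2 (torusMeasure n) (1 : ℂ)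

/-- The state `τ(T) = ⟨T1, 1⟩` (Mathlib's inner products are linear in the second variable). -/
def τ {n : ℕ} (T : B n) : ℂ := inner ℂ (oneL2 n) (T (oneL2 n))

/-- The unitary `V_s` on `L²(𝕋ⁿ)`: `(V_s ξ)(x) = ξ(x + s)`. -/
def V {n : ℕ} (s : E n) : B n := translate fun i => ((s i : ℝ) : AddCircle (2 * π))

/-- `V_{-s}` is the inverse of `V_s`. -/
theorem V_mul_V_neg {n : ℕ} (s : E n) : V s * V (-s) = 1 := by
  ext1 f
  change Lp.compMeasurePreserving _ _ (Lp.compMeasurePreserving _ _ f) = f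
  have h := measurePreserving_add_right (torusMeasure n)
  rw [← Lp.compMeasurePreserving_comp_apply f (h _) (h _)]
  convert Lp.compMeasurePreserving_id_apply f using 2
  congr 1
  ext x i
  simp

/-- The action `α_s(T) = V_s T V_s⁻¹`. -/
def act {n : ℕ} (s : E n) (T : B n) : B n := V s * T * V (-s)

/-- `δ_j(u) = (1/i) ∂_{s_j} α_s(u)` at `s = 0`. -/
def delta {n : ℕ} (j : Fin n) (u : B n) : B n :=
  (-Complex.I) • deriv (fun t : ℝ => act (t • basisVec j) u) 0

/-- `δ^β = δ₁^{β₁} ⋯ δₙ^{βₙ}`. -/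
def deltaPow {n : ℕ} (β : Fin n → ℕ) (u : B n) : B n := multiPow delta β u

/-- The smooth noncommutative torus `𝒜_θ`: the `u ∈ A_θ` such that `s ↦ α_s(u)` is smooth. -/
def SA {n : ℕ} (θ : Matrix (Fin n) (Fin n) ℝ) : Submodule ℂ (B n) where
  carrier := {u | u ∈ A θ ∧ ContDiff ℝ ∞ fun s : E n => act s u}
  zero_mem' := ⟨zero_mem _, by simpa [act] using contDiff_const⟩
  add_mem' := by
    rintro u v ⟨hu, hu'⟩ ⟨hv, hv'⟩
    exact ⟨add_mem hu hv, by simpa [act, mul_add, add_mul] using hu'.add hv'⟩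
  smul_mem' := by
    rintro c u ⟨hu, hu'⟩
    exact ⟨SMulMemClass.smul_mem c hu, by simpa [act] using hu'.const_smul c⟩

/-! ## The Hilbert space `ℋ_θ` -/

/-- A copy of `A_θ`, to carry the pre-inner product `⟨u, v⟩ = τ(u v*)`. -/
def PreH {n : ℕ} (θ : Matrix (Fin n) (Fin n) ℝ) : Type := A θ

instance {n : ℕ} (θ : Matrix (Fin n) (Fin n) ℝ) : AddCommGroup (PreH θ) :=
  inferInstanceAs (AddCommGroup (A θ))

instance {n : ℕ} (θ : Matrix (Fin n) (Fin n) ℝ) : Module ℂ (PreH θ) :=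
  inferInstanceAs (Module ℂ (A θ))

/-- The identity map from `A_θ` to its copy `PreH θ`. -/
def toPreH {n : ℕ} (θ : Matrix (Fin n) (Fin n) ℝ) : A θ ≃ₗ[ℂ] PreH θ := LinearEquiv.refl ℂ _

/-- The underlying operator of an element of `PreH θ`. -/
def PreH.val {n : ℕ} {θ : Matrix (Fin n) (Fin n) ℝ} (u : PreH θ) : B n :=
  ((toPreH θ).symm u : A θ)

/-- The sesquilinear form `⟨u, v⟩ = τ(u v*)` on `A_θ`, linear in `u`. In Mathlib's convention
this is `inner v u`. -/
abbrev preInner {n : ℕ} (θ : Matrix (Fin n) (Fin n) ℝ) : PreInnerProductSpace.Core ℂ (PreH θ) where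
  inner v u := τ (u.val * star v.val)
  conj_inner_symm x y := by
    simp only [τ, inner_conj_symm]
    rw [show y.val * star x.val = star (x.val * star y.val) by simp,
      ContinuousLinearMap.star_eq_adjoint (x.val * star y.val),
      ContinuousLinearMap.adjoint_inner_right]
  re_inner_nonneg x := by
    simp only [τ, ContinuousLinearMap.star_eq_adjoint]
    change 0 ≤ RCLike.re (inner ℂ (oneL2 n) (x.val (ContinuousLinearMap.adjoint x.val (oneL2 n))))
    rw [← ContinuousLinearMap.adjoint_inner_left]
    exact inner_self_nonneg
  add_left x y z := by
    simp [τ, PreH.val, mul_add, inner_add_right]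
  smul_left x y r := by
    simp [τ, PreH.val, inner_smul_right]

instance {n : ℕ} (θ : Matrix (Fin n) (Fin n) ℝ) : SeminormedAddCommGroup (PreH θ) :=
  InnerProductSpace.Core.toSeminormedAddCommGroup (c := preInner θ)

instance {n : ℕ} (θ : Matrix (Fin n) (Fin n) ℝ) : InnerProductSpace ℂ (PreH θ) :=
  InnerProductSpace.ofCore (preInner θ)

/-- The Hilbert space `ℋ_θ`, the completion for the pre-inner product `⟨u, v⟩ = τ(u v*)`.
(Completing `A_θ` or the dense linear span of the monomials in the `U_j` is the same, because
`τ(u u*) ≤ ‖u‖²`.) -/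
abbrev H {n : ℕ} (θ : Matrix (Fin n) (Fin n) ℝ) : Type := UniformSpace.Completion (PreH θ)

/-- The inclusion of `𝒜_θ` into `ℋ_θ`. -/
def toH {n : ℕ} {θ : Matrix (Fin n) (Fin n) ℝ} (u : SA θ) : H θ :=
  ((toPreH θ ⟨u.1, u.2.1⟩ : PreH θ) : H θ)

/-- `T ∈ ℒ(ℋ_θ)` extends the linear operator `P` on `𝒜_θ`. -/
def Extends {n : ℕ} {θ : Matrix (Fin n) (Fin n) ℝ} (T : H θ →L[ℂ] H θ)
    (P : SA θ →ₗ[ℂ] SA θ) : Prop :=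
  ∀ u : SA θ, T (toH u) = toH (P u)

/-! ## Trace-class operators -/

/-- The characteristic value `μ_k(T) = inf {‖T|_{F^⊥}‖ ; dim F = k}`: for compact `T` this is the
`(k+1)`-th eigenvalue of `|T|`, by the min-max principle. -/
def charValue {K : Type*} [NormedAddCommGroup K] [InnerProductSpace ℂ K]
    (T : K →L[ℂ] K) (k : ℕ) : ℝ :=
  ⨅ F : {F : Submodule ℂ K // FiniteDimensional ℂ F ∧ Module.finrank ℂ F = k},
    ‖T ∘L (F.1ᗮ).subtypeL‖

/-- Trace-class operators: compact operators with summable characteristic values. -/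
def IsTraceClass {K : Type*} [NormedAddCommGroup K] [InnerProductSpace ℂ K]
    (T : K →L[ℂ] K) : Prop :=
  IsCompactOperator T ∧ Summable (charValue T)

/-- `T` is trace-class with `Trace(T) = z`: for any orthonormal basis `(e_i)` we have
`∑ ⟨T e_i, e_i⟩ = z`. -/
def HasTrace {K : Type*} [NormedAddCommGroup K] [InnerProductSpace ℂ K]
    (T : K →L[ℂ] K) (z : ℂ) : Prop :=
  IsTraceClass T ∧ ∀ (ι : Type) (e : HilbertBasis ι ℂ K),
    HasSum (fun i => (inner ℂ (e i) (T (e i)) : ℂ)) z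

/-! ## Classical symbols -/

/-- `ρ ∈ C^∞(Ω; 𝒜_θ)` for `Ω ⊆ ℝⁿ` open. The Fréchet topology of `𝒜_θ` is given by the norms
`‖δ^α(u)‖`, so that `ρ` is smooth into `𝒜_θ` when it takes values in `𝒜_θ` and every
`δ^α(ρ(ξ))` is smooth for the norm of `A_θ`. -/
def IsSmoothOn {n : ℕ} (θ : Matrix (Fin n) (Fin n) ℝ) (Ω : Set (E n)) (ρ : E n → B n) : Prop :=
  (∀ ξ ∈ Ω, ρ ξ ∈ SA θ) ∧ ∀ α : Fin n → ℕ, ContDiffOn ℝ ∞ (fun ξ => deltaPow α (ρ ξ)) Ω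

/-- `S_q(ℝⁿ; 𝒜_θ)`: smooth maps from `ℝⁿ \ 0` to `𝒜_θ` homogeneous of degree `q`. The value
at the origin is irrelevant. -/
def IsHomogeneousSymbol {n : ℕ} (θ : Matrix (Fin n) (Fin n) ℝ) (q : ℂ) (ρ : E n → B n) : Prop :=
  IsSmoothOn θ {0}ᶜ ρ ∧
    ∀ ξ : E n, ξ ≠ 0 → ∀ r : ℝ, 0 < r → ρ (r • ξ) = ((r : ℂ) ^ q) • ρ ξ

/-- `S^q(ℝⁿ; 𝒜_θ)`: smooth maps from `ℝⁿ` to `𝒜_θ` with an expansion `ρ ∼ ∑ ρ_{q-j}`, where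
`ρ_{q-j} ∈ S_{q-j}(ℝⁿ; 𝒜_θ)`, i.e. for all `N`, `α` and all orders `b` of differentiation in `ξ`,
`‖δ^α ∂_ξ^β (ρ - ∑_{j<N} ρ_{q-j})(ξ)‖ ≤ C |ξ|^{Re q - N - b}` for `|β| = b` and `|ξ| ≥ 1`. -/
def IsClassicalSymbol {n : ℕ} (θ : Matrix (Fin n) (Fin n) ℝ) (q : ℂ) (ρ : E n → B n) : Prop :=
  IsSmoothOn θ Set.univ ρ ∧
    ∃ σ : ℕ → E n → B n, (∀ j : ℕ, IsHomogeneousSymbol θ (q - j) (σ j)) ∧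
      ∀ (N : ℕ) (α : Fin n → ℕ) (b : ℕ), ∃ C : ℝ, ∀ ξ : E n, 1 ≤ ‖ξ‖ →
        ‖iteratedFDeriv ℝ b (fun η => deltaPow α (ρ η - ∑ j ∈ Finset.range N, σ j η)) ξ‖
          ≤ C * ‖ξ‖ ^ (q.re - N - b)

/-- A symbol is normalized when `∫ ρ(ξ) dξ = ∑_{k ∈ ℤⁿ} ρ(k)`, the integral and the series being
convergent. -/
def IsNormalized {n : ℕ} (ρ : E n → B n) : Prop :=
  Integrable ρ ∧ HasSum (fun k : Fin n → ℤ => ρ (latt k)) (∫ ξ, ρ ξ)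

/-- The interpolation `ρ̃(ξ) = ∑_{k ∈ ℤⁿ} φ(ξ - k) ρ(k)`. -/
def interpolate {n : ℕ} (φ : 𝓢(E n, ℂ)) (ρ : E n → B n) : E n → B n :=
  fun ξ => ∑' k : Fin n → ℤ, φ (ξ - latt k) • ρ (latt k)

/-! ## Pseudodifferential operators -/

/-- The oscillating integral `(2π)⁻ⁿ ∬ e^{i s·ξ} a(s, ξ) ds dξ` exists and is equal to `v`: for
every cut-off `χ ∈ C_c^∞(ℝⁿ × ℝⁿ)` with `χ(0, 0) = 1`, the absolutely convergent integrals
`(2π)⁻ⁿ ∬ e^{i s·ξ} χ(εs, εξ) a(s, ξ) ds dξ` converge to `v` as `ε → 0⁺`. -/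
def IsOscIntegral {n : ℕ} (a : E n → E n → B n) (v : B n) : Prop :=
  ∀ χ : E n × E n → ℂ, ContDiff ℝ ∞ χ → HasCompactSupport χ → χ 0 = 1 →
    Tendsto (fun ε : ℝ => ((2 * π : ℂ) ^ n)⁻¹ •
        ∫ p : E n × E n,
          (Complex.exp (Complex.I * (inner ℝ p.1 p.2 : ℝ)) * χ (ε • p)) • a p.1 p.2)
      (𝓝[>] 0) (𝓝 v)

/-- `P = P_ρ`, i.e. `P u = (2π)⁻ⁿ ∬ e^{i s·ξ} ρ(ξ) α_{-s}(u) ds dξ` for all `u ∈ 𝒜_θ`. -/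
def IsSymbolOf {n : ℕ} {θ : Matrix (Fin n) (Fin n) ℝ} (ρ : E n → B n)
    (P : SA θ →ₗ[ℂ] SA θ) : Prop :=
  ∀ u : SA θ, IsOscIntegral (fun s ξ => ρ ξ * act (-s) (u : B n)) (P u : B n)

/-- `Ψ^q(𝒜_θ)`: the operators `P_ρ` with `ρ ∈ S^q(ℝⁿ; 𝒜_θ)`. -/
def PsiDO {n : ℕ} (θ : Matrix (Fin n) (Fin n) ℝ) (q : ℂ) : Set (SA θ →ₗ[ℂ] SA θ) :=
  {P | ∃ ρ : E n → B n, IsClassicalSymbol θ q ρ ∧ IsSymbolOf ρ P}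

end NCTorus

end

noncomputable section

namespace NCTorus

/-! ## Sums over the lattice -/

/-! Everything rests on one observation: `P_ρ` only sees the values of `ρ` on `ℤⁿ`. Let `W_k` be the
Weyl unitaries, which are eigenvectors of the action, `α_s(W_k) = e^{ik·s} W_k`. A smooth `u` is the
absolutely convergent sum of its Fourier series `∑ u_k W_k`, and Fourier inversion in the
oscillating integral gives `P_ρ u = ∑ u_k ρ(k) W_k` (`isOscIntegral_of_bounded`,
`IsSymbolOf.apply_eq`).

Interpolation keeps the lattice values, because `φ` is `1` at `0` and `0` at the other lattice
points, so it keeps the operator. Integrating termwise with `∫ φ = 1` gives normalization. What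
remains is that the interpolation is classical. Condition (ii) and summation by parts show that `φ`
reproduces polynomials, `∑ φ(ξ - k) p(k) = p(ξ)` (`lattConv_polyProd`). Taylor's formula at `ξ` then
makes `ρ̃ - ρ` rapidly decaying with all its derivatives (`SymbolBound.interpolation`), so both
symbols have the same homogeneous expansion. A Meyer-type function is the inverse Fourier transform
of a product of one-variable bumps whose integer translates add up to `1` (`exists_isMeyer`).

For the trace, the `W_k` form an orthonormal basis of `ℋ_θ` and `P W_k = ρ(k) W_k`. Since `∑ ‖ρ(k)‖
< ∞` when `Re q < -n`, the extension of `P` is an absolutely convergent sum of rank-one operators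
(`extends_sumRankOne`). It is therefore compact, and its trace in every orthonormal basis is `∑
τ(ρ(k))` (`hasSum_trace_sumRankOne`), which is `∫ τ(ρ)` for a normalized symbol. Summability of the
characteristic values comes from Schur's test on vectors orthogonal to `W_l` for `l` in a large
cube: `μ_k = O(k^{Re q / n})`, with `Re q / n < -1` (`isTraceClass_sumRankOne`). -/

@[simp] lemma latt_apply {n : ℕ} (k : Fin n → ℤ) (i : Fin n) : latt k i = k i := rfl

lemma latt_sub {n : ℕ} (k l : Fin n → ℤ) : latt (k - l) = latt k - latt l := by
  ext i; simp

@[simp] lemma latt_zero {n : ℕ} : latt (0 : Fin n → ℤ) = 0 := by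
  ext i; simp

lemma latt_injective {n : ℕ} : Function.Injective (latt : (Fin n → ℤ) → E n) := by
  intro k l h
  ext i
  have := congrArg (fun x : E n => x i) h
  simpa using this

lemma latt_single {n : ℕ} (j : Fin n) : latt (Pi.single j 1) = basisVec j := by
  ext i
  by_cases h : i = j
  · subst h; simp [basisVec]
  · simp [basisVec, h]

lemma summable_latt {n : ℕ} {r : ℝ} (hr : (n : ℝ) < r) :
    Summable fun k : Fin n → ℤ => (1 + ‖latt k‖) ^ (-r) := by
  let b := (EuclideanSpace.basisFun (Fin n) ℝ).toBasis
  let L : Submodule ℤ (E n) := Submodule.span ℤ (Set.range b)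
  have hmem : ∀ k : Fin n → ℤ, latt k ∈ L := by
    intro k
    have : latt k = ∑ i, k i • b i := by
      ext j
      simp [b, Finset.sum_apply, Pi.single_apply]
    rw [this]
    exact Submodule.sum_mem _ fun i _ =>
      Submodule.smul_mem _ _ (Submodule.subset_span ⟨i, rfl⟩)
  have hrank : Module.finrank ℤ L = n := by
    rw [ZLattice.rank ℝ L]; simp
  have hs : Summable fun z : L => ‖z‖ ^ (-r) :=
    ZLattice.summable_norm_rpow L (-r) (by rw [hrank]; linarith)
  have hs' : Summable fun k : Fin n → ℤ => ‖latt k‖ ^ (-r) :=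
    hs.comp_injective (i := fun k : Fin n → ℤ => (⟨latt k, hmem k⟩ : L))
      fun k l h => latt_injective (congrArg Subtype.val h)
  -- The comparison with `‖latt k‖ ^ (-r)` fails only at `k = 0`, where that power is `0` by
  -- convention.
  refine hs'.of_norm_bounded_eventually ?_
  have : {(0 : Fin n → ℤ)}ᶜ ∈ cofinite := by simp [mem_cofinite]
  filter_upwards [this] with k hk
  have hk0 : 0 < ‖latt k‖ := by
    rw [norm_pos_iff, ← latt_zero]
    exact fun h => hk (latt_injective h)
  rw [Real.norm_of_nonneg (by positivity)]
  exact Real.rpow_le_rpow_of_nonpos hk0 (by linarith)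
    (by have : (0 : ℝ) ≤ n := by positivity
        linarith)

/-- Peetre's inequality. -/
lemma peetre {n : ℕ} {s : ℝ} (hs : 0 ≤ s) (ξ v : E n) :
    (1 + ‖ξ + v‖) ^ (-s) ≤ (1 + ‖ξ‖) ^ (-s) * (1 + ‖v‖) ^ s := by
  have h1 : 1 + ‖ξ‖ ≤ (1 + ‖ξ + v‖) * (1 + ‖v‖) := by
    have : ‖ξ‖ ≤ ‖ξ + v‖ + ‖v‖ := by
      simpa using norm_sub_le (ξ + v) v
    nlinarith [norm_nonneg (ξ + v), norm_nonneg v]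
  have h2 := Real.rpow_le_rpow (by positivity) h1 hs
  rw [Real.mul_rpow (by positivity) (by positivity)] at h2
  rw [Real.rpow_neg (by positivity), Real.rpow_neg (by positivity), ← div_eq_inv_mul,
    inv_le_comm₀ (by positivity) (by positivity), inv_div, div_le_iff₀ (by positivity)]
  exact h2

/-- Uniformity in `ξ` comes from translating by the integer part of `ξ`: the fractional part has
norm at most `√n`, and Peetre's inequality absorbs it in a constant. -/
lemma exists_sum_le {n : ℕ} {r : ℝ} (hr : (n : ℝ) < r) :
    ∃ C : ℝ, 0 ≤ C ∧ ∀ ξ : E n, (Summable fun k : Fin n → ℤ => (1 + ‖ξ - latt k‖) ^ (-r)) ∧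
      ∑' k : Fin n → ℤ, (1 + ‖ξ - latt k‖) ^ (-r) ≤ C := by
  have hn : (0 : ℝ) ≤ n := by positivity
  have hr0 : 0 ≤ r := by linarith
  refine ⟨(∑' k : Fin n → ℤ, (1 + ‖latt k‖) ^ (-r)) * (1 + √n) ^ r,
    mul_nonneg (tsum_nonneg fun k => by positivity) (by positivity), fun ξ => ?_⟩
  let k₀ : Fin n → ℤ := fun i => ⌊ξ i⌋
  have hk₀ : ‖ξ - latt k₀‖ ≤ √n := by
    rw [EuclideanSpace.norm_eq]
    apply Real.sqrt_le_sqrt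
    calc ∑ i, ‖(ξ - latt k₀) i‖ ^ 2 ≤ ∑ i : Fin n, (1 : ℝ) := by
          refine Finset.sum_le_sum fun i _ => ?_
          have h1 := Int.floor_le (ξ i)
          have h2 := Int.lt_floor_add_one (ξ i)
          simp only [PiLp.sub_apply, latt_apply, k₀, Real.norm_eq_abs, sq_abs]
          nlinarith
      _ = n := by simp
  have key : ∀ k : Fin n → ℤ, (1 + ‖ξ - latt k‖) ^ (-r) ≤
      (1 + ‖latt (k - k₀)‖) ^ (-r) * (1 + √n) ^ r := by
    intro k
    have h := peetre hr0 (latt (k₀ - k)) (ξ - latt k₀)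
    rw [show latt (k₀ - k) + (ξ - latt k₀) = ξ - latt k by rw [latt_sub]; abel] at h
    refine h.trans ?_
    rw [show latt (k₀ - k) = - latt (k - k₀) by rw [latt_sub, latt_sub]; abel, norm_neg]
    gcongr
  have hs : Summable fun k : Fin n → ℤ => (1 + ‖latt (k - k₀)‖) ^ (-r) * (1 + √n) ^ r :=
    (((Equiv.subRight k₀).summable_iff (f := fun k => (1 + ‖latt k‖) ^ (-r))).2
      (summable_latt hr)).mul_right _
  have hs' := hs.of_nonneg_of_le (fun k => by positivity) key
  refine ⟨hs', (hs'.tsum_le_tsum key hs).trans_eq ?_⟩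
  rw [tsum_mul_right]
  congr 1
  exact (Equiv.subRight k₀).tsum_eq (fun k => (1 + ‖latt k‖) ^ (-r))

/-- Rapid decay of Schwartz functions. -/
lemma schwartz_decay {n : ℕ} {F : Type*} [NormedAddCommGroup F] [NormedSpace ℝ F]
    (ψ : 𝓢(E n, F)) (b : ℕ) (r : ℝ) :
    ∃ C : ℝ, 0 ≤ C ∧ ∀ x, ‖iteratedFDeriv ℝ b ψ x‖ ≤ C * (1 + ‖x‖) ^ (-r) := by
  obtain ⟨m, hm⟩ := exists_nat_ge r
  refine ⟨2 ^ m * ((Finset.Iic (m, b)).sup fun p => SchwartzMap.seminorm ℝ p.1 p.2) ψ,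
    by positivity, fun x => ?_⟩
  have h := SchwartzMap.one_add_le_sup_seminorm_apply (𝕜 := ℝ) (m := (m, b)) le_rfl le_rfl ψ x
  have hx : (1 : ℝ) ≤ 1 + ‖x‖ := by simp
  have h2 : (1 + ‖x‖) ^ r ≤ (1 + ‖x‖) ^ m := by
    rw [← Real.rpow_natCast]
    exact Real.rpow_le_rpow_of_exponent_le hx hm
  rw [Real.rpow_neg (by positivity), ← div_eq_mul_inv, le_div_iff₀ (by positivity), mul_comm]
  exact (mul_le_mul_of_nonneg_right h2 (norm_nonneg _)).trans h

lemma schwartz_decay_zero {n : ℕ} {F : Type*} [NormedAddCommGroup F] [NormedSpace ℝ F]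
    (ψ : 𝓢(E n, F)) (r : ℝ) :
    ∃ C : ℝ, 0 ≤ C ∧ ∀ x, ‖ψ x‖ ≤ C * (1 + ‖x‖) ^ (-r) := by
  simpa using schwartz_decay ψ 0 r

/-- Locally uniform convergence of `∑ ψ(ξ - k) p(k)` for `p` of polynomial growth. -/
lemma schwartz_latt_bound {n : ℕ} (ψ : 𝓢(E n, ℂ)) {p : (Fin n → ℤ) → ℂ} {c d : ℝ}
    (hp : ∀ k, ‖p k‖ ≤ c * (1 + ‖latt k‖) ^ d) (R : ℝ) :
    ∃ u : (Fin n → ℤ) → ℝ, Summable u ∧ ∀ ξ : E n, ‖ξ‖ ≤ R → ∀ k,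
      ‖ψ (ξ - latt k) * p k‖ ≤ u k := by
  -- This order of decay beats the growth `d` and leaves the summable power `-(n + 1)`; Peetre's
  -- inequality requires it to be nonnegative.
  let s : ℝ := max (d + (n + 1)) 0
  have hs : 0 ≤ s := le_max_right _ _
  obtain ⟨C, hC, h⟩ := schwartz_decay_zero ψ s
  have hc : 0 ≤ c := by
    have := (norm_nonneg _).trans (hp 0)
    simpa using this
  refine ⟨fun k => C * (1 + R) ^ s * c * (1 + ‖latt k‖) ^ (-((n : ℝ) + 1)),
    (summable_latt (by linarith)).mul_left _, fun ξ hξ k => ?_⟩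
  have h1 := h (ξ - latt k)
  have h2 := peetre hs (-latt k) ξ
  rw [show -latt k + ξ = ξ - latt k by abel, norm_neg] at h2
  rw [norm_mul]
  calc ‖ψ (ξ - latt k)‖ * ‖p k‖
      ≤ (C * ((1 + ‖latt k‖) ^ (-s) * (1 + R) ^ s)) * (c * (1 + ‖latt k‖) ^ d) := by
        refine mul_le_mul (h1.trans ?_) (hp k) (norm_nonneg _) ?_
        · refine mul_le_mul_of_nonneg_left (h2.trans ?_) hC
          gcongr
        · have : 0 ≤ R := (norm_nonneg _).trans hξ
          positivity
    _ = C * (1 + R) ^ s * c * (1 + ‖latt k‖) ^ (-s + d) := by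
        rw [Real.rpow_add (by positivity)]; ring
    _ ≤ _ := by
        have : 0 ≤ R := (norm_nonneg _).trans hξ
        refine mul_le_mul_of_nonneg_left (Real.rpow_le_rpow_of_exponent_le ?_ ?_) (by positivity)
        · linarith [norm_nonneg (latt k)]
        · have := le_max_left (d + ((n : ℝ) + 1)) 0
          linarith

end NCTorus
end

noncomputable section

namespace NCTorus

/-! ## Polynomial reproduction by Meyer-type functions -/

lemma exists_polynomial_antideriv (P : Polynomial ℂ) :
    ∃ Q : Polynomial ℂ, Q.derivative = P := by
  induction P using Polynomial.induction_on' with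
  | add p q hp hq =>
    obtain ⟨p', rfl⟩ := hp
    obtain ⟨q', rfl⟩ := hq
    exact ⟨p' + q', by simp⟩
  | monomial m a =>
    refine ⟨Polynomial.monomial (m + 1) (a / (m + 1)), ?_⟩
    rw [Polynomial.derivative_monomial]
    have : (m : ℂ) + 1 ≠ 0 := by exact_mod_cast Nat.succ_ne_zero m
    simp [this]

lemma hasDerivAt_polynomial_ofReal (Q : Polynomial ℂ) (t : ℝ) :
    HasDerivAt (fun t : ℝ => Q.eval (t : ℂ)) (Q.derivative.eval (t : ℂ)) t :=
  (Q.hasDerivAt (t : ℂ)).comp_ofReal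

/-- A function with a vanishing higher derivative is a polynomial. -/
lemma exists_polynomial_of_hasDerivAt (m : ℕ) (g : ℕ → ℝ → ℂ)
    (hg : ∀ i t, HasDerivAt (g i) (g (i + 1) t) t) (hm : ∀ t, g m t = 0) :
    ∃ P : Polynomial ℂ, ∀ t : ℝ, g 0 t = P.eval (t : ℂ) := by
  induction m generalizing g with
  | zero => exact ⟨0, fun t => by simpa using hm t⟩
  | succ m ih =>
    obtain ⟨P, hP⟩ := ih (fun i => g (i + 1)) (fun i t => hg (i + 1) t) hm
    obtain ⟨Q, rfl⟩ := exists_polynomial_antideriv P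
    have hd : ∀ t, HasDerivAt (fun t : ℝ => g 0 t - Q.eval (t : ℂ)) 0 t := fun t => by
      have := (hg 0 t).sub (hasDerivAt_polynomial_ofReal Q t)
      rwa [hP t, sub_self] at this
    have hc := is_const_of_deriv_eq_zero (f := fun t : ℝ => g 0 t - Q.eval (t : ℂ))
      (fun t => (hd t).differentiableAt) (fun t => (hd t).deriv)
    refine ⟨Q + Polynomial.C (g 0 0 - Q.eval 0), fun t => ?_⟩
    have := hc t 0
    simp only [Complex.ofReal_zero] at this
    simp [← this]

lemma exists_polynomial_bound (P : Polynomial ℂ) :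
    ∃ (c : ℝ) (d : ℕ), 0 ≤ c ∧ ∀ x : ℂ, ‖P.eval x‖ ≤ c * (1 + ‖x‖) ^ d := by
  refine ⟨∑ i ∈ Finset.range (P.natDegree + 1), ‖P.coeff i‖, P.natDegree,
    Finset.sum_nonneg fun _ _ => norm_nonneg _, fun x => ?_⟩
  rw [Polynomial.eval_eq_sum_range, Finset.sum_mul]
  refine (norm_sum_le _ _).trans (Finset.sum_le_sum fun i hi => ?_)
  rw [norm_mul, norm_pow]
  refine mul_le_mul_of_nonneg_left ?_ (norm_nonneg _)
  have h1 : ‖x‖ ≤ 1 + ‖x‖ := by linarith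
  have h2 : (1 : ℝ) ≤ 1 + ‖x‖ := by linarith [norm_nonneg x]
  exact (pow_le_pow_left₀ (norm_nonneg _) h1 i).trans
    (pow_le_pow_right₀ h2 (by simp at hi; omega))

/-- The product `∏ᵢ Pᵢ(xᵢ)`. -/
def polyProd {n : ℕ} (P : Fin n → Polynomial ℂ) (x : E n) : ℂ := ∏ i, (P i).eval (x i : ℂ)

lemma exists_polyProd_bound {n : ℕ} (P : Fin n → Polynomial ℂ) :
    ∃ c d : ℝ, ∀ x : E n, ‖polyProd P x‖ ≤ c * (1 + ‖x‖) ^ d := by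
  choose c d hc h using fun i => exists_polynomial_bound (P i)
  refine ⟨∏ i, c i, (∑ i, d i : ℕ), fun x => ?_⟩
  rw [Real.rpow_natCast, polyProd, norm_prod, ← Finset.prod_pow_eq_pow_sum,
    ← Finset.prod_mul_distrib]
  refine Finset.prod_le_prod (fun _ _ => norm_nonneg _) fun i _ => (h i _).trans ?_
  have : ‖(x i : ℂ)‖ ≤ ‖x‖ := by
    simpa using PiLp.norm_apply_le x i
  gcongr
  exact hc i

/-- The sum `∑ₖ f(ξ - k) p(k)`. -/
def lattConv {n : ℕ} (f : E n → ℂ) (p : (Fin n → ℤ) → ℂ) (ξ : E n) : ℂ :=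
  ∑' k, f (ξ - latt k) * p k

/-- Termwise differentiation: the differentiated series is dominated uniformly on the unit ball
around `t`. -/
lemma hasDerivAt_lattConv {n : ℕ} (ψ : 𝓢(E n, ℂ)) {p : (Fin n → ℤ) → ℂ} {c d : ℝ}
    (hp : ∀ k, ‖p k‖ ≤ c * (1 + ‖latt k‖) ^ d) (ξ v : E n) (t : ℝ) :
    HasDerivAt (fun t : ℝ => lattConv ψ p (ξ + t • v))
      (lattConv (LineDeriv.lineDerivOp v ψ : 𝓢(E n, ℂ)) p (ξ + t • v)) t := by
  obtain ⟨u, hu, h⟩ := schwartz_latt_bound (LineDeriv.lineDerivOp v ψ : 𝓢(E n, ℂ)) hp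
    (‖ξ‖ + (|t| + 1) * ‖v‖)
  obtain ⟨u', hu', h'⟩ := schwartz_latt_bound ψ hp ‖ξ + t • v‖
  refine hasDerivAt_tsum_of_isPreconnected (t := Metric.ball t 1) (y₀ := t)
    (g' := fun k s => (LineDeriv.lineDerivOp v ψ : 𝓢(E n, ℂ)) (ξ + s • v - latt k) * p k) hu Metric.isOpen_ball
    (convex_ball t 1).isPreconnected (fun k s _ => ?_) (fun k s hs => h _ ?_ k)
    (Metric.mem_ball_self one_pos) (hu'.of_norm_bounded (h' _ le_rfl))
    (Metric.mem_ball_self one_pos)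
  · refine HasDerivAt.mul_const ?_ (p k)
    rw [SchwartzMap.lineDerivOp_apply_eq_fderiv]
    have h1 : HasDerivAt (fun s : ℝ => ξ + s • v - latt k) v s := by
      simpa using (((hasDerivAt_id s).smul_const v).const_add ξ).sub_const (latt k)
    exact HasFDerivAt.comp_hasDerivAt (f := fun s : ℝ => ξ + s • v - latt k) s
      ψ.differentiableAt.hasFDerivAt h1
  · refine (norm_add_le _ _).trans ?_
    rw [norm_smul]
    have : |s| ≤ |t| + 1 := by
      have h1 := abs_sub_abs_le_abs_sub s t
      rw [Metric.mem_ball, Real.dist_eq] at hs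
      linarith
    rw [Real.norm_eq_abs]
    exact add_le_add_right (mul_le_mul_of_nonneg_right this (norm_nonneg v)) _

lemma multiPow_single {n : ℕ} {X : Type*} (D : Fin n → X → X) (j : Fin n) (m : ℕ) (x : X) :
    multiPow D (Pi.single j m) x = (D j)^[m] x := by
  have key : ∀ l : List (Fin n), l.Nodup →
      l.foldr (fun i y => (D i)^[(Pi.single j m : Fin n → ℕ) i] y) x =
        if j ∈ l then (D j)^[m] x else x := by
    intro l hl
    induction l with
    | nil => simp
    | cons i l ih =>
      rw [List.nodup_cons] at hl
      rw [List.foldr_cons, ih hl.2]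
      by_cases h : i = j
      · subst h; simp [hl.1]
      · simp [h, Ne.symm h]
  rw [multiPow, key _ (List.nodup_finRange n)]
  simp

lemma partialD_iterate_coe {n : ℕ} (j : Fin n) (m : ℕ) (ψ : 𝓢(E n, ℂ)) :
    (partialD j)^[m] (ψ : E n → ℂ) =
      ((LineDeriv.lineDerivOp (basisVec j))^[m] ψ : 𝓢(E n, ℂ)) := by
  induction m generalizing ψ with
  | zero => rfl
  | succ m ih =>
    rw [Function.iterate_succ_apply, Function.iterate_succ_apply, ← ih]
    congr 1
    ext ξ
    exact (SchwartzMap.lineDerivOp_apply _ _ _).symm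

lemma backDiff_iterate {n : ℕ} (j : Fin n) (m : ℕ) (f : E n → ℂ) (ξ : E n) :
    (backDiff j)^[m] f ξ =
      (-1) ^ m * ∑ i ∈ Finset.range (m + 1), ((-1) ^ (m - i) * (m.choose i) : ℤ) •
        f (ξ - i • basisVec j) := by
  have : ∀ ξ, (backDiff j)^[m] f ξ = (-1) ^ m * (fwdDiff (-basisVec j))^[m] f ξ := by
    induction m with
    | zero => simp
    | succ m ih =>
      intro ξ
      rw [Function.iterate_succ_apply', Function.iterate_succ_apply', backDiff, fwdDiff, ih, ih,
        ← sub_eq_add_neg]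
      ring
  rw [this, fwdDiff_iter_eq_sum_shift]
  simp [sub_eq_add_neg]

/-- An `m`-th difference kills polynomials of degree less than `m`; only the `j`-th factor moves,
the others come out of the sum. -/
lemma sum_choose_polyProd {n : ℕ} (P : Fin n → Polynomial ℂ) (j : Fin n) (m : ℕ)
    (hm : (P j).natDegree < m) (x : E n) :
    ∑ i ∈ Finset.range (m + 1), ((-1) ^ (m - i) * (m.choose i) : ℤ) •
        polyProd P (x - i • basisVec j) = 0 := by
  -- The shifts go backwards; reflecting the polynomial turns them into the forward differences with
  -- step `1`.
  let R : Polynomial ℂ := (P j).comp (-Polynomial.X)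
  have hR : R.natDegree < m := by
    simpa [R, Polynomial.natDegree_comp] using hm
  have h0 := fwdDiff_iter_eq_sum_shift (1 : ℂ) (fun y => R.eval y) m (-(x j : ℂ))
  have h1 : (fwdDiff (1 : ℂ))^[m] (fun y => R.eval y) = 0 := by
    have : (fun y => R.eval y) = fun y => ∑ i ∈ Finset.range m, R.coeff i * y ^ i := by
      ext y
      exact R.eval_eq_sum_range' hR y
    rw [this, fwdDiff_iter_sum_mul_pow_eq_zero]
  rw [h1] at h0
  have h2 : ∀ i : ℕ, polyProd P (x - i • basisVec j) =
      R.eval (-(x j : ℂ) + i • 1) * ∏ l ∈ Finset.univ.erase j, (P l).eval (x l : ℂ) := by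
    intro i
    rw [polyProd, ← Finset.mul_prod_erase _ _ (Finset.mem_univ j)]
    congr 1
    · simp [R, basisVec]; congr 1; ring
    · refine Finset.prod_congr rfl fun l hl => ?_
      have : l ≠ j := Finset.ne_of_mem_erase hl
      simp [basisVec, this]
  simp only [h2, ← smul_mul_assoc]
  rw [← Finset.sum_mul, ← h0]
  simp

/-- Summation by parts: reindexing the lattice sum moves the differences from `ψ` to the polynomial,
which they annihilate. -/
lemma lattConv_backDiff_iterate_eq_zero {n : ℕ} (ψ : 𝓢(E n, ℂ)) (P : Fin n → Polynomial ℂ)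
    (j : Fin n) (m : ℕ) (hm : (P j).natDegree < m) (ξ : E n) :
    lattConv ((backDiff j)^[m] ψ) (fun k => polyProd P (latt k)) ξ = 0 := by
  obtain ⟨c, d, hp⟩ := exists_polyProd_bound P
  have hs : ∀ i : ℕ, Summable fun k : Fin n → ℤ =>
      ψ (ξ - latt k - i • basisVec j) * polyProd P (latt k) := by
    intro i
    obtain ⟨u, hu, h⟩ := schwartz_latt_bound ψ (fun k => hp (latt k)) ‖ξ - i • basisVec j‖
    refine hu.of_norm_bounded fun k => ?_
    have := h _ le_rfl k
    rwa [show ξ - i • basisVec j - latt k = ξ - latt k - i • basisVec j by abel] at this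
  have hl : ∀ (i : ℕ) (k : Fin n → ℤ),
      latt (k + i • Pi.single j 1) = latt k + i • basisVec j := by
    intro i k
    rw [← latt_single]
    ext l
    simp
  have hshift : ∀ i : ℕ, HasSum (fun k : Fin n → ℤ =>
      ψ (ξ - latt k) * polyProd P (latt k - i • basisVec j))
      (∑' k : Fin n → ℤ, ψ (ξ - latt k - i • basisVec j) * polyProd P (latt k)) := by
    intro i
    rw [← (Equiv.addRight (i • Pi.single j 1 : Fin n → ℤ)).hasSum_iff]
    convert (hs i).hasSum using 2 with k
    simp only [Function.comp, Equiv.coe_addRight, hl]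
    congr 2
    · abel
    · abel
  have h1 := hasSum_sum fun i (_ : i ∈ Finset.range (m + 1)) =>
    (hshift i).mul_left ((((-1) ^ (m - i) * (m.choose i) : ℤ)) : ℂ)
  have h2 : ∀ k : Fin n → ℤ, ∑ i ∈ Finset.range (m + 1),
      (((-1) ^ (m - i) * (m.choose i) : ℤ) : ℂ) *
        (ψ (ξ - latt k) * polyProd P (latt k - i • basisVec j)) = 0 := by
    intro k
    have := sum_choose_polyProd P j m hm (latt k)
    simp only [zsmul_eq_mul] at this
    calc _ = ψ (ξ - latt k) * ∑ i ∈ Finset.range (m + 1),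
          (((-1) ^ (m - i) * (m.choose i) : ℤ) : ℂ) * polyProd P (latt k - i • basisVec j) := by
          rw [Finset.mul_sum]
          exact Finset.sum_congr rfl fun i _ => by ring
      _ = 0 := by rw [this, mul_zero]
  rw [funext h2] at h1
  have h3 := h1.unique hasSum_zero
  have h4 := (hasSum_sum fun i (_ : i ∈ Finset.range (m + 1)) =>
    (hs i).hasSum.mul_left ((((-1) ^ (m - i) * (m.choose i) : ℤ)) : ℂ)).mul_left ((-1 : ℂ) ^ m)
  rw [h3, mul_zero] at h4
  rw [lattConv, ← h4.tsum_eq]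
  refine tsum_congr fun k => ?_
  rw [backDiff_iterate, mul_assoc, Finset.sum_mul]
  simp only [zsmul_eq_mul, mul_assoc]

/-- By condition (ii), a high enough derivative along `e_j` falls on iterated differences of a
Schwartz function and vanishes after summation; the order `natDegree + 1` is enough. -/
lemma exists_polynomial_lattConv {n : ℕ} {φ : 𝓢(E n, ℂ)} (hφ : IsMeyer φ)
    (P : Fin n → Polynomial ℂ) (j : Fin n) (ξ : E n) :
    ∃ Q : Polynomial ℂ, ∀ t : ℝ,
      lattConv φ (fun k => polyProd P (latt k)) (ξ + t • basisVec j) = Q.eval (t : ℂ) := by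
  obtain ⟨c, d, hp⟩ := exists_polyProd_bound P
  refine exists_polynomial_of_hasDerivAt ((P j).natDegree + 1)
    (fun i t => lattConv ((LineDeriv.lineDerivOp (basisVec j))^[i] φ : 𝓢(E n, ℂ))
      (fun k => polyProd P (latt k)) (ξ + t • basisVec j)) (fun i t => ?_) (fun t => ?_)
  · simp only [Function.iterate_succ_apply']
    exact hasDerivAt_lattConv _ (fun k => hp (latt k)) ξ _ t
  · obtain ⟨ψ, hψ⟩ := hφ.derivs (Pi.single j ((P j).natDegree + 1))
    rw [multiPow_single, multiPow_single, partialD_iterate_coe] at hψ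
    simp only [hψ]
    exact lattConv_backDiff_iterate_eq_zero ψ P j _ (Nat.lt_succ_self _) _

lemma exists_polynomial_polyProd {n : ℕ} (P : Fin n → Polynomial ℂ) (j : Fin n) (ξ : E n) :
    ∃ Q : Polynomial ℂ, ∀ t : ℝ, polyProd P (ξ + t • basisVec j) = Q.eval (t : ℂ) := by
  refine ⟨∏ i, (P i).comp (Polynomial.C (ξ i : ℂ) +
    Polynomial.C ((basisVec j i : ℝ) : ℂ) * Polynomial.X), fun t => ?_⟩
  rw [polyProd, Polynomial.eval_prod]
  refine Finset.prod_congr rfl fun i _ => ?_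
  rw [Polynomial.eval_comp]
  congr 1
  simp only [PiLp.add_apply, PiLp.smul_apply, smul_eq_mul, Polynomial.eval_add,
    Polynomial.eval_mul, Polynomial.eval_C, Polynomial.eval_X]
  push_cast
  ring

/-- A function which is polynomial in each variable and vanishes on `ℤⁿ` is zero. -/
lemma eq_zero_of_polynomial_of_latt {n : ℕ} {D : E n → ℂ}
    (hD : ∀ j ξ, ∃ Q : Polynomial ℂ, ∀ t : ℝ, D (ξ + t • basisVec j) = Q.eval (t : ℂ))
    (h0 : ∀ k, D (latt k) = 0) (ξ : E n) : D ξ = 0 := by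
  -- Induction on the set of coordinates allowed to be non-integral; freeing one more uses that a
  -- one-variable polynomial with infinitely many zeros is `0`.
  suffices h : ∀ (s : Finset (Fin n)) (ξ : E n), (∀ i ∉ s, ∃ m : ℤ, ξ i = m) → D ξ = 0 from
    h Finset.univ ξ (by simp)
  intro s
  induction s using Finset.induction_on with
  | empty =>
    intro ξ h
    choose k hk using fun i => h i (by simp)
    rw [show ξ = latt k by ext i; simp [hk]]
    exact h0 k
  | insert j s hj ih =>
    intro ξ h
    obtain ⟨Q, hQ⟩ := hD j ξ
    have hz : ∀ m : ℤ, Q.eval (((m - ξ j : ℝ)) : ℂ) = 0 := by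
      intro m
      rw [← hQ]
      refine ih _ fun i hi => ?_
      by_cases hij : i = j
      · exact ⟨m, by subst hij; simp [basisVec]⟩
      · obtain ⟨l, hl⟩ := h i (by simp [hij, hi])
        exact ⟨l, by simp [basisVec, hij, hl]⟩
    have hQ0 : Q = 0 := by
      refine Polynomial.eq_zero_of_infinite_isRoot Q ?_
      refine (Set.infinite_range_of_injective (f := fun m : ℤ => ((m - ξ j : ℝ) : ℂ)) ?_).mono ?_
      · intro a b hab
        simpa using hab
      · rintro _ ⟨m, rfl⟩
        exact hz m
    have := hQ 0
    simpa [hQ0] using this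

/-- Polynomial reproduction: both sides are polynomial along every coordinate line, and they agree
on `ℤⁿ` because `φ` is there the indicator of the origin. -/
lemma lattConv_polyProd {n : ℕ} {φ : 𝓢(E n, ℂ)} (hφ : IsMeyer φ) (P : Fin n → Polynomial ℂ)
    (ξ : E n) : lattConv φ (fun k => polyProd P (latt k)) ξ = polyProd P ξ := by
  refine sub_eq_zero.1 (eq_zero_of_polynomial_of_latt
    (D := fun ξ => lattConv φ (fun k => polyProd P (latt k)) ξ - polyProd P ξ)
    (fun j ξ => ?_) (fun k => ?_) ξ)
  · obtain ⟨Q, hQ⟩ := exists_polynomial_lattConv hφ P j ξ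
    obtain ⟨R, hR⟩ := exists_polynomial_polyProd P j ξ
    exact ⟨Q - R, fun t => by rw [hQ, hR]; simp⟩
  · rw [lattConv, tsum_eq_single k]
    · simp [hφ.map_zero]
    · intro l hl
      rw [← latt_sub, hφ.map_latt _ (sub_ne_zero.2 hl.symm), zero_mul]

/-- Meyer-type functions have the moments of the Dirac comb. -/
lemma hasSum_multilinear {n : ℕ} {F : Type*} [NormedAddCommGroup F] [NormedSpace ℝ F]
    [NormedSpace ℂ F] [IsScalarTower ℝ ℂ F]
    {φ : 𝓢(E n, ℂ)} (hφ : IsMeyer φ) (ξ : E n) {m : ℕ} (L : E n [×m]→L[ℝ] F) :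
    HasSum (fun k : Fin n → ℤ => φ (ξ - latt k) • L (fun _ => latt k - ξ)) (L 0) := by
  have h1 : ∀ r : Fin m → Fin n, HasSum (fun k : Fin n → ℤ =>
      φ (ξ - latt k) * ((∏ i, (latt k - ξ) (r i) : ℝ) : ℂ))
      ((∏ i : Fin m, (0 : E n) (r i) : ℝ) : ℂ) := by
    intro r
    -- The monomial of `x - ξ` attached to `r`: the exponent of the coordinate `l` is the number of
    -- slots that `r` sends to `l`.
    let P : Fin n → Polynomial ℂ := fun l => (Polynomial.X - Polynomial.C (ξ l : ℂ)) ^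
      (Finset.univ.filter fun i => r i = l).card
    have hP : ∀ x : E n, polyProd P x = ((∏ i, (x - ξ) (r i) : ℝ) : ℂ) := by
      intro x
      rw [polyProd, ← Finset.prod_fiberwise (s := Finset.univ) (g := r)]
      push_cast
      refine Finset.prod_congr rfl fun l _ => ?_
      rw [Finset.prod_congr rfl (g := fun _ => ((x l : ℂ) - ξ l)), Finset.prod_const]
      · simp [P]
      · intro i hi
        simp [(Finset.mem_filter.1 hi).2]
    have h := lattConv_polyProd hφ P ξ
    simp only [lattConv, hP, sub_self] at h
    rw [← h]
    obtain ⟨c, d, hp⟩ := exists_polyProd_bound P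
    obtain ⟨u, hu, h⟩ := schwartz_latt_bound φ (fun k => hp (latt k)) ‖ξ‖
    refine Summable.hasSum (hu.of_norm_bounded fun k => ?_)
    have := h ξ le_rfl k
    rwa [hP] at this
  have hexp : ∀ x : E n, L (fun _ => x) =
      ∑ r : Fin m → Fin n, ((∏ i, x (r i) : ℝ) : ℂ) • L (fun i => basisVec (r i)) := by
    intro x
    have hx : x = ∑ j, x j • basisVec j := by
      ext i
      simp [basisVec, Finset.sum_apply, Pi.single_apply]
    conv_lhs => rw [hx]
    have := L.toMultilinearMap.map_sum (fun (_ : Fin m) (j : Fin n) => x j • basisVec j)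
    refine this.trans (Finset.sum_congr rfl fun r _ => ?_)
    have h2 := L.toMultilinearMap.map_smul_univ (fun i => x (r i)) (fun i => basisVec (r i))
    refine h2.trans ?_
    rw [← Complex.coe_algebraMap, algebraMap_smul]
    rfl
  have h2 := hasSum_sum fun (r : Fin m → Fin n) (_ : r ∈ Finset.univ) =>
    (h1 r).smul_const (L (fun i => basisVec (r i)))
  rw [← hexp 0] at h2
  convert h2 using 2 with k
  · rw [hexp, Finset.smul_sum]
    simp only [smul_smul]
  · rfl

end NCTorus
end

noncomputable section

namespace NCTorus

/-! ## Interpolation of symbols -/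

section Interpolation

variable {n : ℕ} {F : Type*} [NormedAddCommGroup F] [NormedSpace ℝ F] [NormedSpace ℂ F]
  [IsScalarTower ℝ ℂ F]

/-- Smooth maps satisfying the symbol estimates of order `s`. -/
def SymbolBound (s : ℝ) (f : E n → F) : Prop :=
  ContDiff ℝ ∞ f ∧ ∀ m : ℕ, ∃ C : ℝ, ∀ ξ, ‖iteratedFDeriv ℝ m f ξ‖ ≤ C * (1 + ‖ξ‖) ^ (s - m)

lemma SymbolBound.norm_le {s : ℝ} {f : E n → F} (hf : SymbolBound s f) :
    ∃ C : ℝ, 0 ≤ C ∧ ∀ ξ, ‖f ξ‖ ≤ C * (1 + ‖ξ‖) ^ s := by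
  obtain ⟨C, hC⟩ := hf.2 0
  refine ⟨C, ?_, fun ξ => by simpa using hC ξ⟩
  simpa using (norm_nonneg _).trans (hC 0)

lemma SymbolBound.summable {s : ℝ} (hs : s < -n) {f : E n → F} (hf : SymbolBound s f) :
    Summable fun k : Fin n → ℤ => ‖f (latt k)‖ := by
  obtain ⟨C, -, hC⟩ := hf.norm_le
  have := (summable_latt (n := n) (r := -s) (by linarith)).mul_left C
  rw [neg_neg] at this
  exact this.of_nonneg_of_le (fun _ => norm_nonneg _) fun k => hC _

lemma contDiff_smul_translate (φ : 𝓢(E n, ℂ)) (a : E n) (v : F) :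
    ContDiff ℝ ∞ fun ξ => φ (ξ - a) • v :=
  ((φ.smooth ⊤).comp (contDiff_id.sub contDiff_const)).smul contDiff_const

lemma norm_iteratedFDeriv_smul_translate_le (φ : 𝓢(E n, ℂ)) (a : E n) (v : F) (b : ℕ) (ξ : E n) :
    ‖iteratedFDeriv ℝ b (fun ξ => φ (ξ - a) • v) ξ‖ ≤ ‖iteratedFDeriv ℝ b φ (ξ - a)‖ * ‖v‖ := by
  let L : ℂ →L[ℝ] F := (ContinuousLinearMap.toSpanSingleton ℂ v).restrictScalars ℝ
  have hL : ‖L‖ ≤ ‖v‖ := by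
    refine L.opNorm_le_bound (norm_nonneg _) fun z => ?_
    simp [L, norm_smul, mul_comm]
  have h := L.norm_iteratedFDeriv_comp_left (f := fun ξ => φ (ξ - a)) (x := ξ) (N := ∞) (n := b)
    (((φ.smooth ⊤).comp (contDiff_id.sub contDiff_const)).contDiffAt) (by exact_mod_cast le_top)
  rw [iteratedFDeriv_comp_sub'] at h
  refine h.trans ?_
  rw [mul_comm]
  exact mul_le_mul_of_nonneg_left hL (norm_nonneg _)

/-- Domination uses only that the derivatives of `φ` are bounded, so the derivatives of the sum are
bounded but not yet decaying; `iteratedFDeriv_rapid_decay` recovers decay for the difference with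
the symbol. -/
lemma contDiff_tsum_smul_translate [CompleteSpace F] (φ : 𝓢(E n, ℂ)) {v : (Fin n → ℤ) → F}
    (hv : Summable fun k => ‖v k‖) :
    ContDiff ℝ ∞ (fun ξ => ∑' k, φ (ξ - latt k) • v k) ∧
      ∀ b : ℕ, ∃ C : ℝ, ∀ ξ, ‖iteratedFDeriv ℝ b (fun ξ => ∑' k, φ (ξ - latt k) • v k) ξ‖ ≤ C := by
  choose C hC0 hC using fun b => schwartz_decay φ b 0
  simp only [neg_zero, Real.rpow_zero, mul_one] at hC
  have h1 : ∀ (b : ℕ) (k : Fin n → ℤ) (ξ : E n), (b : ℕ∞) ≤ (⊤ : ℕ∞) →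
      ‖iteratedFDeriv ℝ b (fun ξ => φ (ξ - latt k) • v k) ξ‖ ≤ C b * ‖v k‖ := fun b k ξ _ =>
    (norm_iteratedFDeriv_smul_translate_le φ (latt k) (v k) b ξ).trans
      (mul_le_mul_of_nonneg_right (hC b _) (norm_nonneg _))
  have h2 : ∀ b : ℕ, (b : ℕ∞) ≤ (⊤ : ℕ∞) → Summable fun k => C b * ‖v k‖ := fun b _ => hv.mul_left _
  refine ⟨contDiff_tsum (fun k => contDiff_smul_translate φ (latt k) (v k)) h2
    (fun b k ξ hb => h1 b k ξ hb), fun b => ⟨∑' k, C b * ‖v k‖, fun ξ => ?_⟩⟩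
  rw [iteratedFDeriv_tsum_apply (fun k => contDiff_smul_translate φ (latt k) (v k)) h2 h1 le_top]
  exact tsum_of_norm_bounded (h2 b le_top).hasSum fun k => h1 b k ξ le_top

lemma summable_smul_translate [CompleteSpace F] (φ : 𝓢(E n, ℂ)) {v : (Fin n → ℤ) → F}
    (hv : Summable fun k => ‖v k‖) (ξ : E n) : Summable fun k => φ (ξ - latt k) • v k := by
  obtain ⟨C, hC0, hC⟩ := schwartz_decay_zero φ 0
  simp only [neg_zero, Real.rpow_zero, mul_one] at hC
  refine (hv.mul_left C).of_norm_bounded fun k => ?_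
  rw [norm_smul]
  exact mul_le_mul_of_nonneg_right (hC _) (norm_nonneg _)

/-- The error in Taylor's formula for a symbol. -/
lemma SymbolBound.taylor [CompleteSpace F] {s : ℝ} (hs : s ≤ 0) {f : E n → F}
    (hf : SymbolBound s f) (N : ℕ) :
    ∃ C : ℝ, 0 ≤ C ∧ ∀ ξ v : E n, ‖f (ξ + v) - ∑ m ∈ Finset.range (N + 1),
      (m.factorial : ℝ)⁻¹ • iteratedFDeriv ℝ m f ξ (fun _ => v)‖ ≤
        C * (1 + ‖ξ‖) ^ (-(N + 1 - s)) * (1 + ‖v‖) ^ (2 * (N + 1) - s) := by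
  obtain ⟨C, hC⟩ := hf.2 (N + 1)
  have hC0 : 0 ≤ C := by simpa using (norm_nonneg _).trans (hC 0)
  refine ⟨C, hC0, fun ξ v => ?_⟩
  rw [map_add_eq_sum_add_integral_iteratedFDeriv (n := N) (x := ξ) (y := v)
    (fun t _ => (hf.1.contDiffAt).of_le (by exact_mod_cast le_top)), add_sub_cancel_left, norm_smul]
  have h1 : ‖(N.factorial : ℝ)⁻¹‖ ≤ 1 := by
    rw [norm_inv, Real.norm_natCast]
    exact inv_le_one_of_one_le₀ (by exact_mod_cast N.factorial_pos)
  refine (mul_le_mul h1 (intervalIntegral.norm_integral_le_of_norm_le_const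
    (C := C * (1 + ‖ξ‖) ^ (-(N + 1 - s)) * (1 + ‖v‖) ^ (2 * (N + 1) - s)) fun t ht => ?_)
    (norm_nonneg _) zero_le_one).trans_eq (by simp)
  rw [Set.uIoc_of_le zero_le_one] at ht
  have ht0 : 0 ≤ 1 - t := by linarith [ht.2]
  have ht1 : ‖(1 - t) ^ N‖ ≤ 1 := by
    rw [norm_pow, Real.norm_of_nonneg ht0]
    exact pow_le_one₀ ht0 (by linarith [ht.1])
  rw [norm_smul]
  have h2 : ‖t • v‖ ≤ ‖v‖ := by
    rw [norm_smul, Real.norm_of_nonneg ht.1.le]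
    exact mul_le_of_le_one_left (norm_nonneg _) ht.2
  have hNs : (0 : ℝ) ≤ N + 1 - s := by
    have : (0 : ℝ) ≤ N := by positivity
    linarith
  calc ‖(1 - t) ^ N‖ * ‖iteratedFDeriv ℝ (N + 1) f (ξ + t • v) fun _ => v‖
      ≤ 1 * (‖iteratedFDeriv ℝ (N + 1) f (ξ + t • v)‖ * ‖v‖ ^ (N + 1)) := by
        refine mul_le_mul ht1 ?_ (norm_nonneg _) zero_le_one
        simpa using (iteratedFDeriv ℝ (N + 1) f (ξ + t • v)).le_opNorm (fun _ => v)
    -- Moving the base point from `ξ + tv` back to `ξ` costs `N + 1 - s` powers of `1 + ‖v‖` by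
    -- Peetre's inequality, besides the `N + 1` powers of the multilinear form.
    _ ≤ 1 * ((C * ((1 + ‖ξ‖) ^ (-(N + 1 - s)) * (1 + ‖v‖) ^ (N + 1 - s))) *
          (1 + ‖v‖) ^ ((N : ℝ) + 1)) := by
        rw [one_mul, one_mul]
        refine mul_le_mul ((hC _).trans ?_) ?_ (by positivity) (by positivity)
        · refine mul_le_mul_of_nonneg_left ?_ hC0
          have h3 := peetre hNs ξ (t • v)
          rw [show s - ((N + 1 : ℕ) : ℝ) = -(N + 1 - s) by push_cast; ring]
          refine h3.trans ?_
          gcongr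
        · rw [show (N : ℝ) + 1 = ((N + 1 : ℕ) : ℝ) by push_cast; ring, Real.rpow_natCast]
          gcongr
          linarith
    _ = _ := by
        rw [show (2 * ((N : ℝ) + 1) - s) = (N + 1 - s) + (N + 1) by ring,
          Real.rpow_add (by positivity) (N + 1 - s)]
        simp only [one_mul, mul_assoc]

/-- By polynomial reproduction the Taylor polynomials of `f` at `ξ` sum exactly to `f ξ`, so only
the Taylor remainders are left, weighted by the rapidly decaying `φ (ξ - k)`. -/
lemma SymbolBound.tsum_sub_le [CompleteSpace F] {φ : 𝓢(E n, ℂ)} (hφ : IsMeyer φ) {s : ℝ}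
    (hs : s < -n) {f : E n → F} (hf : SymbolBound s f) (N : ℕ) :
    ∃ C : ℝ, ∀ ξ, ‖(∑' k, φ (ξ - latt k) • f (latt k)) - f ξ‖ ≤ C * (1 + ‖ξ‖) ^ (-(N : ℝ)) := by
  have hs0 : s ≤ 0 := by
    have : (0 : ℝ) ≤ n := by positivity
    linarith
  obtain ⟨C, hC0, hC⟩ := hf.taylor hs0 N
  -- This decay of `φ` cancels the growth of the Taylor remainder in `ξ - k` and leaves `n + 1`
  -- powers for the lattice sum.
  obtain ⟨C', hC0', hC'⟩ := schwartz_decay_zero φ ((2 * (N + 1) - s) + (n + 1))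
  obtain ⟨K, hK0, hK⟩ := exists_sum_le (n := n) (r := n + 1) (by linarith)
  refine ⟨C' * C * K, fun ξ => ?_⟩
  have hT : HasSum (fun k : Fin n → ℤ => φ (ξ - latt k) • ∑ m ∈ Finset.range (N + 1),
      (m.factorial : ℝ)⁻¹ • iteratedFDeriv ℝ m f ξ (fun _ => latt k - ξ)) (f ξ) := by
    have h := hasSum_sum fun (m : ℕ) (_ : m ∈ Finset.range (N + 1)) =>
      (hasSum_multilinear hφ ξ (iteratedFDeriv ℝ m f ξ)).const_smul ((m.factorial : ℝ)⁻¹)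
    convert h using 2 with k
    · rw [Finset.smul_sum]
      exact Finset.sum_congr rfl fun m _ => smul_comm _ _ _
    -- Only the term `m = 0` survives, since a multilinear form of positive degree vanishes at `0`.
    · rw [Finset.sum_range_succ']
      simp [ContinuousMultilinearMap.map_zero]
  have hsub := (summable_smul_translate φ (hf.summable hs) ξ).hasSum.sub hT
  rw [← hsub.tsum_eq]
  have hb : ∀ k : Fin n → ℤ, ‖φ (ξ - latt k) • f (latt k) - φ (ξ - latt k) •
      ∑ m ∈ Finset.range (N + 1), (m.factorial : ℝ)⁻¹ •
        iteratedFDeriv ℝ m f ξ (fun _ => latt k - ξ)‖ ≤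
      C' * C * (1 + ‖ξ‖) ^ (-(N : ℝ)) * (1 + ‖ξ - latt k‖) ^ (-((n : ℝ) + 1)) := by
    intro k
    rw [← smul_sub, norm_smul]
    have h1 := hC ξ (latt k - ξ)
    rw [add_sub_cancel] at h1
    have h2 := hC' (ξ - latt k)
    have h3 : (1 + ‖ξ‖) ^ (-(N + 1 - s)) ≤ (1 + ‖ξ‖) ^ (-(N : ℝ)) :=
      Real.rpow_le_rpow_of_exponent_le (by simp) (by linarith)
    calc _ ≤ (C' * (1 + ‖ξ - latt k‖) ^ (-(2 * (N + 1) - s + (n + 1)))) *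
          (C * (1 + ‖ξ‖) ^ (-(N : ℝ)) * (1 + ‖ξ - latt k‖) ^ (2 * (N + 1) - s)) := by
          refine mul_le_mul h2 (h1.trans ?_) (norm_nonneg _) (by positivity)
          rw [norm_sub_rev (latt k) ξ]
          gcongr
      _ = C' * C * (1 + ‖ξ‖) ^ (-(N : ℝ)) * ((1 + ‖ξ - latt k‖) ^ (-(2 * (N + 1) - s + (n + 1))) *
            (1 + ‖ξ - latt k‖) ^ (2 * (N + 1) - s)) := by ring
      _ = _ := by
          rw [← Real.rpow_add (by positivity)]
          congr 2
          ring
  have hKs := (hK ξ).1.mul_left (C' * C * (1 + ‖ξ‖) ^ (-(N : ℝ)))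
  refine (tsum_of_norm_bounded hKs.hasSum hb).trans ?_
  rw [tsum_mul_left]
  calc _ ≤ C' * C * (1 + ‖ξ‖) ^ (-(N : ℝ)) * K :=
        mul_le_mul_of_nonneg_left (hK ξ).2 (by positivity)
    _ = _ := by ring

/-- If `h` is rapidly decaying and its derivative is Lipschitz, then its derivative is rapidly
decaying. -/
lemma fderiv_rapid_decay {G : Type*} [NormedAddCommGroup G] [NormedSpace ℝ G] {h : E n → G}
    (hd : Differentiable ℝ h) {K : ℝ}
    (hK : ∀ x y, ‖fderiv ℝ h y - fderiv ℝ h x‖ ≤ K * ‖y - x‖)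
    (hr : ∀ N : ℕ, ∃ C : ℝ, ∀ ξ, ‖h ξ‖ ≤ C * (1 + ‖ξ‖) ^ (-(N : ℝ))) (N : ℕ) :
    ∃ C : ℝ, ∀ ξ, ‖fderiv ℝ h ξ‖ ≤ C * (1 + ‖ξ‖) ^ (-(N : ℝ)) := by
  obtain ⟨C, hC⟩ := hr (2 * N)
  have hC0 : 0 ≤ C := by simpa using (norm_nonneg _).trans (hC 0)
  refine ⟨|K| + C * 2 ^ (2 * N) + C, fun ξ => ?_⟩
  -- A difference quotient with step `ε`: the values of `h` are `O(ε²)`, whence the decay of order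
  -- `2 * N` above, and the Lipschitz error is `O(ε)`, so the derivative is `O(ε)`.
  let ε : ℝ := (1 + ‖ξ‖) ^ (-(N : ℝ))
  have hε : 0 < ε := by positivity
  have hε1 : ε ≤ 1 := Real.rpow_le_one_of_one_le_of_nonpos (by simp) (by simp)
  have hε2 : (1 + ‖ξ‖) ^ (-((2 * N : ℕ) : ℝ)) = ε * ε := by
    rw [← Real.rpow_add (by positivity)]
    congr 1
    push_cast
    ring
  refine ContinuousLinearMap.opNorm_le_of_unit_norm (by positivity) fun v hv => ?_
  have hball : ∀ x ∈ Metric.closedBall ξ ε, ‖fderiv ℝ h x - fderiv ℝ h ξ‖ ≤ |K| * ε := by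
    intro x hx
    rw [mem_closedBall_iff_norm] at hx
    exact (hK ξ x).trans (mul_le_mul (le_abs_self K) hx (norm_nonneg _) (abs_nonneg _))
  have h1 := (convex_closedBall ξ ε).norm_image_sub_le_of_norm_fderiv_le'
    (fun x _ => hd x) hball (Metric.mem_closedBall_self hε.le)
    (y := ξ + ε • v) (by simp [norm_smul, hv, abs_of_pos hε])
  rw [add_sub_cancel_left, map_smul, norm_smul, hv, mul_one, Real.norm_of_nonneg hε.le] at h1
  have h2 : ‖h (ξ + ε • v)‖ ≤ C * 2 ^ (2 * N) * (ε * ε) := by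
    refine (hC _).trans ?_
    have h3 := peetre (s := ((2 * N : ℕ) : ℝ)) (by positivity) ξ (ε • v)
    rw [norm_smul, hv, mul_one, Real.norm_of_nonneg hε.le, hε2] at h3
    rw [mul_assoc]
    refine mul_le_mul_of_nonneg_left (h3.trans ?_) hC0
    rw [mul_comm, Real.rpow_natCast]
    gcongr
    linarith
  have h3 : ‖h ξ‖ ≤ C * (ε * ε) := by rw [← hε2]; exact hC ξ
  have h4 : ε * ‖fderiv ℝ h ξ v‖ ≤ (|K| + C * 2 ^ (2 * N) + C) * (ε * ε) := by
    have h5 : ‖ε • fderiv ℝ h ξ v‖ ≤ ‖h (ξ + ε • v)‖ + ‖h ξ‖ +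
        ‖h (ξ + ε • v) - h ξ - ε • fderiv ℝ h ξ v‖ := by
      have := norm_sub_le (h (ξ + ε • v) - h ξ) (h (ξ + ε • v) - h ξ - ε • fderiv ℝ h ξ v)
      rw [sub_sub_cancel] at this
      have h6 := norm_sub_le (h (ξ + ε • v)) (h ξ)
      linarith
    rw [norm_smul, Real.norm_of_nonneg hε.le] at h5
    nlinarith
  have h6 : ε * ‖fderiv ℝ h ξ v‖ ≤ ε * ((|K| + C * 2 ^ (2 * N) + C) * ε) := by
    rw [show ε * ((|K| + C * 2 ^ (2 * N) + C) * ε) = (|K| + C * 2 ^ (2 * N) + C) * (ε * ε) by ring]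
    exact h4
  exact le_of_mul_le_mul_left h6 hε

/-- Induction on the order: a bound on the derivative of order `b + 2` makes that of order `b + 1`
Lipschitz, as `fderiv_rapid_decay` requires. -/
lemma iteratedFDeriv_rapid_decay {g : E n → F} (hg : ContDiff ℝ ∞ g)
    (hb : ∀ b : ℕ, ∃ C : ℝ, ∀ ξ, ‖iteratedFDeriv ℝ b g ξ‖ ≤ C)
    (hr : ∀ N : ℕ, ∃ C : ℝ, ∀ ξ, ‖g ξ‖ ≤ C * (1 + ‖ξ‖) ^ (-(N : ℝ))) (b : ℕ) :
    ∀ N : ℕ, ∃ C : ℝ, ∀ ξ, ‖iteratedFDeriv ℝ b g ξ‖ ≤ C * (1 + ‖ξ‖) ^ (-(N : ℝ)) := by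
  have hdiff : ∀ b : ℕ, Differentiable ℝ (iteratedFDeriv ℝ b g) := fun b =>
    hg.differentiable_iteratedFDeriv (by exact_mod_cast ENat.natCast_lt_top b)
  induction b with
  | zero => simpa using hr
  | succ b ih =>
    obtain ⟨K, hK⟩ := hb (b + 2)
    intro N
    have hlip : ∀ x y, ‖fderiv ℝ (iteratedFDeriv ℝ b g) y - fderiv ℝ (iteratedFDeriv ℝ b g) x‖ ≤
        K * ‖y - x‖ := by
      intro x y
      rw [fderiv_iteratedFDeriv]
      simp only [Function.comp_apply]
      rw [← LinearIsometryEquiv.map_sub, LinearIsometryEquiv.norm_map]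
      refine convex_univ.norm_image_sub_le_of_norm_fderiv_le (𝕜 := ℝ)
        (fun z _ => (hdiff (b + 1)) z) (fun z _ => ?_) (Set.mem_univ x) (Set.mem_univ y)
      rw [norm_fderiv_iteratedFDeriv]
      exact hK z
    obtain ⟨C, hC⟩ := fderiv_rapid_decay (hdiff b) hlip ih N
    refine ⟨C, fun ξ => ?_⟩
    rw [← norm_fderiv_iteratedFDeriv]
    exact hC ξ

/-- The interpolation of a symbol differs from it by a rapidly decaying function. -/
theorem SymbolBound.interpolation [CompleteSpace F] {φ : 𝓢(E n, ℂ)} (hφ : IsMeyer φ) {s : ℝ}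
    (hs : s < -n) {f : E n → F} (hf : SymbolBound s f) (b N : ℕ) :
    ∃ C : ℝ, ∀ ξ, ‖iteratedFDeriv ℝ b (fun ξ => (∑' k, φ (ξ - latt k) • f (latt k)) - f ξ) ξ‖ ≤
      C * (1 + ‖ξ‖) ^ (-(N : ℝ)) := by
  obtain ⟨h1, h2⟩ := contDiff_tsum_smul_translate φ (hf.summable hs)
  refine iteratedFDeriv_rapid_decay (h1.sub hf.1) (fun b => ?_) (hf.tsum_sub_le hφ hs) b N
  obtain ⟨C, hC⟩ := h2 b
  obtain ⟨C', hC'⟩ := hf.2 b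
  have hC0' : 0 ≤ C' := by simpa using (norm_nonneg _).trans (hC' 0)
  refine ⟨C + C', fun ξ => ?_⟩
  have h3 : iteratedFDeriv ℝ b (fun ξ => (∑' k, φ (ξ - latt k) • f (latt k)) - f ξ) ξ =
      iteratedFDeriv ℝ b (fun ξ => ∑' k, φ (ξ - latt k) • f (latt k)) ξ -
        iteratedFDeriv ℝ b f ξ :=
    fun_iteratedFDeriv_sub_apply (h1.contDiffAt.of_le (by exact_mod_cast le_top))
      (hf.1.contDiffAt.of_le (by exact_mod_cast le_top))
  rw [h3]
  refine (norm_sub_le _ _).trans (add_le_add (hC ξ) ((hC' ξ).trans ?_))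
  refine mul_le_of_le_one_right hC0' (Real.rpow_le_one_of_one_le_of_nonpos (by simp) ?_)
  have h4 : (0 : ℝ) ≤ n := by positivity
  have h5 : (0 : ℝ) ≤ b := by positivity
  linarith

end Interpolation

end NCTorus
end

noncomputable section

namespace NCTorus

/-! ## Existence of Meyer-type functions -/

open scoped FourierTransform

/-- Smooth functions on the line supported in `[-1, 1]`. -/
def Bump : Type := {a : ℝ → ℂ // ContDiff ℝ ∞ a ∧ ∀ x, 1 < |x| → a x = 0}

/-- Multiplication by a smooth function. -/
def Bump.mul (g : ℝ → ℂ) (hg : ContDiff ℝ ∞ g) (a : Bump) : Bump :=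
  ⟨fun x => g x * a.1 x, hg.mul a.2.1, fun x hx => by simp [a.2.2 x hx]⟩

lemma Bump.mul_iterate (g : ℝ → ℂ) (hg : ContDiff ℝ ∞ g) (a : Bump) (b : ℕ) (x : ℝ) :
    ((Bump.mul g hg)^[b] a).1 x = g x ^ b * a.1 x := by
  induction b generalizing a with
  | zero => simp
  | succ b ih =>
    rw [Function.iterate_succ_apply, ih, pow_succ, Bump.mul]
    ring

/-- The product `∏ᵢ aᵢ(xᵢ)`, as a Schwartz function. -/
def prodBump {n : ℕ} (a : Fin n → Bump) : 𝓢(E n, ℂ) :=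
  HasCompactSupport.toSchwartzMap (f := fun x : E n => ∏ i, (a i).1 (x i))
    (by
      refine HasCompactSupport.intro (K := (WithLp.toLp 2 : (Fin n → ℝ) → E n) ''
        Set.univ.pi fun _ => Set.Icc (-1) 1) ?_ fun x hx => ?_
      · exact (isCompact_univ_pi fun _ => isCompact_Icc).image (PiLp.continuous_toLp 2 _)
      · have : ∃ i, 1 < |x i| := by
          by_contra! h
          exact hx ⟨x.ofLp, fun i _ => abs_le.1 (h i), rfl⟩
        obtain ⟨i, hi⟩ := this
        exact Finset.prod_eq_zero (Finset.mem_univ i) ((a i).2.2 _ hi))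
    (contDiff_prod fun i _ => (a i).2.1.comp (by fun_prop))

lemma prodBump_apply {n : ℕ} (a : Fin n → Bump) (x : E n) :
    prodBump a x = ∏ i, (a i).1 (x i) := rfl

lemma prodBump_update_mul {n : ℕ} (a : Fin n → Bump) (j : Fin n) (g : ℝ → ℂ)
    (hg : ContDiff ℝ ∞ g) (x : E n) :
    prodBump (Function.update a j (Bump.mul g hg (a j))) x = g (x j) * prodBump a x := by
  rw [prodBump_apply, prodBump_apply, ← Finset.mul_prod_erase _ _ (Finset.mem_univ j),
    ← Finset.mul_prod_erase _ (fun i => (a i).1 (x i)) (Finset.mem_univ j)]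
  have h : ∀ i ∈ Finset.univ.erase j,
      (Function.update a j (Bump.mul g hg (a j)) i).1 (x i) = (a i).1 (x i) := fun i hi => by
    rw [Function.update_of_ne (Finset.ne_of_mem_erase hi)]
  rw [Finset.prod_congr rfl h, Function.update_self, ← mul_assoc]
  rfl

/-- An abstract statement for operators acting on one slot of a product at a time. It serves both
`∂_j` and the backward differences, which are multipliers on the Fourier side. -/
lemma multiPow_update {n : ℕ} {X Y : Type*} (D : Fin n → X → X) (Φ : (Fin n → Y) → X) (T : Y → Y)
    (h : ∀ j a, D j (Φ a) = Φ (Function.update a j (T (a j)))) (β : Fin n → ℕ) (a : Fin n → Y) :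
    multiPow D β (Φ a) = Φ fun i => T^[β i] (a i) := by
  have hiter : ∀ (m : ℕ) (j : Fin n) (a : Fin n → Y),
      (D j)^[m] (Φ a) = Φ (Function.update a j (T^[m] (a j))) := by
    intro m j a
    induction m with
    | zero => simp
    | succ m ih =>
      rw [Function.iterate_succ_apply', ih, h]
      congr 1
      simp [Function.iterate_succ_apply']
  have key : ∀ l : List (Fin n), l.Nodup → l.foldr (fun i y => (D i)^[β i] y) (Φ a) =
      Φ fun i => if i ∈ l then T^[β i] (a i) else a i := by
    intro l hl
    induction l with
    | nil => simp
    | cons j l ih =>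
      rw [List.nodup_cons] at hl
      rw [List.foldr_cons, ih hl.2, hiter]
      congr 1
      ext i
      by_cases hij : i = j
      · subst hij; simp [hl.1]
      · simp [hij]
  rw [multiPow, key _ (List.nodup_finRange n)]
  simp

lemma contDiff_ofReal_mul (c : ℂ) : ContDiff ℝ ∞ fun x : ℝ => c * (x : ℂ) :=
  contDiff_const.mul Complex.ofRealCLM.contDiff

lemma contDiff_one_sub_cexp :
    ContDiff ℝ ∞ fun x : ℝ => 1 - Complex.exp (-(2 * π * Complex.I) * (x : ℂ)) :=
  contDiff_const.sub (contDiff_ofReal_mul _).cexp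

lemma inner_basisVec {n : ℕ} (x : E n) (j : Fin n) : inner ℝ x (basisVec j) = x j := by
  simp [basisVec, EuclideanSpace.inner_single_right]

lemma partialD_fourierInv_prodBump {n : ℕ} (j : Fin n) (a : Fin n → Bump) :
    partialD j (𝓕⁻ (prodBump a) : 𝓢(E n, ℂ)) = (𝓕⁻ (prodBump (Function.update a j
      (Bump.mul _ (contDiff_ofReal_mul (2 * π * Complex.I)) (a j)))) : 𝓢(E n, ℂ)) := by
  have h : partialD j (𝓕⁻ (prodBump a) : 𝓢(E n, ℂ)) =
      (LineDeriv.lineDerivOp (basisVec j) (𝓕⁻ (prodBump a) : 𝓢(E n, ℂ)) : 𝓢(E n, ℂ)) := by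
    ext ξ
    exact (SchwartzMap.lineDerivOp_apply _ _ _).symm
  rw [h, SchwartzMap.lineDerivOp_fourierInv_eq]
  congr 2
  ext x
  have hg : (fun y : E n => inner ℝ y (basisVec j)).HasTemperateGrowth := by fun_prop
  rw [prodBump_update_mul, smul_apply, SchwartzMap.smulLeftCLM_apply_apply hg,
    inner_basisVec]
  simp [mul_assoc]

lemma fourierInv_apply {n : ℕ} (f : 𝓢(E n, ℂ)) (w : E n) :
    (𝓕⁻ f : 𝓢(E n, ℂ)) w = ∫ v, Complex.exp (2 * π * Complex.I * (inner ℝ v w : ℝ)) * f v := by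
  rw [SchwartzMap.fourierInv_coe, Real.fourierInv_eq']
  refine integral_congr_ae (Eventually.of_forall fun v => ?_)
  simp only [smul_eq_mul]
  congr 2
  push_cast
  ring

lemma integrable_exp_mul_schwartz {n : ℕ} (f : 𝓢(E n, ℂ)) (w : E n) :
    Integrable fun v => Complex.exp (2 * π * Complex.I * (inner ℝ v w : ℝ)) * f v := by
  refine f.integrable.bdd_mul (c := 1) (Continuous.aestronglyMeasurable (by fun_prop)) ?_
  refine Eventually.of_forall fun v => ?_
  rw [show 2 * π * Complex.I * ((inner ℝ v w : ℝ) : ℂ) =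
    ((2 * π * inner ℝ v w : ℝ) : ℂ) * Complex.I by push_cast; ring, Complex.norm_exp_ofReal_mul_I]

lemma backDiff_fourierInv_prodBump {n : ℕ} (j : Fin n) (a : Fin n → Bump) :
    backDiff j (𝓕⁻ (prodBump a) : 𝓢(E n, ℂ)) = (𝓕⁻ (prodBump (Function.update a j
      (Bump.mul _ contDiff_one_sub_cexp (a j)))) : 𝓢(E n, ℂ)) := by
  ext ξ
  rw [backDiff, fourierInv_apply, fourierInv_apply, fourierInv_apply,
    ← integral_sub (integrable_exp_mul_schwartz _ _) (integrable_exp_mul_schwartz _ _)]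
  refine integral_congr_ae (Eventually.of_forall fun v => ?_)
  simp only
  rw [prodBump_update_mul, inner_sub_right, inner_basisVec]
  rw [Complex.ofReal_sub, mul_sub, Complex.exp_sub, neg_mul, Complex.exp_neg]
  ring

/-- The entire function `(exp z - 1) / z`. -/
lemma contDiff_dslope_exp :
    ContDiff ℝ ∞ fun x : ℝ => dslope Complex.exp 0 (-(2 * π * Complex.I) * (x : ℂ)) := by
  have h1 : Differentiable ℂ (dslope Complex.exp 0) := by
    rw [← differentiableOn_univ, Complex.differentiableOn_dslope univ_mem]
    exact Complex.differentiable_exp.differentiableOn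
  exact (h1.contDiff.restrict_scalars ℝ).comp (contDiff_ofReal_mul _)

lemma dslope_exp_mul (x : ℝ) : 2 * π * Complex.I * (x : ℂ) *
    dslope Complex.exp 0 (-(2 * π * Complex.I) * (x : ℂ)) =
      1 - Complex.exp (-(2 * π * Complex.I) * (x : ℂ)) := by
  have h := sub_smul_dslope Complex.exp 0 (-(2 * π * Complex.I) * (x : ℂ))
  rw [smul_eq_mul, Complex.exp_zero, sub_zero] at h
  linear_combination -h

/-- The zeros of `1 - e^{-2πix}` are the integers, and the one at `x = 0` is removed by dividing by
`2πix`. -/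
lemma dslope_exp_ne_zero {x : ℝ} (hx : |x| < 1) :
    dslope Complex.exp 0 (-(2 * π * Complex.I) * (x : ℂ)) ≠ 0 := by
  by_cases h0 : x = 0
  · subst h0
    simp [dslope_same]
  intro h
  have h1 := dslope_exp_mul x
  rw [h, mul_zero, eq_comm, sub_eq_zero, eq_comm, Complex.exp_eq_one_iff] at h1
  obtain ⟨m, hm⟩ := h1
  have h2 : -(2 * π * Complex.I) * (x : ℂ) - m * (2 * π * Complex.I) = 0 := sub_eq_zero.2 hm
  have h3 : (2 * π * Complex.I) * (-(x : ℂ) - m) = 0 := by linear_combination h2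
  rcases mul_eq_zero.1 h3 with h4 | h4
  · exact Complex.two_pi_I_ne_zero h4
  · have h5 : -x = m := by
      have := sub_eq_zero.1 h4
      exact_mod_cast this
    have h6 : |(m : ℝ)| < 1 := by rw [← h5, abs_neg]; exact hx
    have h7 : m = 0 := by
      rw [← Int.cast_abs] at h6
      exact Int.abs_lt_one_iff.1 (by exact_mod_cast h6)
    rw [h7] at h5
    simp at h5
    exact h0 h5

/-- A smooth step function. -/
def meyerStep (x : ℝ) : ℝ := Real.smoothTransition (2 * x + 3 / 2)

lemma contDiff_meyerStep : ContDiff ℝ ∞ meyerStep :=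
  Real.smoothTransition.contDiff.comp (by fun_prop)

lemma meyerStep_eq_zero {x : ℝ} (hx : x ≤ -(3 / 4)) : meyerStep x = 0 :=
  Real.smoothTransition.zero_of_nonpos (by linarith)

lemma meyerStep_eq_one {x : ℝ} (hx : -(1 / 4) ≤ x) : meyerStep x = 1 :=
  Real.smoothTransition.one_of_one_le (by linarith)

/-- The one-dimensional profile of the Fourier transform of a Meyer-type function. -/
def meyerProfile (x : ℝ) : ℂ := ((meyerStep x - meyerStep (x - 1) : ℝ) : ℂ)

lemma meyerProfile_eq_zero {x : ℝ} (hx : 3 / 4 ≤ |x|) : meyerProfile x = 0 := by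
  rcases le_abs.1 hx with h | h
  · rw [meyerProfile, meyerStep_eq_one (by linarith), meyerStep_eq_one (by linarith)]
    simp
  · rw [meyerProfile, meyerStep_eq_zero (by linarith), meyerStep_eq_zero (by linarith)]
    simp

lemma contDiff_meyerProfile : ContDiff ℝ ∞ meyerProfile :=
  Complex.ofRealCLM.contDiff.comp
    (contDiff_meyerStep.sub (contDiff_meyerStep.comp (contDiff_id.sub contDiff_const)))

/-- The quotients `(2πix / (1 - e^{-2πix}))^b h(x)`, where `h` is the profile. -/
def meyerBump (b : ℕ) : Bump :=
  ⟨fun x => (dslope Complex.exp 0 (-(2 * π * Complex.I) * (x : ℂ)))⁻¹ ^ b * meyerProfile x, by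
    rw [contDiff_iff_contDiffAt]
    intro x
    -- For `|x| < 1` the denominator does not vanish; elsewhere the profile is zero near `x`. The
    -- support in `|x| ≤ 3/4` leaves room for both.
    by_cases hx : |x| < 1
    · exact ((contDiff_dslope_exp.contDiffAt.inv (dslope_exp_ne_zero hx)).pow b).mul
        contDiff_meyerProfile.contDiffAt
    · have : ∀ᶠ y in 𝓝 x, 3 / 4 < |y| :=
        (continuous_abs.continuousAt).eventually_const_lt (by linarith [not_lt.1 hx])
      refine (contDiffAt_const (c := (0 : ℂ))).congr_of_eventuallyEq ?_
      filter_upwards [this] with y hy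
      rw [meyerProfile_eq_zero hy.le, mul_zero],
    fun x hx => by simp [meyerProfile_eq_zero (x := x) (by linarith)]⟩

lemma meyerBump_zero_apply (x : ℝ) : (meyerBump 0).1 x = meyerProfile x := by
  simp [meyerBump]

/-- Condition (ii) on the Fourier side: the multiplier `(2πix)^b` of the derivative is `(1 -
e^{-2πix})^b`, that of the difference, times a quotient smooth on the support of the profile. -/
lemma meyerBump_iterate (b : ℕ) :
    (Bump.mul _ (contDiff_ofReal_mul (2 * π * Complex.I)))^[b] (meyerBump 0) =
      (Bump.mul _ contDiff_one_sub_cexp)^[b] (meyerBump b) := by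
  apply Subtype.ext
  ext x
  rw [Bump.mul_iterate, Bump.mul_iterate, meyerBump_zero_apply]
  by_cases hx : 3 / 4 ≤ |x|
  · simp [meyerBump, meyerProfile_eq_zero hx]
  · have := dslope_exp_ne_zero (x := x) (by linarith [not_le.1 hx])
    rw [meyerBump, ← mul_assoc, ← mul_pow, ← dslope_exp_mul, mul_assoc _ _ (_⁻¹),
      mul_inv_cancel₀ this, mul_one]

/-- The profile is `s(x) - s(x - 1)` for a step `s`, and the exponential has period `1`, so the
integral telescopes to the one over `[0, 1]`. -/
lemma integral_exp_mul_meyerProfile (k : ℤ) :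
    ∫ x : ℝ, Complex.exp (2 * π * Complex.I * (k * x : ℝ)) * meyerProfile x =
      if k = 0 then 1 else 0 := by
  let e : ℝ → ℂ := fun x => Complex.exp (2 * π * Complex.I * (k * x : ℝ))
  let f : ℝ → ℂ := fun x => e x * (meyerStep x : ℂ)
  have he : Continuous e := by fun_prop
  have hf : Continuous f :=
    he.mul (Complex.continuous_ofReal.comp contDiff_meyerStep.continuous)
  have hi : ∀ a b : ℝ, IntervalIntegrable f volume a b := fun a b => hf.intervalIntegrable a b
  have hper : ∀ x, e (x - 1) = e x := by
    intro x
    have : 2 * π * Complex.I * ((k * (x - 1) : ℝ) : ℂ) =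
        2 * π * Complex.I * ((k * x : ℝ) : ℂ) - k * (2 * π * Complex.I) := by push_cast; ring
    simp only [e, this, Complex.exp_sub, Complex.exp_int_mul_two_pi_mul_I, div_one]
  have h1 : ∫ x : ℝ, e x * meyerProfile x = ∫ x in (-1 : ℝ)..1, e x * meyerProfile x := by
    refine (intervalIntegral.integral_eq_integral_of_support_subset fun x hx => ?_).symm
    by_contra h
    refine hx ?_
    have : 3 / 4 ≤ |x| := by
      rw [Set.mem_Ioc, not_and_or] at h
      rcases h with h | h
      · exact (by linarith : 3 / 4 ≤ -x).trans (neg_le_abs x)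
      · exact (by linarith : 3 / 4 ≤ x).trans (le_abs_self x)
    simp [meyerProfile_eq_zero this]
  have h2 : ∫ x in (-1 : ℝ)..1, e x * meyerProfile x =
      (∫ x in (-1 : ℝ)..1, f x) - ∫ x in (-1 : ℝ)..1, f (x - 1) := by
    have hf' : Continuous fun x => f (x - 1) := by fun_prop
    rw [← intervalIntegral.integral_sub (hi _ _) (hf'.intervalIntegrable _ _)]
    refine intervalIntegral.integral_congr fun x _ => ?_
    simp only [f, hper, meyerProfile]
    push_cast
    ring
  have h3 : ∫ x in (-2 : ℝ)..(-1), f x = 0 := by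
    rw [intervalIntegral.integral_congr (g := fun _ => 0), intervalIntegral.integral_zero]
    intro x hx
    rw [Set.uIcc_of_le (by norm_num)] at hx
    simp [f, meyerStep_eq_zero (show x ≤ -(3 / 4) by linarith [hx.2])]
  have h4 : ∫ x in (0 : ℝ)..1, f x = ∫ x in (0 : ℝ)..1, e x := by
    refine intervalIntegral.integral_congr fun x hx => ?_
    rw [Set.uIcc_of_le (by norm_num)] at hx
    simp [f, meyerStep_eq_one (show -(1 / 4) ≤ x by linarith [hx.1])]
  have h5 : ∫ x : ℝ, e x * meyerProfile x = ∫ x in (0 : ℝ)..1, e x := by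
    rw [h1, h2, intervalIntegral.integral_comp_sub_right, show (-1 : ℝ) - 1 = -2 by norm_num,
      sub_self, ← intervalIntegral.integral_add_adjacent_intervals (hi (-1) 0) (hi 0 1),
      ← intervalIntegral.integral_add_adjacent_intervals (hi (-2) (-1)) (hi (-1) 0), h3, h4]
    ring
  refine h5.trans ?_
  split_ifs with hk
  · subst hk
    simp [e]
  · have hc : (2 * π * Complex.I * k : ℂ) ≠ 0 :=
      mul_ne_zero Complex.two_pi_I_ne_zero (by exact_mod_cast hk)
    have : ∀ x : ℝ, e x = Complex.exp (2 * π * Complex.I * k * x) := fun x => by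
      simp only [e]; congr 1; push_cast; ring
    simp only [this]
    rw [integral_exp_mul_complex hc]
    simp only [Complex.ofReal_one, mul_one, Complex.ofReal_zero, mul_zero, Complex.exp_zero]
    rw [mul_comm (2 * π * Complex.I) (k : ℂ), Complex.exp_int_mul_two_pi_mul_I, sub_self, zero_div]

lemma integral_prod_euclidean {n : ℕ} (f : Fin n → ℝ → ℂ) :
    ∫ x : E n, ∏ i, f i (x i) = ∏ i, ∫ x, f i x := by
  rw [← integral_fintype_prod_volume_eq_prod,
    ← (EuclideanSpace.volume_preserving_symm_measurableEquiv_toLp (Fin n)).integral_comp']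
  rfl

lemma fourierInv_prodBump_latt {n : ℕ} (k : Fin n → ℤ) :
    (𝓕⁻ (prodBump fun _ : Fin n => meyerBump 0) : 𝓢(E n, ℂ)) (latt k) =
      if k = 0 then 1 else 0 := by
  rw [fourierInv_apply]
  have : ∀ v : E n, Complex.exp (2 * π * Complex.I * (inner ℝ v (latt k) : ℝ)) *
      prodBump (fun _ : Fin n => meyerBump 0) v =
      ∏ i, Complex.exp (2 * π * Complex.I * (k i * v i : ℝ)) * meyerProfile (v i) := by
    intro v
    rw [prodBump_apply, Finset.prod_mul_distrib, ← Complex.exp_sum, ← Finset.mul_sum]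
    simp only [meyerBump_zero_apply]
    congr 3
    rw [PiLp.inner_apply]
    push_cast
    exact Finset.sum_congr rfl fun i _ => by simp
  simp only [this]
  rw [integral_prod_euclidean fun i x =>
    Complex.exp (2 * π * Complex.I * (k i * x : ℝ)) * meyerProfile x]
  simp only [integral_exp_mul_meyerProfile]
  split_ifs with hk
  · simp [hk]
  · obtain ⟨i, hi⟩ := Function.ne_iff.1 hk
    exact Finset.prod_eq_zero (Finset.mem_univ i) (if_neg hi)

theorem exists_isMeyer (n : ℕ) : ∃ φ : 𝓢(E n, ℂ), IsMeyer φ := by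
  refine ⟨𝓕⁻ (prodBump fun _ => meyerBump 0), ?_, fun k hk => ?_, fun β => ?_, ?_⟩
  · rw [← latt_zero, fourierInv_prodBump_latt, if_pos rfl]
  · rw [fourierInv_prodBump_latt, if_neg hk]
  · refine ⟨𝓕⁻ (prodBump fun i => meyerBump (β i)), ?_⟩
    rw [multiPow_update partialD (fun a => ((𝓕⁻ (prodBump a) : 𝓢(E n, ℂ)) : E n → ℂ)) _
        partialD_fourierInv_prodBump,
      multiPow_update backDiff (fun a => ((𝓕⁻ (prodBump a) : 𝓢(E n, ℂ)) : E n → ℂ)) _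
        backDiff_fourierInv_prodBump]
    simp only [meyerBump_iterate]
  -- The integral is the Fourier transform at `0`, that is, the product of the values of the profile
  -- at `0`.
  · have h1 : (𝓕 (𝓕⁻ (prodBump fun _ : Fin n => meyerBump 0) : 𝓢(E n, ℂ)) : 𝓢(E n, ℂ)) 0 = 1 := by
      rw [FourierTransform.fourier_fourierInv_eq, prodBump_apply]
      refine Finset.prod_eq_one fun i _ => ?_
      rw [meyerBump_zero_apply, meyerProfile, PiLp.zero_apply, meyerStep_eq_one (by norm_num),
        meyerStep_eq_zero (by norm_num)]
      simp
    rw [← h1, SchwartzMap.fourier_coe, Real.fourier_eq']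
    simp

end NCTorus
end

noncomputable section

namespace NCTorus

/-! ## The Weyl unitaries -/

variable {n : ℕ}

lemma mulOp_coe (f : C(Torus n, ℂ)) (g : L2 n) :
    mulOp f g =ᵐ[torusMeasure n] fun x => f x * g x := by
  have h1 : mulOp f g =ᵐ[torusMeasure n] fun x =>
      (ContinuousMap.toLp ∞ (torusMeasure n) ℂ f) x * g x :=
    (ContinuousLinearMap.mul ℂ ℂ).coeFn_holder (r := 2)
      (ContinuousMap.toLp ∞ (torusMeasure n) ℂ f) g
  filter_upwards [h1, ContinuousMap.coeFn_toLp (p := ∞) (𝕜 := ℂ) (torusMeasure n) f] with x h1 h2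
  rw [h1, h2]

lemma translate_coe (a : Torus n) (g : L2 n) :
    translate a g =ᵐ[torusMeasure n] fun x => g (x + a) :=
  Lp.coeFn_compMeasurePreserving g (measurePreserving_add_right (torusMeasure n) a)

lemma ae_translate {p : Torus n → Prop} (a : Torus n) (h : ∀ᵐ x ∂torusMeasure n, p x) :
    ∀ᵐ x ∂torusMeasure n, p (x + a) :=
  (measurePreserving_add_right (torusMeasure n) a).quasiMeasurePreserving.ae h

lemma mulOp_mul (f g : C(Torus n, ℂ)) : mulOp f * mulOp g = mulOp (f * g) := by
  ext1 u
  apply Lp.ext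
  filter_upwards [mulOp_coe f (mulOp g u), mulOp_coe g u, mulOp_coe (f * g) u] with x h1 h2 h3
  rw [mul_apply_eq_comp, h1, h2, h3, ContinuousMap.mul_apply, mul_assoc]

lemma translate_mul (a b : Torus n) : translate a * translate b = translate (a + b) := by
  ext1 u
  apply Lp.ext
  filter_upwards [translate_coe a (translate b u), ae_translate a (translate_coe b u),
    translate_coe (a + b) u] with x h1 h2 h3
  rw [mul_apply_eq_comp, h1, h2, h3, add_assoc]

lemma mulOp_one : mulOp (1 : C(Torus n, ℂ)) = 1 := by
  ext1 u
  apply Lp.ext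
  filter_upwards [mulOp_coe 1 u] with x h1
  rw [h1]
  simp

lemma translate_zero : translate (0 : Torus n) = 1 := by
  ext1 u
  apply Lp.ext
  filter_upwards [translate_coe 0 u] with x h1
  rw [h1]
  simp

lemma translate_mul_mulOp {a : Torus n} {f : C(Torus n, ℂ)} {c : ℂ}
    (h : ∀ x, f (x + a) = c * f x) : translate a * mulOp f = c • (mulOp f * translate a) := by
  ext1 u
  apply Lp.ext
  have h3 := Lp.coeFn_smul c (mulOp f (translate a u))
  filter_upwards [translate_coe a (mulOp f u), ae_translate a (mulOp_coe f u),
    mulOp_coe f (translate a u), translate_coe a u, h3] with x h1 h2 h3 h4 h5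
  rw [mul_apply_eq_comp, h1, h2, h]
  refine Eq.trans ?_ h5.symm
  rw [Pi.smul_apply, h3, h4, smul_eq_mul, mul_assoc]

lemma norm_translate (a : Torus n) (u : L2 n) : ‖translate a u‖ = ‖u‖ :=
  Lp.norm_compMeasurePreserving u (measurePreserving_add_right (torusMeasure n) a)

/-- The pairing of `ℤⁿ` and `ℝⁿ`. -/
def pair (k : Fin n → ℤ) (v : Fin n → ℝ) : ℝ := ∑ i, (k i : ℝ) * v i

lemma pair_neg_left (k : Fin n → ℤ) (v : Fin n → ℝ) : pair (-k) v = -pair k v := by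
  simp [pair]

lemma pair_single (k : Fin n → ℤ) (j : Fin n) (c : ℝ) : pair k (Pi.single j c) = k j * c := by
  simp [pair, Pi.single_apply]

/-- The point of the torus below `v`. -/
def torusPt (v : Fin n → ℝ) : Torus n := fun i => ((v i : ℝ) : AddCircle (2 * π))

lemma torusPt_add (v w : Fin n → ℝ) : torusPt (v + w) = torusPt v + torusPt w := by
  ext i; simp [torusPt]

/-- The character `e^{ik·x}`. -/
def expChar (k : Fin n → ℤ) : C(Torus n, ℂ) where
  toFun x := ∏ i, fourier (k i) (x i)
  continuous_toFun := by fun_prop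

lemma expChar_apply (k : Fin n → ℤ) (x : Torus n) : expChar k x = ∏ i, fourier (k i) (x i) := rfl

lemma expChar_add (k l : Fin n → ℤ) : expChar (k + l) = expChar k * expChar l := by
  ext x
  simp only [expChar_apply, ContinuousMap.mul_apply, Pi.add_apply, fourier_add,
    Finset.prod_mul_distrib]

lemma expChar_zero : expChar (0 : Fin n → ℤ) = 1 := by
  ext x
  simp [expChar_apply]

lemma expChar_single (j : Fin n) : expChar (Pi.single j 1) = expCoord j := by
  ext x
  rw [expChar_apply, Finset.prod_eq_single j]
  · simp [expCoord]
  · intro i _ hi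
    simp [hi]
  · simp

lemma norm_expChar_apply (k : Fin n → ℤ) (x : Torus n) : ‖expChar k x‖ = 1 := by
  rw [expChar_apply, norm_prod]
  exact Finset.prod_eq_one fun i _ => by rw [fourier_apply, Circle.norm_coe]

lemma expChar_neg_apply (k : Fin n → ℤ) (x : Torus n) :
    expChar (-k) x = starRingEnd ℂ (expChar k x) := by
  simp only [expChar_apply, Pi.neg_apply, fourier_neg, map_prod]

lemma expChar_add_torusPt (k : Fin n → ℤ) (v : Fin n → ℝ) (x : Torus n) :
    expChar k (x + torusPt v) = Complex.exp (Complex.I * pair k v) * expChar k x := by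
  simp only [expChar_apply, Pi.add_apply]
  have h : ∀ i, fourier (k i) (x i + torusPt v i) =
      Complex.exp (Complex.I * (k i * v i : ℝ)) * fourier (k i) (x i) := by
    intro i
    have h1 : fourier (k i) (torusPt v i) = Complex.exp (Complex.I * (k i * v i : ℝ)) := by
      rw [torusPt, fourier_coe_apply]
      congr 1
      have : (π : ℂ) ≠ 0 := by exact_mod_cast Real.pi_ne_zero
      push_cast
      field_simp
    rw [← h1]
    simp only [fourier_apply, smul_add, AddCircle.toCircle_add, Circle.coe_mul]
    ring
  simp only [h, Finset.prod_mul_distrib]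
  rw [← Complex.exp_sum, ← Finset.mul_sum, pair]
  push_cast
  rfl

/-- The vector `πθk`. -/
def rot (θ : Matrix (Fin n) (Fin n) ℝ) (k : Fin n → ℤ) : Fin n → ℝ :=
  fun i => π * ∑ j, θ i j * k j

lemma rot_add (θ : Matrix (Fin n) (Fin n) ℝ) (k l : Fin n → ℤ) :
    rot θ (k + l) = rot θ k + rot θ l := by
  ext i
  simp [rot, mul_add, Finset.sum_add_distrib]

/-- Antisymmetry kills the quadratic form of `θ`. As a result, no phase appears in `W_k W_{-k} = 1`.
-/
lemma pair_rot_self {θ : Matrix (Fin n) (Fin n) ℝ} (hθ : θᵀ = -θ) (k : Fin n → ℤ) :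
    pair k (rot θ k) = 0 := by
  have h : ∀ i j, θ i j = -θ j i := fun i j => by
    have := congrFun (congrFun hθ j) i
    simpa using this
  have h1 : ∑ i, ∑ j, (k i : ℝ) * (θ i j * k j) = -∑ i, ∑ j, (k i : ℝ) * (θ i j * k j) := by
    conv_lhs => rw [Finset.sum_comm]
    rw [← Finset.sum_neg_distrib]
    refine Finset.sum_congr rfl fun i _ => ?_
    rw [← Finset.sum_neg_distrib]
    refine Finset.sum_congr rfl fun j _ => ?_
    rw [h j i]
    ring
  have h2 : pair k (rot θ k) = π * ∑ i, ∑ j, (k i : ℝ) * (θ i j * k j) := by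
    rw [pair, Finset.mul_sum]
    refine Finset.sum_congr rfl fun i _ => ?_
    rw [rot, ← Finset.mul_sum]
    ring
  rw [h2, show ∑ i, ∑ j, (k i : ℝ) * (θ i j * k j) = 0 by linarith, mul_zero]

/-- The Weyl unitaries `(W_k f)(x) = e^{ik·x} f(x + πθk)`. -/
def W (θ : Matrix (Fin n) (Fin n) ℝ) (k : Fin n → ℤ) : B n :=
  mulOp (expChar k) * translate (torusPt (rot θ k))

/-- The cocycle of the Weyl unitaries. -/
def cocycle (θ : Matrix (Fin n) (Fin n) ℝ) (k l : Fin n → ℤ) : ℂ :=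
  Complex.exp (Complex.I * pair l (rot θ k))

lemma norm_exp_I_mul (r : ℝ) : ‖Complex.exp (Complex.I * r)‖ = 1 := by
  rw [mul_comm, Complex.norm_exp_ofReal_mul_I]

lemma norm_cocycle (θ : Matrix (Fin n) (Fin n) ℝ) (k l : Fin n → ℤ) : ‖cocycle θ k l‖ = 1 :=
  norm_exp_I_mul _

lemma cocycle_ne_zero (θ : Matrix (Fin n) (Fin n) ℝ) (k l : Fin n → ℤ) : cocycle θ k l ≠ 0 :=
  Complex.exp_ne_zero _

/-- Moving the translation by `πθk` past the character `e^{il·x}` produces the phase; characters and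
translations each multiply without one. -/
lemma W_mul (θ : Matrix (Fin n) (Fin n) ℝ) (k l : Fin n → ℤ) :
    W θ k * W θ l = cocycle θ k l • W θ (k + l) := by
  have h := translate_mul_mulOp (a := torusPt (rot θ k)) (f := expChar l)
    (expChar_add_torusPt l (rot θ k))
  calc W θ k * W θ l
      = mulOp (expChar k) * (translate (torusPt (rot θ k)) * mulOp (expChar l)) *
          translate (torusPt (rot θ l)) := by simp only [W, mul_assoc]
    _ = cocycle θ k l • ((mulOp (expChar k) * mulOp (expChar l)) *
          (translate (torusPt (rot θ k)) * translate (torusPt (rot θ l)))) := by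
        rw [h, mul_smul_comm, smul_mul_assoc]
        simp only [mul_assoc]
        rfl
    _ = _ := by rw [mulOp_mul, translate_mul, ← expChar_add, ← torusPt_add, ← rot_add]; rfl

lemma W_zero (θ : Matrix (Fin n) (Fin n) ℝ) : W θ 0 = 1 := by
  have h : torusPt (rot θ 0) = (0 : Torus n) := by
    ext i; simp [torusPt, rot]
  rw [W, expChar_zero, mulOp_one, h, translate_zero, mul_one]

lemma cocycle_neg {θ : Matrix (Fin n) (Fin n) ℝ} (hθ : θᵀ = -θ) (k : Fin n → ℤ) :
    cocycle θ k (-k) = 1 := by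
  rw [cocycle, pair_neg_left, pair_rot_self hθ]
  simp

lemma W_mul_W_neg {θ : Matrix (Fin n) (Fin n) ℝ} (hθ : θᵀ = -θ) (k : Fin n → ℤ) :
    W θ k * W θ (-k) = 1 := by
  rw [W_mul, cocycle_neg hθ, add_neg_cancel, W_zero, one_smul]

lemma norm_mulOp_expChar (k : Fin n → ℤ) (u : L2 n) : ‖mulOp (expChar k) u‖ = ‖u‖ := by
  rw [Lp.norm_def, Lp.norm_def]
  congr 1
  refine eLpNorm_congr_norm_ae ?_
  filter_upwards [mulOp_coe (expChar k) u] with x hx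
  rw [hx, norm_mul, norm_expChar_apply, one_mul]

lemma norm_W_apply (θ : Matrix (Fin n) (Fin n) ℝ) (k : Fin n → ℤ) (u : L2 n) :
    ‖W θ k u‖ = ‖u‖ := by
  rw [W, mul_apply_eq_comp, norm_mulOp_expChar, norm_translate]

lemma norm_W_le (θ : Matrix (Fin n) (Fin n) ℝ) (k : Fin n → ℤ) : ‖W θ k‖ ≤ 1 :=
  ContinuousLinearMap.opNorm_le_bound _ zero_le_one fun u => by rw [norm_W_apply, one_mul]

/-- `W_k` is isometric, so its adjoint is a left inverse and must equal the right inverse `W_{-k}`.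
-/
lemma star_W {θ : Matrix (Fin n) (Fin n) ℝ} (hθ : θᵀ = -θ) (k : Fin n → ℤ) :
    star (W θ k) = W θ (-k) := by
  have h1 : star (W θ k) * W θ k = 1 := by
    rw [ContinuousLinearMap.star_eq_adjoint]
    exact (ContinuousLinearMap.norm_map_iff_adjoint_comp_self _).1 (norm_W_apply θ k)
  calc star (W θ k) = star (W θ k) * (W θ k * W θ (-k)) := by rw [W_mul_W_neg hθ, mul_one]
    _ = W θ (-k) := by rw [← mul_assoc, h1, one_mul]

lemma U_eq_W (θ : Matrix (Fin n) (Fin n) ℝ) (j : Fin n) : U θ j = W θ (Pi.single j 1) := by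
  rw [U, W, expChar_single, ContinuousLinearMap.mul_def]
  congr 2
  ext i
  simp [torusPt, rot, Pi.single_apply]

/-! ### The action of `ℝⁿ` -/

/-- `α_s` as a continuous linear map. -/
def actL (s : E n) : B n →L[ℂ] B n :=
  (ContinuousLinearMap.mul ℂ (B n) (V s)) ∘L ((ContinuousLinearMap.mul ℂ (B n)).flip (V (-s)))

lemma actL_apply (s : E n) (T : B n) : actL s T = act s T := by
  simp [actL, act, mul_assoc]

lemma V_eq (s : E n) : V s = translate (torusPt s.ofLp) := rfl

lemma V_add (s t : E n) : V (s + t) = V s * V t := by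
  rw [V_eq, V_eq, V_eq, translate_mul, ← torusPt_add]
  rfl

lemma act_add (s t : E n) (T : B n) : act (s + t) T = act s (act t T) := by
  simp only [act, neg_add_rev, V_add, mul_assoc]

lemma act_W (θ : Matrix (Fin n) (Fin n) ℝ) (s : E n) (k : Fin n → ℤ) :
    act s (W θ k) = Complex.exp (Complex.I * pair k s) • W θ k := by
  have h := translate_mul_mulOp (a := torusPt s.ofLp) (f := expChar k)
    (expChar_add_torusPt k s.ofLp)
  calc act s (W θ k) = (V s * mulOp (expChar k)) * (translate (torusPt (rot θ k)) * V (-s)) := by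
        simp only [act, W, mul_assoc]
    _ = Complex.exp (Complex.I * pair k s) • (mulOp (expChar k) *
          (V s * (translate (torusPt (rot θ k)) * V (-s)))) := by
        rw [V_eq, h, smul_mul_assoc, mul_assoc]
    _ = _ := by
        rw [V_eq, V_eq, translate_mul, translate_mul, W]
        congr 3
        rw [← torusPt_add, ← torusPt_add]
        congr 1
        ext i
        simp

lemma V_oneL2 (s : E n) : V s (oneL2 n) = oneL2 n := by
  apply Lp.ext
  have h := Lp.coeFn_const (p := 2) (μ := torusMeasure n) (1 : ℂ)
  filter_upwards [translate_coe (torusPt s.ofLp) (oneL2 n), h,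
    ae_translate (torusPt s.ofLp) h] with x h1 h2 h3
  rw [V_eq, h1]
  exact h3.trans h2.symm

lemma τ_act (s : E n) (T : B n) : τ (act s T) = τ T := by
  have h : ∀ f g : L2 n, inner ℂ (V s f) (V s g) = (inner ℂ f g : ℂ) := fun f g =>
    (Lp.compMeasurePreservingₗᵢ (p := 2) (E := ℂ) ℂ _
      (measurePreserving_add_right (torusMeasure n) (torusPt s.ofLp))).inner_map_map f g
  rw [τ, act, mul_apply_eq_comp, mul_apply_eq_comp, V_oneL2]
  conv_lhs => rw [← V_oneL2 s]
  rw [h]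
  rfl

lemma norm_oneL2 : ‖oneL2 n‖ = 1 := by
  refine (Lp.norm_const' (p := 2) (μ := torusMeasure n) (c := (1 : ℂ)) (by simp) (by simp)).trans ?_
  simp

lemma τ_smul (c : ℂ) (T : B n) : τ (c • T) = c * τ T := by
  simp [τ, inner_smul_right]

lemma norm_τ_le (T : B n) : ‖τ T‖ ≤ ‖T‖ := by
  refine (norm_inner_le_norm _ _).trans ?_
  have := T.le_opNorm (oneL2 n)
  rwa [norm_oneL2, mul_one, ← one_mul ‖T (oneL2 n)‖, ← norm_oneL2 (n := n)] at this

lemma τ_W (θ : Matrix (Fin n) (Fin n) ℝ) (k : Fin n → ℤ) :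
    τ (W θ k) = if k = 0 then 1 else 0 := by
  split_ifs with hk
  · rw [hk, W_zero, τ, one_apply_eq_self, inner_self_eq_norm_sq_to_K, norm_oneL2]
    simp
  · obtain ⟨j, hj⟩ := Function.ne_iff.1 hk
    have hj' : (k j : ℝ) ≠ 0 := by exact_mod_cast hj
    -- This `s` gives `W_k` the phase `e^{iπ} = -1`, while `τ` is invariant, so `τ (W_k)` equals its
    -- opposite.
    have h := τ_act (WithLp.toLp 2 (Pi.single j (π / k j)) : E n) (W θ k)
    rw [act_W, τ_smul, pair_single, mul_div_cancel₀ _ hj', mul_comm Complex.I,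
      Complex.exp_pi_mul_I] at h
    have h2 : (2 : ℂ) * τ (W θ k) = 0 := by linear_combination -h
    simpa using h2

end NCTorus
end

noncomputable section

namespace NCTorus

/-! ## The structure of `A_θ` -/

section Algebra

variable {n : ℕ} {θ : Matrix (Fin n) (Fin n) ℝ}

lemma isClosed_A : IsClosed (A θ : Set (B n)) := StarSubalgebra.isClosed_topologicalClosure _

lemma mem_adjoin_of_smul {c : ℂ} (hc : c ≠ 0) {T : B n} {S : StarSubalgebra ℂ (B n)}
    (h : c • T ∈ S) : T ∈ S := by
  have := SMulMemClass.smul_mem (c⁻¹) h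
  rwa [smul_smul, inv_mul_cancel₀ hc, one_smul] at this

/-- The `k` with `W_k` in the generated algebra form a subgroup, up to the nonzero phases, and it
contains the canonical generators of `ℤⁿ`. -/
lemma W_mem_A (hθ : θᵀ = -θ) (k : Fin n → ℤ) : W θ k ∈ A θ := by
  let S := StarAlgebra.adjoin ℂ (Set.range (U θ))
  suffices h : W θ k ∈ S from StarSubalgebra.le_topologicalClosure _ h
  let G : AddSubgroup (Fin n → ℤ) :=
    { carrier := {k | W θ k ∈ S}
      zero_mem' := by change W θ 0 ∈ S; rw [W_zero]; exact one_mem S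
      add_mem' := fun {k l} hk hl => mem_adjoin_of_smul (cocycle_ne_zero θ k l)
        (by
          have hk : W θ k ∈ S := hk
          have hl : W θ l ∈ S := hl
          rw [← W_mul]; exact mul_mem hk hl)
      neg_mem' := fun {k} hk => by
        have hk : W θ k ∈ S := hk
        change W θ (-k) ∈ S
        rw [← star_W hθ]
        exact star_mem hk }
  have hj : ∀ j, Pi.single j 1 ∈ G := fun j => by
    change W θ (Pi.single j 1) ∈ S
    rw [← U_eq_W]
    exact StarAlgebra.subset_adjoin ℂ _ ⟨j, rfl⟩
  have hk : k = ∑ j, k j • (Pi.single j 1 : Fin n → ℤ) := by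
    ext i
    simp [Finset.sum_apply, Pi.single_apply]
  change k ∈ G
  rw [hk]
  exact sum_mem fun j _ => zsmul_mem (hj j) _

/-- The span of the `W_k` is already closed under products and adjoints, and it contains the unit
and the `U_j`. -/
lemma adjoin_le_span (hθ : θᵀ = -θ) {T : B n} (hT : T ∈ StarAlgebra.adjoin ℂ (Set.range (U θ))) :
    T ∈ Submodule.span ℂ (Set.range (W θ)) := by
  induction hT using StarAlgebra.adjoin_induction with
  | mem x hx =>
    obtain ⟨j, rfl⟩ := hx
    rw [U_eq_W]
    exact Submodule.subset_span ⟨_, rfl⟩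
  | algebraMap r =>
    rw [Algebra.algebraMap_eq_smul_one, ← W_zero θ]
    exact Submodule.smul_mem _ _ (Submodule.subset_span ⟨_, rfl⟩)
  | add x y _ _ hx hy => exact add_mem hx hy
  | mul x y hx0 hy0 hx hy =>
    clear hx0 hy0
    induction hx using Submodule.span_induction with
    | mem x hx =>
      obtain ⟨k, rfl⟩ := hx
      induction hy using Submodule.span_induction with
      | mem y hy =>
        obtain ⟨l, rfl⟩ := hy
        rw [W_mul]
        exact Submodule.smul_mem _ _ (Submodule.subset_span ⟨_, rfl⟩)
      | zero => simp
      | add y z _ _ hy hz => rw [mul_add]; exact add_mem hy hz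
      | smul c y _ hy => rw [mul_smul_comm]; exact Submodule.smul_mem _ _ hy
    | zero => simp
    | add x z _ _ hx hz => rw [add_mul]; exact add_mem hx hz
    | smul c x _ hx => rw [smul_mul_assoc]; exact Submodule.smul_mem _ _ hx
  | star x hx0 hx =>
    clear hx0
    induction hx using Submodule.span_induction with
    | mem x hx =>
      obtain ⟨k, rfl⟩ := hx
      rw [star_W hθ]
      exact Submodule.subset_span ⟨_, rfl⟩
    | zero => simp
    | add x z _ _ hx hz => rw [star_add]; exact add_mem hx hz
    | smul c x _ hx => rw [star_smul]; exact Submodule.smul_mem _ _ hx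

/-- The density principle through which linear statements about `A_θ` are reduced to the `W_k`. -/
lemma A_le_of_isClosed (hθ : θᵀ = -θ) (K : Submodule ℂ (B n)) (hK : IsClosed (K : Set (B n)))
    (h : ∀ k, W θ k ∈ K) {u : B n} (hu : u ∈ A θ) : u ∈ K := by
  have h1 : (StarAlgebra.adjoin ℂ (Set.range (U θ)) : Set (B n)) ⊆ K := fun T hT =>
    Submodule.span_le.2 (Set.range_subset_iff.2 h) (adjoin_le_span hθ hT)
  exact closure_minimal h1 hK hu

lemma eqOn_A (hθ : θᵀ = -θ) {X : Type*} [NormedAddCommGroup X] [NormedSpace ℂ X]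
    {L₁ L₂ : B n →L[ℂ] X} (h : ∀ k, L₁ (W θ k) = L₂ (W θ k)) {u : B n} (hu : u ∈ A θ) :
    L₁ u = L₂ u := by
  have := A_le_of_isClosed hθ (LinearMap.ker (L₁ - L₂ : B n →L[ℂ] X).toLinearMap)
    (L₁ - L₂).isClosed_ker (fun k => by simp [h k]) hu
  simpa [sub_eq_zero] using this

/-- `A_θ` as a submodule. -/
def ASub (θ : Matrix (Fin n) (Fin n) ℝ) : Submodule ℂ (B n) := (A θ).toSubalgebra.toSubmodule

lemma map_mem_A (hθ : θᵀ = -θ) {L : B n →L[ℂ] B n} (h : ∀ k, L (W θ k) ∈ A θ) {u : B n}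
    (hu : u ∈ A θ) : L u ∈ A θ :=
  A_le_of_isClosed hθ ((ASub θ).comap L.toLinearMap) (isClosed_A.preimage L.continuous) h hu

lemma act_mem_A (hθ : θᵀ = -θ) (s : E n) {u : B n} (hu : u ∈ A θ) : act s u ∈ A θ := by
  rw [← actL_apply]
  refine map_mem_A hθ (fun k => ?_) hu
  rw [actL_apply, act_W]
  exact SMulMemClass.smul_mem _ (W_mem_A hθ k)

lemma hasSum_mem_A {ι : Type*} {f : ι → B n} {u : B n} (hf : ∀ i, f i ∈ A θ) (h : HasSum f u) :
    u ∈ A θ :=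
  isClosed_A.mem_of_tendsto h (Eventually.of_forall fun _ => sum_mem fun i _ => hf i)

/-- The state `τ` as a continuous linear map. -/
def τL (n : ℕ) : B n →L[ℂ] ℂ :=
  (innerSL ℂ (oneL2 n)) ∘L (ContinuousLinearMap.apply ℂ (L2 n) (oneL2 n))

/-- The Fourier coefficient `τ(T W_k*)`. -/
def coef (θ : Matrix (Fin n) (Fin n) ℝ) (k : Fin n → ℤ) : B n →L[ℂ] ℂ :=
  (τL n) ∘L ((ContinuousLinearMap.mul ℂ (B n)).flip (W θ (-k)))

lemma coef_apply (k : Fin n → ℤ) (T : B n) : coef θ k T = τ (T * W θ (-k)) := rfl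

lemma norm_coef_le (k : Fin n → ℤ) (T : B n) : ‖coef θ k T‖ ≤ ‖T‖ := by
  rw [coef_apply]
  refine (norm_τ_le _).trans ((norm_mul_le _ _).trans ?_)
  exact mul_le_of_le_one_right (norm_nonneg _) (norm_W_le θ _)

lemma coef_W (hθ : θᵀ = -θ) (k l : Fin n → ℤ) :
    coef θ k (W θ l) = if l = k then 1 else 0 := by
  rw [coef_apply, W_mul, τ_smul, τ_W]
  by_cases h : l = k
  · subst h
    simp [cocycle_neg hθ]
  · have : l + -k ≠ 0 := fun h' => h (by rwa [← sub_eq_add_neg, sub_eq_zero] at h')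
    simp [h, this]

lemma coef_act (hθ : θᵀ = -θ) (k : Fin n → ℤ) (s : E n) {u : B n} (hu : u ∈ A θ) :
    coef θ k (act s u) = Complex.exp (Complex.I * pair k s) * coef θ k u := by
  have := eqOn_A hθ (L₁ := coef θ k ∘L actL s)
    (L₂ := Complex.exp (Complex.I * pair k s) • coef θ k) (fun l => ?_) hu
  · simpa [actL_apply] using this
  · simp only [ContinuousLinearMap.comp_apply, actL_apply, act_W, map_smul,
      smul_apply, smul_eq_mul, coef_W hθ]
    split_ifs with h
    · rw [h]
    · simp

/-! ### Completeness of the exponentials -/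

/-- Stone–Weierstrass: the exponentials are closed under products and conjugation, so they span a
star-subalgebra, and the coordinate exponentials separate points. -/
lemma span_expChar_closure_eq_top :
    (Submodule.span ℂ (Set.range (expChar (n := n)))).topologicalClosure = ⊤ := by
  let S : StarSubalgebra ℂ C(Torus n, ℂ) :=
    { toSubalgebra := Algebra.adjoin ℂ (Set.range expChar)
      star_mem' := by
        change Algebra.adjoin ℂ (Set.range expChar) ≤ star (Algebra.adjoin ℂ (Set.range expChar))
        refine Algebra.adjoin_le ?_
        rintro _ ⟨k, rfl⟩
        refine Algebra.subset_adjoin ⟨-k, ?_⟩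
        ext1 x
        rw [expChar_neg_apply, ContinuousMap.star_apply, starRingEnd_apply] }
  have hS : S.toSubalgebra.toSubmodule = Submodule.span ℂ (Set.range (expChar (n := n))) := by
    apply Algebra.adjoin_eq_span_of_subset
    refine .trans (fun x ↦ Submonoid.closure_induction (fun _ ↦ id) ⟨0, expChar_zero⟩ ?_)
      Submodule.subset_span
    rintro _ _ _ _ ⟨k, rfl⟩ ⟨l, rfl⟩
    exact ⟨k + l, expChar_add k l⟩
  have hsep : S.SeparatesPoints := by
    intro x y hxy
    obtain ⟨i, hi⟩ := Function.ne_iff.1 hxy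
    refine ⟨_, ⟨expChar (Pi.single i 1), Algebra.subset_adjoin ⟨Pi.single i 1, rfl⟩, rfl⟩, ?_⟩
    dsimp only
    rw [expChar_single]
    simp only [expCoord, ContinuousMap.coe_mk]
    rw [fourier_one, fourier_one]
    exact fun h => hi (AddCircle.injective_toCircle (by positivity) (Circle.ext h))
  rw [← hS]
  exact congr_arg (Subalgebra.toSubmodule <| StarSubalgebra.toSubalgebra ·)
    (ContinuousMap.starSubalgebra_topologicalClosure_eq_top_of_separatesPoints S hsep)

lemma W_oneL2 (k : Fin n → ℤ) :
    W θ k (oneL2 n) = ContinuousMap.toLp 2 (torusMeasure n) ℂ (expChar k) := by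
  have h0 : translate (torusPt (rot θ k)) (oneL2 n) = oneL2 n := V_oneL2 (WithLp.toLp 2 (rot θ k))
  rw [W, mul_apply_eq_comp, h0]
  apply Lp.ext
  filter_upwards [mulOp_coe (expChar k) (oneL2 n),
    ContinuousMap.coeFn_toLp (p := 2) (𝕜 := ℂ) (torusMeasure n) (expChar k),
    Lp.coeFn_const (p := 2) (μ := torusMeasure n) (1 : ℂ)] with x h1 h2 h3
  rw [h1, h2, oneL2, h3]
  simp

lemma eq_zero_of_W_oneL2 {X : Type*} [NormedAddCommGroup X] [NormedSpace ℂ X]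
    {L : L2 n →L[ℂ] X} (h : ∀ k, L (W θ k (oneL2 n)) = 0) : L = 0 := by
  let J := ContinuousMap.toLp (E := ℂ) 2 (torusMeasure n) ℂ
  have h1 : ∀ f : C(Torus n, ℂ), (L ∘L J) f = 0 := by
    intro f
    have hle : Submodule.span ℂ (Set.range (expChar (n := n))) ≤
        LinearMap.ker (L ∘L J).toLinearMap := by
      rw [Submodule.span_le]
      rintro _ ⟨k, rfl⟩
      have := h k
      rw [W_oneL2] at this
      exact this
    have hcl := Submodule.topologicalClosure_minimal _ hle (L ∘L J).isClosed_ker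
    rw [span_expChar_closure_eq_top] at hcl
    exact hcl (Submodule.mem_top (x := f))
  have hd : DenseRange J := ContinuousMap.toLp_denseRange ℂ (torusMeasure n) ℂ (by simp)
  have h2 : (L : L2 n → X) = (0 : L2 n →L[ℂ] X) :=
    hd.equalizer L.continuous (0 : L2 n →L[ℂ] X).continuous (by ext f; exact h1 f)
  exact DFunLike.coe_injective h2

/-- The Fourier coefficients determine the elements of `A_θ`. -/
lemma eq_zero_of_coef (hθ : θᵀ = -θ) {w : B n} (hw : w ∈ A θ) (h : ∀ k, coef θ k w = 0) :
    w = 0 := by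
  -- These are the matrix entries of `w` between the vectors `W_l 1` and `W_k 1`, which span a dense
  -- subspace.
  have key : ∀ k l, τ (W θ (-k) * w * W θ l) = 0 := by
    intro k l
    let L : B n →L[ℂ] ℂ := (τL n) ∘L ((ContinuousLinearMap.mul ℂ (B n)).flip (W θ l)) ∘L
      (ContinuousLinearMap.mul ℂ (B n) (W θ (-k)))
    have hL : ∀ T, L T = τ (W θ (-k) * T * W θ l) := fun T => rfl
    -- On the `W_m` this functional vanishes unless `m = k - l`, so it is a multiple of one Fourier
    -- coefficient.
    have h1 := eqOn_A hθ (L₁ := L) (L₂ := L (W θ (k - l)) • coef θ (k - l)) (fun m => ?_) hw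
    · rw [← hL, h1]
      simp [h]
    · rw [smul_apply, coef_W hθ]
      split_ifs with hm
      · rw [hm]; simp
      · rw [hL, W_mul, smul_mul_assoc, W_mul, smul_smul, τ_smul, τ_W, if_neg]
        · simp
        · intro h'
          apply hm
          have : m = k - l + (-k + m + l) := by abel
          rw [this, h', add_zero]
  refine eq_zero_of_W_oneL2 (θ := θ) fun l => ?_
  have h2 : innerSL ℂ (w (W θ l (oneL2 n))) = 0 := by
    refine eq_zero_of_W_oneL2 (θ := θ) fun k => ?_
    have h3 := key k l
    rw [← star_W hθ, τ, mul_apply_eq_comp, mul_apply_eq_comp,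
      ContinuousLinearMap.star_eq_adjoint, ContinuousLinearMap.adjoint_inner_right] at h3
    rw [innerSL_apply_apply, ← inner_conj_symm, h3, map_zero]
  have h4 := DFunLike.congr_fun h2 (w (W θ l (oneL2 n)))
  simpa using h4

lemma eq_of_coef (hθ : θᵀ = -θ) {u v : B n} (hu : u ∈ A θ) (hv : v ∈ A θ)
    (h : ∀ k, coef θ k u = coef θ k v) : u = v :=
  sub_eq_zero.1 (eq_zero_of_coef hθ (sub_mem hu hv) fun k => by simp [h k])

/-! ### The smooth elements -/

lemma hasDerivAt_act {u : B n} (hu : u ∈ SA θ) (s v : E n) :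
    HasDerivAt (fun t : ℝ => act (s + t • v) u) (fderiv ℝ (fun s => act s u) s v) 0 := by
  have h1 : HasDerivAt (fun t : ℝ => s + t • v) v 0 := by
    simpa using ((hasDerivAt_id (0 : ℝ)).smul_const v).const_add s
  have h2 : HasFDerivAt (fun s => act s u) (fderiv ℝ (fun s => act s u) s) (s + (0 : ℝ) • v) := by
    simpa using ((hu.2.differentiable (by simp)) s).hasFDerivAt
  exact h2.comp_hasDerivAt (0 : ℝ) h1

lemma delta_eq {u : B n} (hu : u ∈ SA θ) (j : Fin n) :
    delta j u = (-Complex.I) • fderiv ℝ (fun s => act s u) 0 (basisVec j) := by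
  have := (hasDerivAt_act hu 0 (basisVec j)).deriv
  simp only [zero_add] at this
  rw [delta, this]

/-- By the group law, the derivative of the orbit at `s` is `α_s` applied to its derivative at `0`.
-/
lemma act_delta {u : B n} (hu : u ∈ SA θ) (j : Fin n) (s : E n) :
    act s (delta j u) = (-Complex.I) • fderiv ℝ (fun s => act s u) s (basisVec j) := by
  rw [delta_eq hu, ← actL_apply, map_smul]
  congr 1
  have h1 := hasDerivAt_act hu 0 (basisVec j)
  have h2 := ((actL s).restrictScalars ℝ).hasFDerivAt.comp_hasDerivAt (0 : ℝ) h1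
  have h3 := hasDerivAt_act hu s (basisVec j)
  refine h2.unique (h3.congr_of_eventuallyEq (Eventually.of_forall fun t => ?_))
  simp [actL_apply, act_add]

/-- The difference quotients of the orbit lie in the closed space `A_θ`, and the orbit of `δ_j u` is
a derivative of that of `u`. -/
lemma delta_mem (hθ : θᵀ = -θ) {u : B n} (hu : u ∈ SA θ) (j : Fin n) : delta j u ∈ SA θ := by
  refine ⟨?_, ?_⟩
  · rw [delta_eq hu]
    refine SMulMemClass.smul_mem _ ?_
    have h1 := (hasDerivAt_act hu 0 (basisVec j)).tendsto_slope
    refine isClosed_A.mem_of_tendsto h1 (Eventually.of_forall fun t => ?_)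
    rw [slope_def_module, ← algebraMap_smul ℂ]
    exact SMulMemClass.smul_mem _ (sub_mem (act_mem_A hθ _ hu.1) (act_mem_A hθ _ hu.1))
  · simp only [act_delta hu]
    have h1 : ContDiff ℝ ∞ (fderiv ℝ fun s => act s u) := hu.2.fderiv_right (by simp)
    exact (h1.clm_apply contDiff_const).const_smul _

lemma coef_delta (hθ : θᵀ = -θ) {u : B n} (hu : u ∈ SA θ) (j : Fin n) (k : Fin n → ℤ) :
    coef θ k (delta j u) = k j * coef θ k u := by
  rw [delta_eq hu, map_smul]
  have h1 := ((coef θ k).restrictScalars ℝ).hasFDerivAt.comp_hasDerivAt (0 : ℝ)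
    (hasDerivAt_act hu 0 (basisVec j))
  have h2 : HasDerivAt (fun t : ℝ => Complex.exp (Complex.I * k j * (t : ℂ)) * coef θ k u)
      (Complex.I * k j * coef θ k u) 0 := by
    have h3 : HasDerivAt (fun z : ℂ => Complex.exp (Complex.I * k j * z)) (Complex.I * k j)
        ((0 : ℝ) : ℂ) := by
      have := ((hasDerivAt_id ((0 : ℝ) : ℂ)).const_mul (Complex.I * k j)).cexp
      simpa using this
    exact h3.comp_ofReal.mul_const _
  have h4 : ∀ t : ℝ, coef θ k (act (0 + t • basisVec j) u) =
      Complex.exp (Complex.I * k j * (t : ℂ)) * coef θ k u := by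
    intro t
    rw [coef_act hθ k _ hu.1, show (0 + t • basisVec j : E n).ofLp = Pi.single j t by
      ext i; simp [basisVec, Pi.single_apply], pair_single]
    push_cast
    rw [mul_assoc]
  have h5 := h1.unique (h2.congr_of_eventuallyEq (Eventually.of_forall fun t => h4 t))
  have h6 : coef θ k (fderiv ℝ (fun s => act s u) 0 (basisVec j)) =
      Complex.I * k j * coef θ k u := h5
  rw [h6, smul_eq_mul, ← mul_assoc, ← mul_assoc, neg_mul, Complex.I_mul_I]
  ring

/-- Proved jointly, since each further `δ_j` can be computed only once the previous iterate is known
to be smooth. -/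
lemma deltaPow_mem_and_coef (hθ : θᵀ = -θ) {u : B n} (hu : u ∈ SA θ) (β : Fin n → ℕ) :
    deltaPow β u ∈ SA θ ∧
      ∀ k, coef θ k (deltaPow β u) = (∏ j, (k j : ℂ) ^ β j) * coef θ k u := by
  have hit : ∀ (m : ℕ) (j : Fin n) {v : B n}, v ∈ SA θ → (delta j)^[m] v ∈ SA θ ∧
      ∀ k, coef θ k ((delta j)^[m] v) = (k j : ℂ) ^ m * coef θ k v := by
    intro m j v hv
    induction m with
    | zero => simpa using hv
    | succ m ih =>
      rw [Function.iterate_succ_apply']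
      refine ⟨delta_mem hθ ih.1 j, fun k => ?_⟩
      rw [coef_delta hθ ih.1, ih.2, pow_succ]
      ring
  have key : ∀ l : List (Fin n), l.foldr (fun j y => (delta j)^[β j] y) u ∈ SA θ ∧
      ∀ k : Fin n → ℤ, coef θ k (l.foldr (fun j y => (delta j)^[β j] y) u) =
        (l.map fun j => (k j : ℂ) ^ β j).prod * coef θ k u := by
    intro l
    induction l with
    | nil => simpa using hu
    | cons j l ih =>
      rw [List.foldr_cons]
      refine ⟨(hit _ j ih.1).1, fun k => ?_⟩
      rw [(hit _ j ih.1).2, ih.2, List.map_cons, List.prod_cons, mul_assoc]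
  have := key (List.finRange n)
  refine ⟨this.1, fun k => ?_⟩
  rw [Fin.prod_univ_def]
  exact this.2 k

lemma deltaPow_mem (hθ : θᵀ = -θ) {u : B n} (hu : u ∈ SA θ) (β : Fin n → ℕ) :
    deltaPow β u ∈ SA θ := (deltaPow_mem_and_coef hθ hu β).1

lemma coef_deltaPow (hθ : θᵀ = -θ) {u : B n} (hu : u ∈ SA θ) (β : Fin n → ℕ) (k : Fin n → ℤ) :
    coef θ k (deltaPow β u) = (∏ j, (k j : ℂ) ^ β j) * coef θ k u :=
  (deltaPow_mem_and_coef hθ hu β).2 k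

lemma deltaPow_zero (u : B n) : deltaPow 0 u = u := by
  have : ∀ l : List (Fin n), l.foldr (fun j y => (delta j)^[(0 : Fin n → ℕ) j] y) u = u := by
    intro l
    induction l with
    | nil => rfl
    | cons j l ih => rw [List.foldr_cons, ih]; rfl
  exact this _

/-- Fourier coefficients determine the elements of `A_θ`, and `δ^β` multiplies them by `k^β`; this
makes it linear on `𝒜_θ`. -/
lemma deltaPow_sub (hθ : θᵀ = -θ) {u v : B n} (hu : u ∈ SA θ) (hv : v ∈ SA θ) (β : Fin n → ℕ) :
    deltaPow β (u - v) = deltaPow β u - deltaPow β v := by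
  refine eq_of_coef hθ (deltaPow_mem hθ (sub_mem hu hv) β).1
    (sub_mem (deltaPow_mem hθ hu β).1 (deltaPow_mem hθ hv β).1) fun k => ?_
  rw [map_sub, coef_deltaPow hθ hu, coef_deltaPow hθ hv, coef_deltaPow hθ (sub_mem hu hv), map_sub,
    mul_sub]

/-- The largest coordinate controls the norm, so only the pure derivatives `δ_j^m` are needed to
bound Fourier coefficients. -/
lemma one_add_norm_latt_pow_le (k : Fin n → ℤ) (m : ℕ) :
    (1 + ‖latt k‖) ^ m ≤ ((n : ℝ) + 1) ^ m * (1 + ∑ j, |(k j : ℝ)| ^ m) := by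
  obtain ⟨M, hM0, hM, h1⟩ : ∃ M : ℝ, 0 ≤ M ∧ (∀ j, |(k j : ℝ)| ≤ M) ∧
      (1 ⊔ M) ^ m ≤ 1 + ∑ j, |(k j : ℝ)| ^ m := by
    by_cases hn : Nonempty (Fin n)
    · obtain ⟨i, hi⟩ := Finite.exists_max fun j => |(k j : ℝ)|
      refine ⟨|(k i : ℝ)|, abs_nonneg _, hi, ?_⟩
      have h2 : |(k i : ℝ)| ^ m ≤ ∑ j, |(k j : ℝ)| ^ m :=
        Finset.single_le_sum (f := fun j => |(k j : ℝ)| ^ m) (fun j _ => by positivity)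
          (Finset.mem_univ i)
      have h3 : (0 : ℝ) ≤ |(k i : ℝ)| ^ m := by positivity
      rcases le_total 1 |(k i : ℝ)| with h | h
      · rw [sup_of_le_right h]; linarith
      · rw [sup_of_le_left h, one_pow]; linarith
    · have : IsEmpty (Fin n) := not_nonempty_iff.1 hn
      exact ⟨0, le_rfl, fun j => (this.false j).elim, by simp⟩
  have h2 : 1 + ‖latt k‖ ≤ (n + 1) * (1 ⊔ M) := by
    have h3 : ‖latt k‖ ≤ ∑ j : Fin n, |(k j : ℝ)| := by
      have : latt k = ∑ j, (k j : ℝ) • basisVec j := by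
        ext i; simp [basisVec, Finset.sum_apply, Pi.single_apply]
      rw [this]
      refine (norm_sum_le _ _).trans (Finset.sum_le_sum fun j _ => ?_)
      simp [norm_smul, basisVec]
    have h4 : ∑ j : Fin n, |(k j : ℝ)| ≤ n * M := by
      refine (Finset.sum_le_sum fun j _ => hM j).trans ?_
      simp
    have h5 : (n : ℝ) * M ≤ n * (1 ⊔ M) := by gcongr; exact le_sup_right
    have h6 : (1 : ℝ) ≤ 1 ⊔ M := le_sup_left
    linarith
  calc (1 + ‖latt k‖) ^ m ≤ ((n + 1) * (1 ⊔ M)) ^ m := pow_le_pow_left₀ (by positivity) h2 m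
    _ = ((n : ℝ) + 1) ^ m * (1 ⊔ M) ^ m := mul_pow _ _ _
    _ ≤ _ := by gcongr

/-- Rapid decay of the Fourier coefficients of smooth elements. -/
lemma norm_coef_le_of_mem_SA (hθ : θᵀ = -θ) (m : ℕ) {u : B n} (hu : u ∈ SA θ) (k : Fin n → ℤ) :
    ‖coef θ k u‖ ≤ ((n : ℝ) + 1) ^ m * (‖u‖ + ∑ j, ‖deltaPow (Pi.single j m) u‖) *
      (1 + ‖latt k‖) ^ (-(m : ℝ)) := by
  rw [Real.rpow_neg (by positivity), ← div_eq_mul_inv, le_div_iff₀ (by positivity),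
    Real.rpow_natCast]
  have h1 : ∀ j, ‖coef θ k u‖ * |(k j : ℝ)| ^ m ≤ ‖deltaPow (Pi.single j m) u‖ := by
    intro j
    have h := norm_coef_le (θ := θ) k (deltaPow (Pi.single j m) u)
    rw [coef_deltaPow hθ hu, norm_mul, norm_prod, Finset.prod_eq_single j] at h
    · simpa [mul_comm] using h
    · intro i _ hi; simp [hi]
    · simp
  calc ‖coef θ k u‖ * (1 + ‖latt k‖) ^ m
      ≤ ‖coef θ k u‖ * (((n : ℝ) + 1) ^ m * (1 + ∑ j, |(k j : ℝ)| ^ m)) :=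
        mul_le_mul_of_nonneg_left (one_add_norm_latt_pow_le k m) (norm_nonneg _)
    _ = ((n : ℝ) + 1) ^ m * (‖coef θ k u‖ + ∑ j, ‖coef θ k u‖ * |(k j : ℝ)| ^ m) := by
        rw [← Finset.mul_sum]; ring
    _ ≤ _ := by
        gcongr with j
        · exact norm_coef_le k u
        · exact h1 j

lemma summable_norm_of_decay {c : (Fin n → ℤ) → ℂ} {C : ℝ}
    (h : ∀ k, ‖c k‖ ≤ C * (1 + ‖latt k‖) ^ (-((n + 1 : ℕ) : ℝ))) :
    Summable fun k => ‖c k‖ := by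
  refine ((summable_latt (n := n) (r := ((n + 1 : ℕ) : ℝ)) (by push_cast; linarith)).mul_left
    C).of_nonneg_of_le (fun _ => norm_nonneg _) h

lemma norm_smul_W_le (c : ℂ) (k : Fin n → ℤ) : ‖c • W θ k‖ ≤ ‖c‖ := by
  rw [norm_smul]
  exact mul_le_of_le_one_right (norm_nonneg _) (norm_W_le θ k)

/-- The absolutely convergent series has a sum in `A_θ` with the same Fourier coefficients as `u`.
-/
lemma hasSum_coef_of_summable (hθ : θᵀ = -θ) {u : B n} (hu : u ∈ A θ)
    (h : Summable fun k => ‖coef θ k u‖) : HasSum (fun k => coef θ k u • W θ k) u := by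
  have hs : Summable fun k => coef θ k u • W θ k := h.of_norm_bounded fun k => norm_smul_W_le _ k
  have hA : ∑' k, coef θ k u • W θ k ∈ A θ :=
    hasSum_mem_A (fun k => SMulMemClass.smul_mem _ (W_mem_A hθ k)) hs.hasSum
  have heq : ∑' k, coef θ k u • W θ k = u := by
    symm
    refine eq_of_coef hθ hu hA fun l => ?_
    have h1 := (coef θ l).hasSum hs.hasSum
    have h2 : ∀ k, coef θ l (coef θ k u • W θ k) = if k = l then coef θ l u else 0 := by
      intro k
      rw [map_smul, coef_W hθ]
      split_ifs with hk
      · simp [hk]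
      · simp
    simp only [h2] at h1
    exact (hasSum_ite_eq l (coef θ l u)).unique h1
  have h3 := hs.hasSum
  rwa [heq] at h3

lemma summable_coef (hθ : θᵀ = -θ) {u : B n} (hu : u ∈ SA θ) : Summable fun k => ‖coef θ k u‖ :=
  summable_norm_of_decay fun k => norm_coef_le_of_mem_SA hθ (n + 1) hu k

lemma hasSum_coef (hθ : θᵀ = -θ) {u : B n} (hu : u ∈ SA θ) :
    HasSum (fun k => coef θ k u • W θ k) u :=
  hasSum_coef_of_summable hθ hu.1 (summable_coef hθ hu)

/-- The linear form `pair k`. -/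
def pairL (k : Fin n → ℤ) : E n →L[ℝ] ℝ := innerSL ℝ (latt k)

lemma pairL_apply (k : Fin n → ℤ) (s : E n) : pairL k s = pair k s := by
  rw [pairL, innerSL_apply_apply, PiLp.inner_apply, pair]
  exact Finset.sum_congr rfl fun i _ => by simp [mul_comm]

lemma contDiff_exp_smul {X : Type*} [NormedAddCommGroup X] [NormedSpace ℂ X] [NormedSpace ℝ X]
    [IsScalarTower ℝ ℂ X] (v : X) :
    ContDiff ℝ ∞ fun t : ℝ => Complex.exp (Complex.I * t) • v :=
  ((contDiff_const.mul Complex.ofRealCLM.contDiff).cexp).smul contDiff_const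

lemma contDiff_exp_pair_smul {X : Type*} [NormedAddCommGroup X] [NormedSpace ℂ X]
    [NormedSpace ℝ X] [IsScalarTower ℝ ℂ X] (k : Fin n → ℤ) (v : X) :
    ContDiff ℝ ∞ fun s : E n => Complex.exp (Complex.I * pair k s) • v := by
  have h := (contDiff_exp_smul v).comp (pairL k).contDiff
  simpa only [Function.comp_def, pairL_apply] using h

lemma iteratedDeriv_exp_smul {X : Type*} [NormedAddCommGroup X] [NormedSpace ℂ X] [NormedSpace ℝ X]
    [IsScalarTower ℝ ℂ X] (v : X) (b : ℕ) :
    iteratedDeriv b (fun t : ℝ => Complex.exp (Complex.I * t) • v) =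
      fun t : ℝ => Complex.exp (Complex.I * t) • Complex.I ^ b • v := by
  induction b with
  | zero => ext; simp
  | succ b ih =>
    rw [iteratedDeriv_succ, ih]
    ext t
    have h : HasDerivAt (fun t : ℝ => Complex.exp (Complex.I * t))
        (Complex.exp (Complex.I * t) * Complex.I) t := by
      have := ((hasDerivAt_id (t : ℂ)).const_mul Complex.I).cexp
      simp only [id, mul_one] at this
      exact this.comp_ofReal
    rw [(h.smul_const (Complex.I ^ b • v)).deriv, smul_smul, smul_smul, pow_succ]
    congr 1
    ring

/-- The function factors through the linear form `k · s`, of norm `‖latt k‖`. -/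
lemma norm_iteratedFDeriv_exp_smul_le {X : Type*} [NormedAddCommGroup X] [NormedSpace ℂ X]
    [NormedSpace ℝ X] [IsScalarTower ℝ ℂ X] (v : X) (k : Fin n → ℤ) (b : ℕ) (s : E n) :
    ‖iteratedFDeriv ℝ b (fun s : E n => Complex.exp (Complex.I * pair k s) • v) s‖ ≤
      ‖latt k‖ ^ b * ‖v‖ := by
  have h1 : (fun s : E n => Complex.exp (Complex.I * pair k s) • v) =
      (fun t : ℝ => Complex.exp (Complex.I * t) • v) ∘ pairL k := by
    ext s; simp [pairL_apply]
  rw [h1, (pairL k).iteratedFDeriv_comp_right (contDiff_exp_smul v) s (by exact_mod_cast le_top)]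
  refine (ContinuousMultilinearMap.norm_compContinuousLinearMap_le _ _).trans ?_
  rw [norm_iteratedFDeriv_eq_norm_iteratedDeriv, iteratedDeriv_exp_smul, Finset.prod_const,
    Finset.card_univ, Fintype.card_fin, norm_smul, norm_smul, norm_exp_I_mul, norm_pow,
    Complex.norm_I, one_pow, one_mul, one_mul, mul_comm]
  gcongr
  rw [pairL, innerSL_apply_norm]

/-- Elements with rapidly decaying Fourier coefficients are smooth. -/
lemma mem_SA_of_decay (hθ : θᵀ = -θ) {u : B n} (hu : u ∈ A θ)
    (h : ∀ m : ℕ, ∃ C : ℝ, ∀ k, ‖coef θ k u‖ ≤ C * (1 + ‖latt k‖) ^ (-(m : ℝ))) : u ∈ SA θ := by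
  refine ⟨hu, ?_⟩
  obtain ⟨C, hC⟩ := h (n + 1)
  have h1 := hasSum_coef_of_summable hθ hu (summable_norm_of_decay hC)
  have h2 : (fun s : E n => act s u) =
      fun s : E n => ∑' k, Complex.exp (Complex.I * pair k s) • (coef θ k u • W θ k) := by
    ext1 s
    rw [← actL_apply, ← ((actL s).hasSum h1).tsum_eq]
    refine tsum_congr fun k => ?_
    rw [map_smul, actL_apply, act_W, smul_comm]
  rw [h2]
  refine contDiff_tsum (N := ⊤) (v := fun b k => ‖latt k‖ ^ b * ‖coef θ k u‖)
    (fun k => contDiff_exp_pair_smul k _) (fun b _ => ?_) (fun b k s _ => ?_)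
  · obtain ⟨D, hD⟩ := h (b + (n + 1))
    refine ((summable_latt (n := n) (r := ((n + 1 : ℕ) : ℝ)) (by push_cast; linarith)).mul_left
      D).of_nonneg_of_le (fun _ => by positivity) fun k => ?_
    have hD0 : 0 ≤ D := by simpa using (norm_nonneg _).trans (hD 0)
    calc ‖latt k‖ ^ b * ‖coef θ k u‖
        ≤ (1 + ‖latt k‖) ^ b * (D * (1 + ‖latt k‖) ^ (-((b + (n + 1) : ℕ) : ℝ))) := by
          gcongr
          · linarith
          · exact hD k
      _ = D * ((1 + ‖latt k‖) ^ (b : ℝ) * (1 + ‖latt k‖) ^ (-((b + (n + 1) : ℕ) : ℝ))) := by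
          rw [Real.rpow_natCast]; ring
      _ = _ := by
          rw [← Real.rpow_add (by positivity)]
          congr 2
          push_cast
          ring
  · refine (norm_iteratedFDeriv_exp_smul_le _ k b s).trans ?_
    gcongr
    exact norm_smul_W_le _ k

lemma W_mem_SA (hθ : θᵀ = -θ) (k : Fin n → ℤ) : W θ k ∈ SA θ := by
  refine mem_SA_of_decay hθ (W_mem_A hθ k) fun m => ⟨(1 + ‖latt k‖) ^ (m : ℝ), fun l => ?_⟩
  rw [coef_W hθ]
  split_ifs with h
  · rw [h, ← Real.rpow_add (by positivity)]
    simp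
  · simp; positivity

end Algebra

end NCTorus
end

noncomputable section

namespace NCTorus

/-! ## Oscillating integrals -/

section Oscillating

variable {n : ℕ} {χ : E n × E n → ℂ}

/-- The partial Fourier transform `∫ e^{i t·η} χ(t, ζ) dt`. -/
def oscKernel (χ : E n × E n → ℂ) (η ζ : E n) : ℂ :=
  ∫ t : E n, Complex.exp (Complex.I * (inner ℝ t η : ℝ)) * χ (t, ζ)

lemma eq_zero_of_notMem_fst {X : Type*} [Zero X] {f : E n × E n → X} {t ζ : E n}
    (h : t ∉ Prod.fst '' tsupport f) : f (t, ζ) = 0 := by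
  by_contra h'
  exact h ⟨(t, ζ), subset_tsupport _ h', rfl⟩

lemma continuous_oscKernel (hχ : Continuous χ) (hc : HasCompactSupport χ) :
    Continuous fun p : E n × E n => oscKernel χ p.1 p.2 := by
  have hK : IsCompact (Prod.fst '' tsupport χ) := hc.isCompact.image continuous_fst
  have h1 : Continuous (Function.uncurry fun (p : E n × E n) (t : E n) =>
      Complex.exp (Complex.I * (inner ℝ t p.1 : ℝ)) * χ (t, p.2)) := by
    simp only [Function.uncurry_def]
    fun_prop
  have h2 := continuous_parametric_integral_of_continuous (μ := volume) h1 hK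
  refine h2.congr fun p => ?_
  exact setIntegral_eq_integral_of_forall_compl_eq_zero fun t ht => by
    rw [eq_zero_of_notMem_fst ht, mul_zero]

lemma oscKernel_eq_fourier (η ζ : E n) :
    oscKernel χ η ζ = FourierTransform.fourier (fun t => χ (t, ζ)) (-(2 * π)⁻¹ • η) := by
  rw [Real.fourier_eq', oscKernel]
  congr 1
  ext t
  rw [smul_eq_mul, inner_smul_right]
  congr 2
  rw [mul_comm]
  congr 2
  field_simp

/-- The slices of `χ` are supported in one compact set, with derivatives bounded uniformly in `ζ`,
so the usual decay of Fourier transforms is uniform in `ζ`. -/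
lemma exists_norm_oscKernel_le (hχ : ContDiff ℝ ∞ χ) (hc : HasCompactSupport χ) :
    ∃ C : ℝ, 0 ≤ C ∧ ∀ η ζ, ‖oscKernel χ η ζ‖ ≤ C * (1 + ‖η‖) ^ (-((n + 1 : ℕ) : ℝ)) := by
  let K : Set (E n) := Prod.fst '' tsupport χ
  have hK : IsCompact K := hc.isCompact.image continuous_fst
  have hslice : ∀ ζ, ContDiff ℝ ∞ fun t : E n => χ (t, ζ) := fun ζ =>
    hχ.comp (contDiff_id.prodMk contDiff_const)
  have hb : ∀ p : ℕ, ∃ D : ℝ, ∀ ζ t,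
      ‖iteratedFDeriv ℝ p (fun t : E n => χ (t, ζ)) t‖ ≤ K.indicator (fun _ => D) t := by
    intro p
    obtain ⟨D, hD⟩ := (hχ.continuous_iteratedFDeriv (m := p)
      (by exact_mod_cast le_top)).bounded_above_of_compact_support (hc.iteratedFDeriv p)
    refine ⟨D, fun ζ t => ?_⟩
    have h1 : (fun t : E n => χ (t, ζ)) =
        (fun z => χ (z + (0, ζ))) ∘ ContinuousLinearMap.inl ℝ (E n) (E n) := by
      ext t; simp
    have h2 : ‖iteratedFDeriv ℝ p (fun t : E n => χ (t, ζ)) t‖ ≤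
        ‖iteratedFDeriv ℝ p χ (t, ζ)‖ := by
      rw [h1, (ContinuousLinearMap.inl ℝ (E n) (E n)).iteratedFDeriv_comp_right
        (f := fun z => χ (z + (0, ζ))) (hχ.comp (contDiff_id.add contDiff_const)) t (by exact_mod_cast le_top),
        iteratedFDeriv_comp_add_right]
      refine (ContinuousMultilinearMap.norm_compContinuousLinearMap_le _ _).trans ?_
      rw [Finset.prod_const]
      have h3 : (ContinuousLinearMap.inl ℝ (E n) (E n)) t + (0, ζ) = (t, ζ) := by simp
      rw [h3]
      exact mul_le_of_le_one_right (norm_nonneg _)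
        (pow_le_one₀ (norm_nonneg _) (ContinuousLinearMap.norm_inl_le_one _ _ _))
    by_cases ht : t ∈ K
    · rw [Set.indicator_of_mem ht]
      exact h2.trans (hD _)
    · rw [Set.indicator_of_notMem ht]
      refine h2.trans (le_of_eq ?_)
      rw [norm_eq_zero]
      by_contra h'
      exact ht ⟨(t, ζ), support_iteratedFDeriv_subset p h', rfl⟩
  choose D hD using hb
  have hint : ∀ p, Integrable (K.indicator fun _ : E n => D p) := fun p =>
    (integrableOn_const (hs := hK.measure_lt_top.ne)).integrable_indicator hK.measurableSet
  have hint' : ∀ ζ (p : ℕ), Integrable fun t =>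
      ‖iteratedFDeriv ℝ p (fun t : E n => χ (t, ζ)) t‖ := fun ζ p =>
    (hint p).mono' ((hslice ζ).continuous_iteratedFDeriv
      (by exact_mod_cast le_top)).norm.aestronglyMeasurable
      (Eventually.of_forall fun t => by rw [norm_norm]; exact hD p ζ t)
  have hF : ∀ m : ℕ, ∃ C, ∀ ζ w : E n,
      ‖w‖ ^ m * ‖FourierTransform.fourier (fun t => χ (t, ζ)) w‖ ≤ C := by
    intro m
    refine ⟨(2 * π) ^ 0 * (2 * (0 : ℕ) + 2) ^ m * ∑ p ∈ Finset.range (0 + 1) ×ˢ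
      Finset.range (m + 1), ∫ t, K.indicator (fun _ => D p.2) t, fun ζ w => ?_⟩
    have := Real.pow_mul_norm_iteratedFDeriv_fourier_le (K := 0) (N := ⊤) (hslice ζ)
      (fun k p hk _ => by
        have hk0 : k = 0 := by simpa using hk
        simpa [hk0] using hint' ζ p) (k := 0) (n := m) (by simp) (by exact_mod_cast le_top) w
    rw [norm_iteratedFDeriv_zero] at this
    refine this.trans ?_
    refine mul_le_mul_of_nonneg_left (Finset.sum_le_sum fun p hp => ?_) (by positivity)
    have hp1 : p.1 = 0 := by simpa using (Finset.mem_product.1 hp).1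
    simp only [hp1, pow_zero, one_mul]
    exact integral_mono (hint' ζ p.2) (hint p.2) fun t => hD p.2 ζ t
  obtain ⟨C₀, h0⟩ := hF 0
  obtain ⟨C₁, h1⟩ := hF (n + 1)
  have hC0 : 0 ≤ C₀ := le_trans (by positivity) (h0 0 0)
  have hC1 : 0 ≤ C₁ := le_trans (by positivity) (h1 0 0)
  refine ⟨2 ^ n * (C₀ + (2 * π) ^ (n + 1) * C₁), by positivity, fun η ζ => ?_⟩
  rw [Real.rpow_neg (by positivity), ← div_eq_mul_inv, le_div_iff₀ (by positivity),
    Real.rpow_natCast]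
  have h2 : ‖oscKernel χ η ζ‖ ≤ C₀ := by
    have := h0 ζ (-(2 * π)⁻¹ • η)
    rwa [pow_zero, one_mul, ← oscKernel_eq_fourier] at this
  have h3 : ‖oscKernel χ η ζ‖ * ‖η‖ ^ (n + 1) ≤ (2 * π) ^ (n + 1) * C₁ := by
    have := h1 ζ (-(2 * π)⁻¹ • η)
    rw [← oscKernel_eq_fourier, norm_smul, norm_neg, norm_inv, mul_pow, inv_pow,
      Real.norm_of_nonneg (by positivity), mul_assoc, inv_mul_le_iff₀ (by positivity)] at this
    linarith
  have h4 : (1 + ‖η‖) ^ (n + 1) ≤ 2 ^ n * (1 + ‖η‖ ^ (n + 1)) := by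
    have := add_pow_le (zero_le_one' ℝ) (norm_nonneg η) (n + 1)
    simpa using this
  calc ‖oscKernel χ η ζ‖ * (1 + ‖η‖) ^ (n + 1)
      ≤ ‖oscKernel χ η ζ‖ * (2 ^ n * (1 + ‖η‖ ^ (n + 1))) := by gcongr
    _ = 2 ^ n * (‖oscKernel χ η ζ‖ + ‖oscKernel χ η ζ‖ * ‖η‖ ^ (n + 1)) := by ring
    _ ≤ _ := by gcongr

lemma integrable_one_add_norm_succ :
    Integrable fun η : E n => (1 + ‖η‖) ^ (-((n + 1 : ℕ) : ℝ)) :=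
  integrable_one_add_norm (by simp)

lemma integrable_oscKernel (hχ : ContDiff ℝ ∞ χ) (hc : HasCompactSupport χ) (ζ : E n) :
    Integrable fun η => oscKernel χ η ζ := by
  obtain ⟨C, _, hC⟩ := exists_norm_oscKernel_le hχ hc
  exact (integrable_one_add_norm_succ.const_mul C).mono'
    ((continuous_oscKernel hχ.continuous hc).comp
      (by fun_prop : Continuous fun η : E n => (η, ζ))).aestronglyMeasurable
    (Eventually.of_forall fun η => hC η ζ)

/-- Fourier inversion at the origin for the slice `χ(·, ζ)`; the factor `(2π)ⁿ` comes from the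
normalization of the phase. -/
lemma integral_oscKernel (hχ : ContDiff ℝ ∞ χ) (hc : HasCompactSupport χ) (ζ : E n) :
    ∫ η, oscKernel χ η ζ = (2 * π : ℂ) ^ n * χ (0, ζ) := by
  have hπ : (2 * π) ≠ 0 := by positivity
  let f : E n → ℂ := fun t => χ (t, ζ)
  have hf : Continuous f := hχ.continuous.comp (by fun_prop)
  have hfc : HasCompactSupport f := by
    refine HasCompactSupport.of_support_subset_isCompact (hc.isCompact.image continuous_fst) ?_
    exact fun t ht => ⟨(t, ζ), subset_tsupport _ ht, rfl⟩
  have hF : FourierTransform.fourier f = fun w => oscKernel χ ((-(2 * π)) • w) ζ := by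
    ext w
    rw [oscKernel_eq_fourier, smul_smul, neg_mul_neg, inv_mul_cancel₀ hπ, one_smul]
  have h1 := (hf.integrable_of_hasCompactSupport hfc).fourierInv_fourier_eq
    (by rw [hF]; exact (integrable_oscKernel hχ hc ζ).comp_smul (neg_ne_zero.2 hπ))
    (hf.continuousAt (x := 0))
  rw [Real.fourierInv_eq'] at h1
  simp only [inner_zero_right, mul_zero, Complex.ofReal_zero, zero_mul, Complex.exp_zero,
    one_smul] at h1
  rw [hF, Measure.integral_comp_smul volume (fun η => oscKernel χ η ζ)] at h1
  rw [show χ (0, ζ) = f 0 from rfl, ← h1, finrank_euclideanSpace_fin, abs_inv, abs_pow, abs_neg,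
    abs_of_pos (by positivity : 0 < 2 * π), Complex.real_smul, ← mul_assoc]
  push_cast
  rw [mul_inv_cancel₀ (by exact_mod_cast pow_ne_zero n hπ), one_mul]

/-! ### Regularized oscillating integrals and their limits -/

variable {X : Type*} [NormedAddCommGroup X] [NormedSpace ℂ X]

lemma continuous_osc_integrand (hχ : Continuous χ) {f : E n → X} (hf : Continuous f) (a : E n)
    (ε : ℝ) : Continuous fun p : E n × E n =>
      (Complex.exp (Complex.I * (inner ℝ p.1 (p.2 - a) : ℝ)) * χ (ε • p)) • f p.2 := by
  fun_prop

lemma hasCompactSupport_osc_integrand (hc : HasCompactSupport χ) {f : E n → X} (a : E n)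
    {ε : ℝ} (hε : ε ≠ 0) : HasCompactSupport fun p : E n × E n =>
      (Complex.exp (Complex.I * (inner ℝ p.1 (p.2 - a) : ℝ)) * χ (ε • p)) • f p.2 :=
  ((hc.comp_smul hε).mul_left).smul_right

variable [NormedSpace ℝ X] [IsScalarTower ℝ ℂ X]

/-- The substitutions `s = t/ε` and `ξ = a + εη` have inverse Jacobians and remove `ε` from the
phase. -/
lemma integral_osc [CompleteSpace X] (hχ : Continuous χ) (hc : HasCompactSupport χ) {f : E n → X}
    (hf : Continuous f) (a : E n) {ε : ℝ} (hε : 0 < ε) :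
    ∫ p : E n × E n, (Complex.exp (Complex.I * (inner ℝ p.1 (p.2 - a) : ℝ)) * χ (ε • p)) • f p.2 =
      ∫ η, oscKernel χ η (ε • (a + ε • η)) • f (a + ε • η) := by
  have h1 := (continuous_osc_integrand hχ hf a ε).integrable_of_hasCompactSupport (μ := volume)
    (hasCompactSupport_osc_integrand (f := f) hc a hε.ne')
  rw [Measure.volume_eq_prod] at h1 ⊢
  rw [integral_prod_symm _ h1]
  have h2 : ∀ ξ : E n, ∫ s : E n, (Complex.exp (Complex.I * (inner ℝ s (ξ - a) : ℝ)) *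
      χ (ε • (s, ξ))) • f ξ = (ε ^ n)⁻¹ • oscKernel χ (ε⁻¹ • (ξ - a)) (ε • ξ) • f ξ := by
    intro ξ
    rw [integral_smul_const, ← smul_assoc]
    congr 1
    have h3 := Measure.integral_comp_smul volume (fun t : E n =>
      Complex.exp (Complex.I * (inner ℝ t (ε⁻¹ • (ξ - a)) : ℝ)) * χ (t, ε • ξ)) ε
    rw [finrank_euclideanSpace_fin, abs_of_pos (by positivity)] at h3
    rw [oscKernel, ← h3]
    congr 1
    ext s
    rw [inner_smul_left, inner_smul_right, Prod.smul_mk]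
    congr 4
    simp [hε.ne']
  simp only [h2]
  rw [integral_smul]
  have h4 := integral_add_left_eq_self (μ := volume)
    (fun ξ => oscKernel χ (ε⁻¹ • (ξ - a)) (ε • ξ) • f ξ) a
  rw [← h4]
  have h5 := Measure.integral_comp_smul volume (fun ζ : E n =>
      oscKernel χ (ε⁻¹ • (a + ζ - a)) (ε • (a + ζ)) • f (a + ζ)) ε
  rw [finrank_euclideanSpace_fin, abs_of_pos (by positivity)] at h5
  rw [← h5]
  congr 1
  ext η
  rw [add_sub_cancel_left, smul_smul, inv_mul_cancel₀ hε.ne', one_smul]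

lemma norm_integral_osc_le [CompleteSpace X] (hχ : ContDiff ℝ ∞ χ) (hc : HasCompactSupport χ) :
    ∃ C : ℝ, 0 ≤ C ∧ ∀ (f : E n → X) (M : ℝ), Continuous f → (∀ ξ, ‖f ξ‖ ≤ M) →
      ∀ (a : E n) (ε : ℝ), 0 < ε → ‖∫ p : E n × E n,
        (Complex.exp (Complex.I * (inner ℝ p.1 (p.2 - a) : ℝ)) * χ (ε • p)) • f p.2‖ ≤ C * M := by
  obtain ⟨C, hC0, hC⟩ := exists_norm_oscKernel_le hχ hc
  refine ⟨C * ∫ η : E n, (1 + ‖η‖) ^ (-((n + 1 : ℕ) : ℝ)),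
    mul_nonneg hC0 (integral_nonneg fun η => by positivity), fun f M hf hM a ε hε => ?_⟩
  rw [integral_osc hχ.continuous hc hf a hε, mul_right_comm, ← integral_const_mul]
  refine norm_integral_le_of_norm_le (integrable_one_add_norm_succ.const_mul _)
    (Eventually.of_forall fun η => ?_)
  rw [norm_smul, mul_right_comm]
  exact mul_le_mul (hC _ _) (hM _) (norm_nonneg _) (by positivity)

/-- Dominated convergence: as `ε → 0` the kernel tends to `oscKernel χ η 0`, whose integral is
known, and `f` is evaluated at `a`. -/
lemma tendsto_integral_osc [CompleteSpace X] (hχ : ContDiff ℝ ∞ χ) (hc : HasCompactSupport χ)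
    {f : E n → X} {M : ℝ} (hf : Continuous f) (hM : ∀ ξ, ‖f ξ‖ ≤ M) (a : E n) :
    Tendsto (fun ε : ℝ => ∫ p : E n × E n,
      (Complex.exp (Complex.I * (inner ℝ p.1 (p.2 - a) : ℝ)) * χ (ε • p)) • f p.2) (𝓝[>] 0)
      (𝓝 (((2 * π : ℂ) ^ n * χ 0) • f a)) := by
  obtain ⟨C, hC0, hC⟩ := exists_norm_oscKernel_le hχ hc
  have hk := continuous_oscKernel hχ.continuous hc
  have hlim : ((2 * π : ℂ) ^ n * χ 0) • f a = ∫ η, oscKernel χ η 0 • f a := by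
    rw [integral_smul_const, integral_oscKernel hχ hc]
    rfl
  have h1 : Tendsto (fun ε : ℝ => ∫ η, oscKernel χ η (ε • (a + ε • η)) • f (a + ε • η)) (𝓝[>] 0)
      (𝓝 (∫ η, oscKernel χ η 0 • f a)) := by
    have hcont : Continuous (Function.uncurry fun (ε : ℝ) (η : E n) =>
        oscKernel χ η (ε • (a + ε • η)) • f (a + ε • η)) := by
      have h2 : Continuous fun q : ℝ × E n => (q.2, q.1 • (a + q.1 • q.2)) := by fun_prop
      have h3 : Continuous fun q : ℝ × E n => f (a + q.1 • q.2) := by fun_prop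
      exact (hk.comp h2).smul h3
    refine tendsto_integral_filter_of_dominated_convergence
      (fun η => C * (1 + ‖η‖) ^ (-((n + 1 : ℕ) : ℝ)) * M) ?_ ?_ ?_ ?_
    · refine Eventually.of_forall fun ε => Continuous.aestronglyMeasurable ?_
      exact hcont.uncurry_left ε
    · refine Eventually.of_forall fun ε => Eventually.of_forall fun η => ?_
      rw [norm_smul]
      exact mul_le_mul (hC _ _) (hM _) (norm_nonneg _) (by positivity)
    · exact (integrable_one_add_norm_succ.const_mul C).mul_const M
    · refine Eventually.of_forall fun η => ?_
      have h3 := (hcont.uncurry_right η).tendsto 0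
      simp only [zero_smul, add_zero] at h3
      exact h3.mono_left nhdsWithin_le_nhds
  rw [hlim]
  refine h1.congr' ?_
  filter_upwards [self_mem_nhdsWithin] with ε hε
  exact (integral_osc hχ.continuous hc hf a hε).symm

variable {θ : Matrix (Fin n) (Fin n) ℝ}

/-- The operator with a bounded symbol `ρ` maps `∑ u_k W_k` to `∑ u_k ρ(k) W_k`. -/
theorem isOscIntegral_of_bounded (hθ : θᵀ = -θ) {ρ : E n → B n} {M : ℝ} (hρ : Continuous ρ)
    (hM : ∀ ξ, ‖ρ ξ‖ ≤ M) {u : B n} (hu : u ∈ SA θ) :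
    IsOscIntegral (fun s ξ => ρ ξ * act (-s) u)
      (∑' k, coef θ k u • (ρ (latt k) * W θ k)) := by
  intro χ hχ hc h0
  have hM0 : 0 ≤ M := (norm_nonneg _).trans (hM 0)
  have hsum := summable_coef hθ hu
  let f : (Fin n → ℤ) → E n → B n := fun k ξ => coef θ k u • (ρ ξ * W θ k)
  have hf : ∀ k, Continuous (f k) := fun k => by fun_prop
  have hfM : ∀ k ξ, ‖f k ξ‖ ≤ ‖coef θ k u‖ * M := fun k ξ => by
    rw [norm_smul]
    gcongr
    refine (norm_mul_le _ _).trans ?_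
    exact (mul_le_of_le_one_right (norm_nonneg _) (norm_W_le θ k)).trans (hM ξ)
  let F : ℝ → (Fin n → ℤ) → E n × E n → B n := fun ε k p =>
    (Complex.exp (Complex.I * (inner ℝ p.1 (p.2 - latt k) : ℝ)) * χ (ε • p)) • f k p.2
  have hexp : ∀ ε (p : E n × E n), HasSum (fun k => F ε k p)
      ((Complex.exp (Complex.I * (inner ℝ p.1 p.2 : ℝ)) * χ (ε • p)) •
        (ρ p.2 * act (-p.1) u)) := by
    intro ε p
    have h1 := ((actL (-p.1)).hasSum (hasSum_coef hθ hu)).mul_left (ρ p.2)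
    have h2 := h1.const_smul (Complex.exp (Complex.I * (inner ℝ p.1 p.2 : ℝ)) * χ (ε • p))
    rw [actL_apply] at h2
    suffices h4 : ∀ k, F ε k p = (Complex.exp (Complex.I * (inner ℝ p.1 p.2 : ℝ)) * χ (ε • p)) •
        (ρ p.2 * actL (-p.1) (coef θ k u • W θ k)) by
      rw [funext h4]
      exact h2
    intro k
    -- The phase `e^{-ik·s}` of `α_{-s}(W_k)` moves the critical frequency from `0` to `k`; this is
    -- why `ρ` is evaluated at the lattice points.
    have h3 : Complex.exp (Complex.I * (inner ℝ p.1 (p.2 - latt k) : ℝ)) =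
        Complex.exp (Complex.I * (inner ℝ p.1 p.2 : ℝ)) *
          Complex.exp (Complex.I * pair k (-p.1 : E n)) := by
      rw [← Complex.exp_add, ← pairL_apply, pairL, innerSL_apply_apply, inner_sub_right,
        inner_neg_right, real_inner_comm p.1 (latt k)]
      push_cast
      ring_nf
    simp only [F, f, map_smul, actL_apply, act_W, mul_smul_comm, smul_smul, h3]
    congr 1
    ring
  -- For fixed `ε` the cut-off is integrable and the Fourier coefficients are summable, so sum and
  -- integral may be exchanged.
  have hsw : ∀ ε : ℝ, 0 < ε → HasSum (fun k => ∫ p, F ε k p)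
      (∫ p : E n × E n, (Complex.exp (Complex.I * (inner ℝ p.1 p.2 : ℝ)) * χ (ε • p)) •
        (ρ p.2 * act (-p.1) u)) := by
    intro ε hε
    have hint : ∀ k, Integrable (F ε k) := fun k =>
      (continuous_osc_integrand hχ.continuous (hf k) _ _).integrable_of_hasCompactSupport
        (hasCompactSupport_osc_integrand hc _ hε.ne')
    have hχi : Integrable fun p : E n × E n => ‖χ (ε • p)‖ :=
      ((hχ.continuous.comp (continuous_const_smul ε)).integrable_of_hasCompactSupport
        (hc.comp_smul hε.ne')).norm
    have h1 := hasSum_integral_of_summable_integral_norm hint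
      ((hsum.mul_right (M * ∫ p : E n × E n, ‖χ (ε • p)‖)).of_nonneg_of_le
        (fun k => integral_nonneg fun p => norm_nonneg _) fun k => by
          rw [← mul_assoc, ← integral_const_mul]
          refine integral_mono (hint k).norm (hχi.const_mul _) fun p => ?_
          change ‖F ε k p‖ ≤ _
          rw [norm_smul, norm_mul, norm_exp_I_mul, one_mul, mul_comm]
          exact mul_le_mul_of_nonneg_right (hfM k p.2) (norm_nonneg _))
    simpa only [(hexp ε _).tsum_eq] using h1
  -- A bound independent of `ε` and of the frequency `k`: it dominates the series and lets the limit
  -- pass under the sum.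
  obtain ⟨C, hC0, hC⟩ := norm_integral_osc_le (X := B n) hχ hc
  have h1 : Tendsto (fun ε : ℝ => ∑' k, ∫ p, F ε k p) (𝓝[>] 0)
      (𝓝 (∑' k, ((2 * π : ℂ) ^ n * χ 0) • f k (latt k))) := by
    refine tendsto_tsum_of_dominated_convergence (bound := fun k => C * (‖coef θ k u‖ * M))
      ((hsum.mul_right M).mul_left C)
      (fun k => tendsto_integral_osc hχ hc (hf k) (hfM k) (latt k)) ?_
    filter_upwards [self_mem_nhdsWithin] with ε hε k
    exact hC (f k) _ (hf k) (hfM k) _ ε hε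
  have h2 := h1.const_smul ((2 * π : ℂ) ^ n)⁻¹
  have hπ : (2 * π : ℂ) ^ n ≠ 0 := pow_ne_zero _ (by simp [Real.pi_ne_zero])
  rw [h0, mul_one, tsum_const_smul'' , smul_smul, inv_mul_cancel₀ hπ, one_smul] at h2
  refine h2.congr' ?_
  filter_upwards [self_mem_nhdsWithin] with ε hε
  rw [(hsw ε hε).tsum_eq]

/-- Oscillating integrals have at most one value. -/
lemma IsOscIntegral.unique {a : E n → E n → B n} {v w : B n} (hv : IsOscIntegral a v)
    (hw : IsOscIntegral a w) : v = w := by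
  let χ₀ : ContDiffBump (0 : E n × E n) := ⟨1, 2, one_pos, one_lt_two⟩
  let χ : E n × E n → ℂ := fun p => (χ₀ p : ℂ)
  have h1 : ContDiff ℝ ∞ χ := Complex.ofRealCLM.contDiff.comp χ₀.contDiff
  have h2 : HasCompactSupport χ := χ₀.hasCompactSupport.comp_left (g := Complex.ofReal) (by simp)
  have h3 : χ 0 = 1 := by
    simp only [χ]
    rw [χ₀.one_of_mem_closedBall (by simp [χ₀]), Complex.ofReal_one]
  exact tendsto_nhds_unique (hv χ h1 h2 h3) (hw χ h1 h2 h3)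

end Oscillating

end NCTorus
end

noncomputable section

namespace NCTorus

/-! ## Interpolation of symbols -/

section Interpolation

variable {n : ℕ} {θ : Matrix (Fin n) (Fin n) ℝ}

lemma deltaPow_sum (hθ : θᵀ = -θ) {ι : Type*} (s : Finset ι) {v : ι → B n}
    (hv : ∀ i ∈ s, v i ∈ SA θ) (β : Fin n → ℕ) :
    deltaPow β (∑ i ∈ s, v i) = ∑ i ∈ s, deltaPow β (v i) := by
  refine eq_of_coef hθ (deltaPow_mem hθ (sum_mem hv) β).1
    (sum_mem fun i hi => (deltaPow_mem hθ (hv i hi) β).1) fun k => ?_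
  rw [coef_deltaPow hθ (sum_mem hv), map_sum, map_sum, Finset.mul_sum]
  exact Finset.sum_congr rfl fun i hi => (coef_deltaPow hθ (hv i hi) β k).symm

/-- The Fréchet topology of `𝒜_θ` is complete. -/
lemma hasSum_deltaPow (hθ : θᵀ = -θ) {ι : Type*} {v : ι → B n} (hv : ∀ i, v i ∈ SA θ)
    (hs : ∀ β : Fin n → ℕ, Summable fun i => ‖deltaPow β (v i)‖) :
    ∑' i, v i ∈ SA θ ∧ ∀ β, HasSum (fun i => deltaPow β (v i)) (deltaPow β (∑' i, v i)) := by
  have h0 : Summable fun i => ‖v i‖ := by simpa [deltaPow_zero] using hs 0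
  have hsum : HasSum v (∑' i, v i) := h0.of_norm.hasSum
  have hA : ∑' i, v i ∈ A θ := hasSum_mem_A (fun i => (hv i).1) hsum
  -- The rapid decay of the coefficients of each term has constants built from the seminorms, and
  -- these are summable over `i`.
  have hSA : ∑' i, v i ∈ SA θ := by
    refine mem_SA_of_decay hθ hA fun m => ?_
    have h1 : Summable fun i => ((n : ℝ) + 1) ^ m *
        (‖v i‖ + ∑ j, ‖deltaPow (Pi.single j m) (v i)‖) :=
      (h0.add (summable_sum fun j _ => hs _)).mul_left _
    refine ⟨∑' i, ((n : ℝ) + 1) ^ m * (‖v i‖ + ∑ j, ‖deltaPow (Pi.single j m) (v i)‖),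
      fun k => ?_⟩
    rw [← tsum_mul_right, ← ((coef θ k).hasSum hsum).tsum_eq]
    exact tsum_of_norm_bounded (h1.mul_right _).hasSum
      fun i => norm_coef_le_of_mem_SA hθ m (hv i) k
  refine ⟨hSA, fun β => ?_⟩
  have h2 := (hs β).of_norm.hasSum
  have h3 : ∑' i, deltaPow β (v i) = deltaPow β (∑' i, v i) := by
    refine eq_of_coef hθ (hasSum_mem_A (fun i => (deltaPow_mem hθ (hv i) β).1) h2)
      (deltaPow_mem hθ hSA β).1 fun k => ?_
    rw [coef_deltaPow hθ hSA]
    have h4 := (coef θ k).hasSum h2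
    have h5 := ((coef θ k).hasSum hsum).mul_left (∏ j, (k j : ℂ) ^ β j)
    simp only [coef_deltaPow hθ (hv _)] at h4
    exact h4.unique h5
  rwa [h3] at h2

lemma deltaPow_smul (hθ : θᵀ = -θ) {u : B n} (hu : u ∈ SA θ) (c : ℂ) (β : Fin n → ℕ) :
    deltaPow β (c • u) = c • deltaPow β u := by
  refine eq_of_coef hθ (deltaPow_mem hθ (Submodule.smul_mem _ c hu) β).1
    (SMulMemClass.smul_mem c (deltaPow_mem hθ hu β).1) fun k => ?_
  rw [coef_deltaPow hθ (Submodule.smul_mem _ c hu), map_smul, map_smul, coef_deltaPow hθ hu,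
    smul_eq_mul, smul_eq_mul]
  ring

/-! ### Classical symbols and their interpolation -/

variable {q : ℂ} {ρ : E n → B n}

lemma rpow_le_two_rpow_abs {x s : ℝ} (h1 : 1 ≤ x) (h2 : x ≤ 2) : x ^ s ≤ 2 ^ |s| :=
  (Real.rpow_le_rpow_of_exponent_le h1 (le_abs_self s)).trans
    (Real.rpow_le_rpow (by positivity) h2 (abs_nonneg s))

/-- Compactness handles the unit ball, and outside it `‖ξ‖` and `1 + ‖ξ‖` agree up to a factor `2`.
-/
lemma symbolBound_of_outside_ball {X : Type*} [NormedAddCommGroup X] [NormedSpace ℝ X]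
    {f : E n → X} (hf : ContDiff ℝ ∞ f) {s : ℝ}
    (h : ∀ m : ℕ, ∃ C : ℝ, ∀ ξ, 1 ≤ ‖ξ‖ → ‖iteratedFDeriv ℝ m f ξ‖ ≤ C * ‖ξ‖ ^ (s - m)) :
    SymbolBound s f := by
  refine ⟨hf, fun m => ?_⟩
  obtain ⟨C, hC⟩ := h m
  obtain ⟨D, hD⟩ := (isCompact_closedBall (0 : E n) 1).exists_bound_of_continuousOn
    (hf.continuous_iteratedFDeriv (m := m) (by exact_mod_cast le_top)).continuousOn
  have hD0 : 0 ≤ D := (norm_nonneg _).trans (hD 0 (by simp))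
  have key : ∀ x : ℝ, 1 ≤ x → x ≤ 2 → 1 ≤ 2 ^ |s - m| * x ^ (s - m) := by
    intro x h1 h2
    have h3 := rpow_le_two_rpow_abs (s := -(s - m)) h1 h2
    rwa [abs_neg, Real.rpow_neg (by positivity), inv_le_iff_one_le_mul₀ (by positivity)] at h3
  refine ⟨(|C| + D) * 2 ^ |s - m|, fun ξ => ?_⟩
  rcases le_total 1 ‖ξ‖ with h1 | h1
  · have h0 : 0 < ‖ξ‖ := by linarith
    have h2 := key ((1 + ‖ξ‖) / ‖ξ‖) (by rw [le_div_iff₀ h0]; linarith)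
      (by rw [div_le_iff₀ h0]; linarith)
    rw [Real.div_rpow (by positivity) h0.le, ← mul_div_assoc, le_div_iff₀ (by positivity),
      one_mul] at h2
    calc ‖iteratedFDeriv ℝ m f ξ‖ ≤ C * ‖ξ‖ ^ (s - m) := hC ξ h1
      _ ≤ (|C| + D) * ‖ξ‖ ^ (s - m) := by
        gcongr
        linarith [le_abs_self C]
      _ ≤ (|C| + D) * (2 ^ |s - m| * (1 + ‖ξ‖) ^ (s - m)) := by gcongr
      _ = _ := by ring
  · have h2 := key (1 + ‖ξ‖) (by linarith [norm_nonneg ξ]) (by linarith)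
    calc ‖iteratedFDeriv ℝ m f ξ‖ ≤ D := hD ξ (by simpa using h1)
      _ ≤ (|C| + D) * 1 := by linarith [abs_nonneg C]
      _ ≤ (|C| + D) * (2 ^ |s - m| * (1 + ‖ξ‖) ^ (s - m)) := by gcongr
      _ = _ := by ring

lemma IsClassicalSymbol.mem_SA (hρ : IsClassicalSymbol θ q ρ) (ξ : E n) : ρ ξ ∈ SA θ :=
  hρ.1.1 ξ trivial

/-- This is the case `N = 0` of the expansion, where no homogeneous term is subtracted. -/
lemma IsClassicalSymbol.symbolBound (hρ : IsClassicalSymbol θ q ρ) (α : Fin n → ℕ) :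
    SymbolBound q.re fun ξ => deltaPow α (ρ ξ) := by
  obtain ⟨⟨-, h1⟩, σ, -, h2⟩ := hρ
  refine symbolBound_of_outside_ball (contDiffOn_univ.1 (h1 α)) fun m => ?_
  simpa using h2 0 α m

lemma IsClassicalSymbol.symbolBound_self (hρ : IsClassicalSymbol θ q ρ) : SymbolBound q.re ρ := by
  simpa [deltaPow_zero] using hρ.symbolBound 0

lemma deltaPow_interpolate (hθ : θᵀ = -θ) (hq : q.re < -n) (φ : 𝓢(E n, ℂ))
    (hρ : IsClassicalSymbol θ q ρ) (ξ : E n) :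
    interpolate φ ρ ξ ∈ SA θ ∧ ∀ α, deltaPow α (interpolate φ ρ ξ) =
      ∑' k : Fin n → ℤ, φ (ξ - latt k) • deltaPow α (ρ (latt k)) := by
  have hv : ∀ k : Fin n → ℤ, φ (ξ - latt k) • ρ (latt k) ∈ SA θ := fun k =>
    Submodule.smul_mem _ _ (hρ.mem_SA _)
  obtain ⟨C, hC0, hC⟩ := schwartz_decay_zero φ 0
  simp only [neg_zero, Real.rpow_zero, mul_one] at hC
  have h := hasSum_deltaPow hθ hv fun β => by
    simp only [deltaPow_smul hθ (hρ.mem_SA _), norm_smul]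
    exact (((hρ.symbolBound β).summable hq).mul_left C).of_nonneg_of_le
      (fun k => by positivity) fun k => mul_le_mul_of_nonneg_right (hC _) (norm_nonneg _)
  refine ⟨h.1, fun α => ?_⟩
  rw [interpolate, ← (h.2 α).tsum_eq]
  exact tsum_congr fun k => deltaPow_smul hθ (hρ.mem_SA _) _ _

lemma isSmoothOn_interpolate (hθ : θᵀ = -θ) (hq : q.re < -n) (φ : 𝓢(E n, ℂ))
    (hρ : IsClassicalSymbol θ q ρ) : IsSmoothOn θ Set.univ (interpolate φ ρ) := by
  refine ⟨fun ξ _ => (deltaPow_interpolate hθ hq φ hρ ξ).1, fun α => ?_⟩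
  rw [contDiffOn_univ]
  simp only [(deltaPow_interpolate hθ hq φ hρ _).2]
  exact (contDiff_tsum_smul_translate φ ((hρ.symbolBound α).summable hq)).1

/-- The expansion of `ρ` is kept unchanged: the interpolation error is smaller than every remainder.
-/
lemma isClassicalSymbol_interpolate (hθ : θᵀ = -θ) (hq : q.re < -n) {φ : 𝓢(E n, ℂ)}
    (hφ : IsMeyer φ) (hρ : IsClassicalSymbol θ q ρ) :
    IsClassicalSymbol θ q (interpolate φ ρ) := by
  refine ⟨isSmoothOn_interpolate hθ hq φ hρ, ?_⟩
  obtain ⟨-, σ, hσ, h2⟩ := id hρ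
  refine ⟨σ, hσ, fun N α b => ?_⟩
  obtain ⟨C, hC⟩ := h2 N α b
  obtain ⟨K, hK⟩ := exists_nat_ge (-(q.re - N - b))
  obtain ⟨C', hC'⟩ := (hρ.symbolBound α).interpolation hφ hq b K
  have hC0' : 0 ≤ C' := by simpa using (norm_nonneg _).trans (hC' 0)
  have hint := deltaPow_interpolate hθ hq φ hρ
  have hsm : ContDiff ℝ ∞ fun ξ => deltaPow α (ρ ξ) := (hρ.symbolBound α).1
  refine ⟨C' + C, fun ξ hξ => ?_⟩
  -- The homogeneous terms are smooth only off the origin, so the derivatives are computed near `ξ`.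
  have hξ0 : ξ ≠ 0 := by
    rintro rfl
    simp at hξ
    linarith
  let g : E n → B n := fun η =>
    (∑' k : Fin n → ℤ, φ (η - latt k) • deltaPow α (ρ (latt k))) - deltaPow α (ρ η)
  let r : E n → B n := fun η => deltaPow α (ρ η - ∑ j ∈ Finset.range N, σ j η)
  have hσSA : ∀ η : E n, η ≠ 0 → ∑ j ∈ Finset.range N, σ j η ∈ SA θ := fun η hη =>
    sum_mem fun j _ => (hσ j).1.1 η hη
  have hg : ContDiff ℝ ∞ g :=
    (contDiff_tsum_smul_translate φ ((hρ.symbolBound α).summable hq)).1.sub hsm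
  have hr : ContDiffAt ℝ ∞ r ξ := by
    have h3 : ContDiffAt ℝ ∞
        (fun η => deltaPow α (ρ η) - ∑ j ∈ Finset.range N, deltaPow α (σ j η)) ξ :=
      hsm.contDiffAt.sub (ContDiffAt.sum fun j _ =>
        ((hσ j).1.2 α).contDiffAt (isOpen_compl_singleton.mem_nhds hξ0))
    refine h3.congr_of_eventuallyEq ?_
    filter_upwards [isOpen_compl_singleton.mem_nhds hξ0] with η hη
    rw [← deltaPow_sum hθ _ (fun j _ => (hσ j).1.1 η hη),
      ← deltaPow_sub hθ (hρ.mem_SA η) (hσSA η hη)]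
  have heq : (fun η => deltaPow α (interpolate φ ρ η - ∑ j ∈ Finset.range N, σ j η)) =ᶠ[𝓝 ξ]
      fun η => g η + r η := by
    filter_upwards [isOpen_compl_singleton.mem_nhds hξ0] with η hη
    simp only [g, r]
    rw [← (hint η).2, deltaPow_sub hθ (hint η).1 (hσSA η hη),
      deltaPow_sub hθ (hρ.mem_SA η) (hσSA η hη)]
    abel
  rw [(heq.iteratedFDeriv ℝ b).eq_of_nhds, fun_iteratedFDeriv_add_apply
    (hg.contDiffAt.of_le (by exact_mod_cast le_top)) (hr.of_le (by exact_mod_cast le_top)),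
    add_mul]
  refine (norm_add_le _ _).trans (add_le_add ((hC' ξ).trans ?_) (hC ξ hξ))
  refine mul_le_mul_of_nonneg_left ?_ hC0'
  calc (1 + ‖ξ‖) ^ (-(K : ℝ)) ≤ ‖ξ‖ ^ (-(K : ℝ)) :=
        Real.rpow_le_rpow_of_nonpos (by linarith) (by linarith) (by simp)
    _ ≤ ‖ξ‖ ^ (q.re - N - b) := Real.rpow_le_rpow_of_exponent_le hξ (by linarith)

lemma interpolate_latt {φ : 𝓢(E n, ℂ)} (hφ : IsMeyer φ) (ρ : E n → B n) (k : Fin n → ℤ) :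
    interpolate φ ρ (latt k) = ρ (latt k) := by
  rw [interpolate, tsum_eq_single k]
  · rw [sub_self, hφ.map_zero, one_smul]
  · intro l hl
    rw [← latt_sub, hφ.map_latt _ (sub_ne_zero.2 hl.symm), zero_smul]

lemma SymbolBound.integrable {X : Type*} [NormedAddCommGroup X] [NormedSpace ℝ X]
    [NormedSpace ℂ X] [IsScalarTower ℝ ℂ X] {s : ℝ} {f : E n → X} (hf : SymbolBound s f)
    (hs : s < -n) : Integrable f := by
  obtain ⟨C, -, hC⟩ := hf.norm_le
  have h := integrable_one_add_norm (E := E n) (μ := volume) (r := -s) (by simp; linarith)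
  rw [neg_neg] at h
  exact (h.const_mul C).mono' hf.1.continuous.aestronglyMeasurable (Eventually.of_forall hC)

/-- Integrating termwise with `∫ φ = 1` gives `∑ ρ(k)`, and the values on the lattice are unchanged.
-/
lemma isNormalized_interpolate (hθ : θᵀ = -θ) (hq : q.re < -n) {φ : 𝓢(E n, ℂ)}
    (hφ : IsMeyer φ) (hρ : IsClassicalSymbol θ q ρ) : IsNormalized (interpolate φ ρ) := by
  refine ⟨(isClassicalSymbol_interpolate hθ hq hφ hρ).symbolBound_self.integrable hq, ?_⟩
  simp only [interpolate_latt hφ]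
  have hint : ∀ k : Fin n → ℤ, Integrable fun ξ => φ (ξ - latt k) • ρ (latt k) := fun k =>
    (φ.integrable.comp_sub_right (latt k)).smul_const _
  have h1 := hasSum_integral_of_summable_integral_norm hint (by
    simp only [norm_smul]
    simp only [integral_mul_const, integral_sub_right_eq_self (fun ξ => ‖φ ξ‖)]
    exact (hρ.symbolBound_self.summable hq).mul_left _)
  simp only [integral_smul_const, integral_sub_right_eq_self (fun ξ => φ ξ), hφ.integral_eq,
    one_smul] at h1
  exact h1

lemma IsClassicalSymbol.isOscIntegral (hθ : θᵀ = -θ) (hq : q.re ≤ 0)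
    (hρ : IsClassicalSymbol θ q ρ) {u : B n} (hu : u ∈ SA θ) :
    IsOscIntegral (fun s ξ => ρ ξ * act (-s) u)
      (∑' k, coef θ k u • (ρ (latt k) * W θ k)) := by
  obtain ⟨C, hC0, hC⟩ := hρ.symbolBound_self.norm_le
  refine isOscIntegral_of_bounded hθ (M := C) hρ.symbolBound_self.1.continuous (fun ξ => ?_) hu
  exact (hC ξ).trans (mul_le_of_le_one_right hC0
    (Real.rpow_le_one_of_one_le_of_nonpos (by linarith [norm_nonneg ξ]) hq))

/-- The operator `P_ρ` on Fourier series. -/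
lemma IsSymbolOf.apply_eq (hθ : θᵀ = -θ) (hq : q.re ≤ 0) (hρ : IsClassicalSymbol θ q ρ)
    {P : SA θ →ₗ[ℂ] SA θ} (hP : IsSymbolOf ρ P) (u : SA θ) :
    (P u : B n) = ∑' k, coef θ k (u : B n) • (ρ (latt k) * W θ k) :=
  (hP u).unique (hρ.isOscIntegral hθ hq u.2)

/-- The operator depends only on the values of its symbol on `ℤⁿ`, and interpolation preserves them.
-/
lemma isSymbolOf_interpolate (hθ : θᵀ = -θ) (hq : q.re < -n) {φ : 𝓢(E n, ℂ)}
    (hφ : IsMeyer φ) (hρ : IsClassicalSymbol θ q ρ) {P : SA θ →ₗ[ℂ] SA θ} (hP : IsSymbolOf ρ P) :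
    IsSymbolOf (interpolate φ ρ) P := by
  have hq0 : q.re ≤ 0 := hq.le.trans (by simp)
  intro u
  have h := (isClassicalSymbol_interpolate hθ hq hφ hρ).isOscIntegral hθ hq0 u.2
  simp only [interpolate_latt hφ] at h
  rwa [← hP.apply_eq hθ hq0 hρ] at h

end Interpolation

end NCTorus
end

noncomputable section

namespace NCTorus

/-! ## Sums of rank-one operators -/

section RankOne

lemma summable_prod_of_fiberwise {α β : Type*} {F : α × β → ℂ} {g : α → β → ℝ} {G : α → ℝ}
    (hg : ∀ a, HasSum (g a) (G a)) (hG : Summable G) (h : ∀ a b, ‖F (a, b)‖ ≤ g a b) :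
    Summable F ∧ ‖∑' p, F p‖ ≤ ∑' a, G a := by
  have h0 : ∀ a, Summable fun b => ‖F (a, b)‖ := fun a =>
    (hg a).summable.of_nonneg_of_le (fun _ => norm_nonneg _) (h a)
  have h1 : ∀ a, ∑' b, ‖F (a, b)‖ ≤ G a := fun a => by
    rw [← (hg a).tsum_eq]
    exact (h0 a).tsum_le_tsum (h a) (hg a).summable
  have h2 : Summable fun a => ∑' b, ‖F (a, b)‖ :=
    hG.of_nonneg_of_le (fun a => tsum_nonneg fun _ => norm_nonneg _) h1
  have h3 : Summable fun p => ‖F p‖ :=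
    (summable_prod_of_nonneg fun p => norm_nonneg (F p)).2 ⟨h0, h2⟩
  refine ⟨h3.of_norm, (norm_tsum_le_tsum_norm h3).trans ?_⟩
  rw [h3.tsum_prod' h0]
  exact h2.tsum_le_tsum h1 hG

variable {K : Type*} [NormedAddCommGroup K] [InnerProductSpace ℂ K] {ι : Type*}

lemma hasSum_sq_norm_inner (e : HilbertBasis ι ℂ K) (x : K) :
    HasSum (fun i => ‖(inner ℂ (e i) x : ℂ)‖ ^ 2) (‖x‖ ^ 2) := by
  have h := Complex.hasSum_re (e.hasSum_inner_mul_inner x x)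
  rw [inner_self_eq_norm_sq_to_K] at h
  have h1 : ∀ i, (inner ℂ x (e i) * inner ℂ (e i) x : ℂ).re = ‖(inner ℂ (e i) x : ℂ)‖ ^ 2 := by
    intro i
    rw [← inner_conj_symm x (e i), mul_comm, Complex.mul_conj, Complex.ofReal_re,
      Complex.normSq_eq_norm_sq]
  simp only [h1] at h
  convert h using 1
  norm_cast

/-- The operator `∑ f_i ⟨e_i, ·⟩`. -/
def sumRankOne (e f : ι → K) : K →L[ℂ] K := ∑' i, (innerSL ℂ (e i)).smulRight (f i)

variable [CompleteSpace K] {f : ι → K}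

lemma hasSum_rankOne (e : HilbertBasis ι ℂ K) (hf : Summable fun i => ‖f i‖) :
    HasSum (fun i => (innerSL ℂ (e i)).smulRight (f i)) (sumRankOne e f) := by
  refine (hf.of_norm_bounded fun i => ?_).hasSum
  rw [ContinuousLinearMap.norm_smulRight_apply, innerSL_apply_norm, e.orthonormal.1 i, one_mul]

lemma hasSum_sumRankOne_apply (e : HilbertBasis ι ℂ K) (hf : Summable fun i => ‖f i‖) (x : K) :
    HasSum (fun i => (inner ℂ (e i) x : ℂ) • f i) (sumRankOne e f x) := by
  have h := (ContinuousLinearMap.apply ℂ K x).hasSum (hasSum_rankOne e hf)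
  simp only [ContinuousLinearMap.apply_apply, ContinuousLinearMap.smulRight_apply,
    innerSL_apply_apply] at h
  exact h

lemma isCompactOperator_sumRankOne (e : HilbertBasis ι ℂ K) (hf : Summable fun i => ‖f i‖) :
    IsCompactOperator (sumRankOne e f) := by
  refine isCompactOperator_of_tendsto (hasSum_rankOne e hf) (Eventually.of_forall fun s => ?_)
  refine sum_mem (S := compactOperator (RingHom.id ℂ) K K) fun i _ => ?_
  exact (isCompactOperator_of_locallyCompactSpace_rng
    (ContinuousLinearMap.toSpanSingleton ℂ (f i))).comp_clm (innerSL ℂ (e i))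

/-- The trace of `∑ f_i ⟨e_i, ·⟩` in any orthonormal basis. -/
lemma hasSum_trace_sumRankOne (e : HilbertBasis ι ℂ K) (hf : Summable fun i => ‖f i‖)
    {κ : Type*} (b : HilbertBasis κ ℂ K) :
    HasSum (fun j => (inner ℂ (b j) (sumRankOne e f (b j)) : ℂ))
      (∑' i, (inner ℂ (e i) (f i) : ℂ)) := by
  let F : ι × κ → ℂ := fun p => inner ℂ (e p.1) (b p.2) * inner ℂ (b p.2) (f p.1)
  -- The weight `‖f i‖` in the arithmetic-geometric inequality makes the majorant of each row sum to
  -- `‖f i‖`. When `f i = 0` the quotient is `0` by convention, and so is the row of `F`.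
  have h1 : ∀ i, HasSum (fun j => (‖f i‖ * ‖(inner ℂ (b j) (e i) : ℂ)‖ ^ 2 +
      ‖(inner ℂ (b j) (f i) : ℂ)‖ ^ 2 / ‖f i‖) / 2) ‖f i‖ := by
    intro i
    have h := (((hasSum_sq_norm_inner b (e i)).mul_left ‖f i‖).add
      ((hasSum_sq_norm_inner b (f i)).div_const ‖f i‖)).div_const 2
    suffices h' : (‖f i‖ * ‖e i‖ ^ 2 + ‖f i‖ ^ 2 / ‖f i‖) / 2 = ‖f i‖ by rwa [h'] at h
    rw [e.orthonormal.1 i]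
    by_cases h0 : ‖f i‖ = 0
    · simp [h0]
    · field_simp
      ring
  obtain ⟨hF, -⟩ := summable_prod_of_fiberwise (F := F) h1 hf fun i j => by
    rw [norm_mul, ← inner_conj_symm, RCLike.norm_conj]
    by_cases h0 : f i = 0
    · simp [h0]
    · have h2 : 0 < ‖f i‖ := norm_pos_iff.2 h0
      rw [le_div_iff₀ two_pos, ← sub_nonneg]
      have h3 : ‖f i‖ * ‖(inner ℂ (b j) (e i) : ℂ)‖ ^ 2 + ‖(inner ℂ (b j) (f i) : ℂ)‖ ^ 2 / ‖f i‖ -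
          ‖(inner ℂ (b j) (e i) : ℂ)‖ * ‖(inner ℂ (b j) (f i) : ℂ)‖ * 2 =
          (‖f i‖ * ‖(inner ℂ (b j) (e i) : ℂ)‖ - ‖(inner ℂ (b j) (f i) : ℂ)‖) ^ 2 / ‖f i‖ := by
        field_simp
        ring
      rw [h3]
      positivity
  have h4 : HasSum (fun i => (inner ℂ (e i) (f i) : ℂ)) (∑' p, F p) :=
    hF.hasSum.prod_fiberwise fun i => b.hasSum_inner_mul_inner (e i) (f i)
  rw [h4.tsum_eq]
  have h5 : HasSum (fun p : κ × ι => F p.swap) (∑' p, F p) :=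
    (Equiv.prodComm κ ι).hasSum_iff.2 hF.hasSum
  refine h5.prod_fiberwise fun j => ?_
  have h6 := (innerSL ℂ (b j)).hasSum (hasSum_sumRankOne_apply e hf (b j))
  simpa [F, inner_smul_right] using h6

/-- A form of Schur's test. -/
lemma norm_sumRankOne_apply_le {G : Type*} [AddGroup G] (e : HilbertBasis G ℂ K) {f : G → K}
    (hf : Summable fun i => ‖f i‖) {a : G → G → ℂ} {w b : G → ℝ}
    (ha : ∀ l, HasSum (fun m => a l m • e (m + l)) (f l)) (hab : ∀ l m, ‖a l m‖ ≤ w l * b m)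
    (hb0 : ∀ m, 0 ≤ b m) (hb : Summable b) {D : ℝ} (hD : 0 ≤ D) {x : K}
    (hx : ∀ l, (inner ℂ (e l) x : ℂ) ≠ 0 → w l ≤ D) :
    ‖sumRankOne e f x‖ ≤ D * (∑' m, b m) * ‖x‖ := by
  have hB : 0 ≤ ∑' m, b m := tsum_nonneg hb0
  -- Grouped by the offset `m`, each diagonal is bounded by the arithmetic-geometric inequality and
  -- Parseval, since `l ↦ m + l` is a bijection.
  have key : ∀ y : K, ‖(inner ℂ y (sumRankOne e f x) : ℂ)‖ ≤
      D * (∑' m, b m) * ((‖x‖ ^ 2 + ‖y‖ ^ 2) / 2) := by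
    intro y
    let F : G × G → ℂ := fun p => inner ℂ (e p.2) x * (a p.2 p.1 * inner ℂ y (e (p.1 + p.2)))
    have h1 : ∀ m, HasSum (fun l => D * b m * ((‖(inner ℂ (e l) x : ℂ)‖ ^ 2 +
        ‖(inner ℂ (e (m + l)) y : ℂ)‖ ^ 2) / 2)) (D * b m * ((‖x‖ ^ 2 + ‖y‖ ^ 2) / 2)) := fun m =>
      (((hasSum_sq_norm_inner e x).add ((Equiv.addLeft m).hasSum_iff.2
        (hasSum_sq_norm_inner e y))).div_const 2).mul_left _
    obtain ⟨hF, hF'⟩ := summable_prod_of_fiberwise (F := F) h1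
      ((hb.mul_left D).mul_right _) fun m l => by
        by_cases h0 : (inner ℂ (e l) x : ℂ) = 0
        · simp only [F, h0, zero_mul, norm_zero]
          have := hb0 m
          positivity
        · have h2 : ‖a l m‖ ≤ D * b m :=
            (hab l m).trans (mul_le_mul_of_nonneg_right (hx l h0) (hb0 m))
          simp only [F]
          rw [norm_mul, norm_mul, ← inner_conj_symm y, RCLike.norm_conj, mul_left_comm]
          refine mul_le_mul h2 ?_ (by positivity) (mul_nonneg hD (hb0 m))
          nlinarith [sq_nonneg (‖(inner ℂ (e l) x : ℂ)‖ - ‖(inner ℂ (e (m + l)) y : ℂ)‖)]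
    rw [tsum_mul_right, tsum_mul_left] at hF'
    have h5 : HasSum (fun p : G × G => F p.swap) (∑' p, F p) :=
      (Equiv.prodComm G G).hasSum_iff.2 hF.hasSum
    have h6 : HasSum (fun l => (inner ℂ (e l) x * inner ℂ y (f l) : ℂ)) (∑' p, F p) := by
      refine h5.prod_fiberwise fun l => ?_
      have h7 := ((innerSL ℂ y).hasSum (ha l)).mul_left (inner ℂ (e l) x : ℂ)
      simpa [F, inner_smul_right] using h7
    have h8 := (innerSL ℂ y).hasSum (hasSum_sumRankOne_apply e hf x)
    simp only [map_smul, innerSL_apply_apply, smul_eq_mul] at h8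
    rw [h8.unique h6]
    exact hF'
  set T := sumRankOne e f x
  by_cases hT : ‖T‖ = 0
  · rw [hT]; positivity
  by_cases hx0 : ‖x‖ = 0
  · have : x = 0 := norm_eq_zero.1 hx0
    simp [T, this]
  have hTp : 0 < ‖T‖ := (norm_nonneg _).lt_of_ne' hT
  have hxp : 0 < ‖x‖ := (norm_nonneg _).lt_of_ne' hx0
  -- Testing against the image of `x`, rescaled to have the norm of `x`, turns the quadratic bound
  -- into the linear one.
  have h := key (((‖x‖ / ‖T‖ : ℝ) : ℂ) • T)
  rw [inner_smul_left, inner_self_eq_norm_sq_to_K, norm_mul, norm_smul, RCLike.norm_conj,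
    Complex.norm_real, norm_pow, RCLike.norm_ofReal, abs_norm, Real.norm_of_nonneg (by positivity),
    div_mul_cancel₀ _ hT, add_self_div_two, sq, ← mul_assoc, div_mul_cancel₀ _ hT, sq,
    ← mul_assoc, mul_comm ‖x‖ ‖T‖] at h
  exact le_of_mul_le_mul_right h hxp

end RankOne

/-! ### Characteristic values -/

section CharValue

variable {K : Type*} [NormedAddCommGroup K] [InnerProductSpace ℂ K]

lemma charValue_nonneg (T : K →L[ℂ] K) (k : ℕ) : 0 ≤ charValue T k :=
  Real.iInf_nonneg fun F => norm_nonneg (T ∘L (F.1ᗮ).subtypeL)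

/-- The span of the `e i`, `i ∈ s`, is a competitor of the right dimension in the infimum. -/
lemma charValue_le {ι : Type*} {e : ι → K} (he : Orthonormal ℂ e) (T : K →L[ℂ] K) (s : Finset ι)
    {C : ℝ} (hC : 0 ≤ C) (h : ∀ x, (∀ i ∈ s, (inner ℂ (e i) x : ℂ) = 0) → ‖T x‖ ≤ C * ‖x‖) :
    charValue T s.card ≤ C := by
  classical
  let F : Submodule ℂ K := Submodule.span ℂ (s.image e : Set K)
  have hfin : FiniteDimensional ℂ F := FiniteDimensional.span_finset ℂ _
  have hrank : Module.finrank ℂ F = s.card := by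
    rw [← Finset.card_image_of_injective s he.linearIndependent.injective]
    refine finrank_span_finset_eq_card ?_
    rw [Finset.coe_image]
    exact (he.linearIndependent.linearIndepOn _).id_image
  refine (ciInf_le ⟨0, ?_⟩ ⟨F, hfin, hrank⟩).trans ?_
  · rintro _ ⟨F', rfl⟩
    exact norm_nonneg (T ∘L (F'.1ᗮ).subtypeL)
  · refine ContinuousLinearMap.opNorm_le_bound _ hC fun x => ?_
    refine h x fun i hi => ?_
    exact (Submodule.mem_orthogonal _ _).1 x.2 _
      (Submodule.subset_span (by simpa using ⟨i, hi, rfl⟩))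

end CharValue

end NCTorus
end

noncomputable section

namespace NCTorus

/-! ## The Hilbert space of the noncommutative torus -/

section Hilbert

variable {n : ℕ} {θ : Matrix (Fin n) (Fin n) ℝ}

lemma inner_toPreH (u v : A θ) :
    (inner ℂ (toPreH θ v : H θ) (toPreH θ u : H θ) : ℂ) = τ ((u : B n) * star (v : B n)) :=
  UniformSpace.Completion.inner_coe _ _

lemma norm_toPreH_le (u : A θ) : ‖(toPreH θ u : H θ)‖ ≤ ‖(u : B n)‖ := by
  refine le_of_sq_le_sq ?_ (norm_nonneg _)
  have h := inner_self_eq_norm_sq_to_K (𝕜 := ℂ) (toPreH θ u : H θ)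
  rw [inner_toPreH] at h
  have h1 := congrArg norm h
  rw [norm_pow, RCLike.norm_ofReal, abs_norm] at h1
  rw [← h1, sq]
  refine (norm_τ_le _).trans ((norm_mul_le _ _).trans ?_)
  rw [ContinuousLinearMap.star_eq_adjoint, LinearIsometryEquiv.norm_map]

/-- The inclusion of `A_θ` into `ℋ_θ`. -/
def inclH (θ : Matrix (Fin n) (Fin n) ℝ) : ASub θ →L[ℂ] H θ :=
  LinearMap.mkContinuous
    { toFun := fun u => (toPreH θ ⟨u.1, u.2⟩ : H θ)
      map_add' := fun u v => UniformSpace.Completion.coe_add _ _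
      map_smul' := fun c u => UniformSpace.Completion.coe_smul c _ } 1 fun u => by
    rw [one_mul]
    exact norm_toPreH_le _

lemma inner_inclH (u v : ASub θ) :
    (inner ℂ (inclH θ v) (inclH θ u) : ℂ) = τ ((u : B n) * star (v : B n)) :=
  inner_toPreH _ _

lemma toH_eq (u : SA θ) : toH u = inclH θ ⟨u.1, u.2.1⟩ := rfl

lemma denseRange_inclH : DenseRange (inclH θ) :=
  UniformSpace.Completion.denseRange_coe.comp (toPreH θ).surjective.denseRange
    (UniformSpace.Completion.continuous_coe _)

/-- The image of `W_k` in `ℋ_θ`. -/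
def waveH (hθ : θᵀ = -θ) (k : Fin n → ℤ) : H θ := inclH θ ⟨W θ k, W_mem_A hθ k⟩

lemma inner_waveH (hθ : θᵀ = -θ) (k : Fin n → ℤ) (u : ASub θ) :
    (inner ℂ (waveH hθ k) (inclH θ u) : ℂ) = coef θ k (u : B n) := by
  rw [waveH, inner_inclH, star_W hθ]
  rfl

lemma orthonormal_waveH (hθ : θᵀ = -θ) : Orthonormal ℂ (waveH hθ) := by
  rw [orthonormal_iff_ite]
  intro k l
  rw [show waveH hθ l = inclH θ ⟨W θ l, W_mem_A hθ l⟩ from rfl, inner_waveH, coef_W hθ]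
  simp only [eq_comm]

lemma dense_span_waveH (hθ : θᵀ = -θ) :
    ⊤ ≤ (Submodule.span ℂ (Set.range (waveH hθ))).topologicalClosure := by
  let M := (Submodule.span ℂ (Set.range (waveH hθ))).topologicalClosure
  have hM : IsClosed (M : Set (H θ)) := Submodule.isClosed_topologicalClosure _
  have h1 : ∀ u : ASub θ, inclH θ u ∈ M := by
    -- The density principle is stated in `B n`; pushing the subspace forward keeps it closed
    -- because `A_θ` is closed.
    let N : Submodule ℂ (B n) := (M.comap (inclH θ).toLinearMap).map (ASub θ).subtype
    have hN : IsClosed (N : Set (B n)) := by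
      rw [Submodule.map_coe]
      exact (IsClosed.isClosedEmbedding_subtypeVal (s := (ASub θ : Set (B n)))
        isClosed_A).isClosedMap _ (hM.preimage (inclH θ).continuous)
    intro u
    have h2 : (u : B n) ∈ N := A_le_of_isClosed hθ N hN (fun k =>
      ⟨⟨W θ k, W_mem_A hθ k⟩, Submodule.le_topologicalClosure _
        (Submodule.subset_span ⟨k, rfl⟩), rfl⟩) u.2
    obtain ⟨v, hv, hvu⟩ := h2
    rw [← Subtype.ext hvu]
    exact hv
  intro x _
  exact hM.closure_subset_iff.2 (Set.range_subset_iff.2 h1) (denseRange_inclH x)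

/-- The orthonormal basis `(W_k)` of `ℋ_θ`. -/
def basisH (hθ : θᵀ = -θ) : HilbertBasis (Fin n → ℤ) ℂ (H θ) :=
  HilbertBasis.mk (orthonormal_waveH hθ) (dense_span_waveH hθ)

lemma basisH_apply (hθ : θᵀ = -θ) (k : Fin n → ℤ) : basisH hθ k = waveH hθ k := by
  rw [basisH, HilbertBasis.coe_mk]

lemma basisH_eq_toH (hθ : θᵀ = -θ) (k : Fin n → ℤ) :
    basisH hθ k = toH ⟨W θ k, W_mem_SA hθ k⟩ := by
  rw [basisH_apply]
  rfl

/-- The basis vectors `W_k` are images of smooth elements, so two extensions agree on a dense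
subspace. -/
lemma Extends.unique (hθ : θᵀ = -θ) {P : SA θ →ₗ[ℂ] SA θ} {S T : H θ →L[ℂ] H θ}
    (hS : Extends S P) (hT : Extends T P) : S = T := by
  have hd : Dense ((Submodule.span ℂ (Set.range (basisH hθ)) : Submodule ℂ (H θ)) :
      Set (H θ)) := by
    rw [Submodule.dense_iff_topologicalClosure_eq_top]
    exact (basisH hθ).dense_span
  refine ContinuousLinearMap.ext_on hd ?_
  rintro _ ⟨k, rfl⟩
  rw [basisH_eq_toH hθ, hS, hT]

lemma hasSum_inclH {ι : Type*} {v : ι → B n} {u : B n} (hv : ∀ i, v i ∈ A θ) (hu : u ∈ A θ)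
    (h : HasSum v u) : HasSum (fun i => inclH θ ⟨v i, hv i⟩) (inclH θ ⟨u, hu⟩) := by
  refine (inclH θ).hasSum (f := fun i => (⟨v i, hv i⟩ : ASub θ)) ?_
  exact Topology.IsInducing.subtypeVal.hasSum_iff (g := (ASub θ).subtype) _ _ |>.1 h

lemma norm_inclH_le (u : ASub θ) : ‖inclH θ u‖ ≤ ‖(u : B n)‖ := norm_toPreH_le _

/-! ### The extension of a pseudodifferential operator, its characteristic values and its trace -/

variable {q : ℂ} {ρ : E n → B n}

lemma symbol_mul_W_mem (hθ : θᵀ = -θ) (hρ : IsClassicalSymbol θ q ρ) (k : Fin n → ℤ) :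
    ρ (latt k) * W θ k ∈ A θ := mul_mem (hρ.mem_SA _).1 (W_mem_A hθ k)

/-- The vector `P W_k` for the operator `P` with symbol `ρ`. -/
def symbolVec (hθ : θᵀ = -θ) (hρ : IsClassicalSymbol θ q ρ) (k : Fin n → ℤ) : H θ :=
  inclH θ ⟨ρ (latt k) * W θ k, symbol_mul_W_mem hθ hρ k⟩

lemma summable_symbolVec (hθ : θᵀ = -θ) (hq : q.re < -n) (hρ : IsClassicalSymbol θ q ρ) :
    Summable fun k => ‖symbolVec hθ hρ k‖ := by
  refine (hρ.symbolBound_self.summable hq).of_nonneg_of_le (fun _ => norm_nonneg _) fun k => ?_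
  refine (norm_inclH_le _).trans ((norm_mul_le _ _).trans ?_)
  exact mul_le_of_le_one_right (norm_nonneg _) (norm_W_le θ k)

/-- The diagonal entry of `P` at `W_k` is `τ(ρ(k) W_k W_k*)`, and `W_k` is unitary. -/
lemma inner_symbolVec (hθ : θᵀ = -θ) (hρ : IsClassicalSymbol θ q ρ) (k : Fin n → ℤ) :
    (inner ℂ (basisH hθ k) (symbolVec hθ hρ k) : ℂ) = τ (ρ (latt k)) := by
  rw [basisH_apply, symbolVec, inner_waveH, coef_apply, mul_assoc, W_mul_W_neg hθ, mul_one]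

/-- The matrix of `P` listed by the offset `m` from the diagonal, in the form Schur's test uses. -/
lemma hasSum_symbolVec (hθ : θᵀ = -θ) (hρ : IsClassicalSymbol θ q ρ) (l : Fin n → ℤ) :
    HasSum (fun m => (coef θ m (ρ (latt l)) * cocycle θ m l) • basisH hθ (m + l))
      (symbolVec hθ hρ l) := by
  have h1 := (hasSum_coef hθ (hρ.mem_SA (latt l))).mul_right (W θ l)
  have h2 := hasSum_inclH (fun m => mul_mem
    (SMulMemClass.smul_mem _ (W_mem_A hθ m)) (W_mem_A hθ l)) (symbol_mul_W_mem hθ hρ l) h1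
  refine (congrArg (fun g => HasSum g (symbolVec hθ hρ l)) (funext fun m => ?_)).mp h2
  rw [basisH_apply, waveH, ← map_smul]
  congr 1
  ext1
  simp [W_mul, smul_smul]

/-- The bounded extension to `ℋ_θ` of an operator with symbol `ρ`. -/
lemma extends_sumRankOne (hθ : θᵀ = -θ) (hq : q.re < -n) (hρ : IsClassicalSymbol θ q ρ)
    {P : SA θ →ₗ[ℂ] SA θ} (hP : IsSymbolOf ρ P) :
    Extends (sumRankOne (basisH hθ) (symbolVec hθ hρ)) P := by
  intro u
  have h1 := hasSum_sumRankOne_apply (basisH hθ) (summable_symbolVec hθ hq hρ) (toH u)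
  have h2 : ∀ k, (inner ℂ (basisH hθ k) (toH u) : ℂ) = coef θ k (u : B n) := fun k => by
    rw [basisH_apply, toH_eq, inner_waveH]
  simp only [h2] at h1
  have hs : Summable fun k => coef θ k (u : B n) • (ρ (latt k) * W θ k) := by
    obtain ⟨C, hC0, hC⟩ := hρ.symbolBound_self.norm_le
    refine ((summable_coef hθ u.2).mul_right C).of_norm_bounded fun k => ?_
    rw [norm_smul]
    refine mul_le_mul_of_nonneg_left ((norm_mul_le _ _).trans ?_) (norm_nonneg _)
    refine (mul_le_of_le_one_right (norm_nonneg _) (norm_W_le θ k)).trans ((hC _).trans ?_)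
    exact mul_le_of_le_one_right hC0 (Real.rpow_le_one_of_one_le_of_nonpos
      (by linarith [norm_nonneg (latt k)]) (hq.le.trans (by simp)))
  have h3 := hs.hasSum
  rw [← hP.apply_eq hθ (hq.le.trans (by simp)) hρ u] at h3
  have h4 := hasSum_inclH (fun k => SMulMemClass.smul_mem _ (symbol_mul_W_mem hθ hρ k))
    (P u).2.1 h3
  refine h1.unique ?_
  refine (congrArg (fun g => HasSum g (toH (P u))) (funext fun m => ?_)).mp h4
  rw [symbolVec, ← map_smul]
  rfl

/-- The bounds on `δ_j^N ρ` give decay off the diagonal, with the symbol order kept as a weight in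
`l`. -/
lemma exists_norm_coef_symbol_le (hθ : θᵀ = -θ) (hρ : IsClassicalSymbol θ q ρ) (N : ℕ) :
    ∃ C : ℝ, 0 ≤ C ∧ ∀ l m : Fin n → ℤ, ‖coef θ m (ρ (latt l))‖ ≤
      (1 + ‖latt l‖) ^ q.re * (C * (1 + ‖latt m‖) ^ (-(N : ℝ))) := by
  obtain ⟨C₀, hC0, hC⟩ := hρ.symbolBound_self.norm_le
  choose D hD0 hD using fun j : Fin n => (hρ.symbolBound (Pi.single j N)).norm_le
  refine ⟨((n : ℝ) + 1) ^ N * (C₀ + ∑ j, D j), ?_, fun l m => ?_⟩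
  · have := Finset.sum_nonneg fun j (_ : j ∈ Finset.univ) => hD0 j
    positivity
  · refine (norm_coef_le_of_mem_SA hθ N (hρ.mem_SA (latt l)) m).trans ?_
    rw [← mul_assoc]
    refine mul_le_mul_of_nonneg_right ?_ (by positivity)
    calc ((n : ℝ) + 1) ^ N *
        (‖ρ (latt l)‖ + ∑ j, ‖deltaPow (Pi.single j N) (ρ (latt l))‖) ≤
        ((n : ℝ) + 1) ^ N * (C₀ * (1 + ‖latt l‖) ^ q.re +
          ∑ j, D j * (1 + ‖latt l‖) ^ q.re) := by
          gcongr with j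
          · exact hC _
          · exact hD j _
      _ = _ := by rw [← Finset.sum_mul]; ring

/-- Lattice points outside a set of `k` points containing a large cube. -/
lemma exists_finset_latt (hn : n ≠ 0) (k : ℕ) (hk : k ≠ 0) : ∃ s : Finset (Fin n → ℤ),
    s.card = k ∧ ∀ l ∉ s, (k : ℝ) ^ (n : ℝ)⁻¹ / 2 ≤ 1 + ‖latt l‖ := by
  have hnn : Nonempty (Fin n) := ⟨⟨0, Nat.pos_of_ne_zero hn⟩⟩
  let x : ℝ := (k : ℝ) ^ (n : ℝ)⁻¹
  have hx1 : 1 ≤ x := Real.one_le_rpow (by exact_mod_cast Nat.one_le_iff_ne_zero.2 hk)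
    (by positivity)
  -- The cube `[-R, R]ⁿ` has `(2R + 1)ⁿ ≤ k` points, and a lattice point outside it has norm at
  -- least `R + 1 > (x - 1) / 2`.
  let R : ℕ := ⌊(x - 1) / 2⌋₊
  have hR : (R : ℝ) ≤ (x - 1) / 2 := Nat.floor_le (by linarith)
  have hR' : (x - 1) / 2 < R + 1 := Nat.lt_floor_add_one _
  let Q : Finset (Fin n → ℤ) := Fintype.piFinset fun _ => Finset.Icc (-(R : ℤ)) R
  have hQ : Q.card ≤ k := by
    have h1 : Q.card = (2 * R + 1) ^ n := by
      simp only [Q, Fintype.card_piFinset, Int.card_Icc, Finset.prod_const, Finset.card_univ,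
        Fintype.card_fin]
      congr 1
      omega
    rw [h1]
    have h2 : ((2 * R + 1 : ℕ) : ℝ) ^ n ≤ x ^ n := by
      refine pow_le_pow_left₀ (by positivity) ?_ n
      push_cast
      linarith
    rw [Real.rpow_inv_natCast_pow (by positivity) hn] at h2
    exact_mod_cast h2
  obtain ⟨s, hs, hsk⟩ := Infinite.exists_superset_card_eq Q k hQ
  refine ⟨s, hsk, fun l hl => ?_⟩
  have h1 : l ∉ Q := fun h => hl (hs h)
  obtain ⟨i, hi⟩ : ∃ i, ¬ l i ∈ Finset.Icc (-(R : ℤ)) R := by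
    simpa only [Q, Fintype.mem_piFinset, not_forall] using h1
  have h2 : (R : ℤ) + 1 ≤ |l i| := by
    rw [Finset.mem_Icc, ← abs_le, not_le] at hi
    omega
  have h3 : (R : ℝ) + 1 ≤ |(l i : ℝ)| := by exact_mod_cast h2
  have h4 : |(l i : ℝ)| ≤ ‖latt l‖ := by
    simpa using PiLp.norm_apply_le (latt l) i
  change x / 2 ≤ _
  linarith

/-- Orthogonally to the `W_l` with `l` in a set of `k` points containing a large cube, only
frequencies of size at least of order `k^{1/n}` remain. There the weight is `O(k^{Re q / n})`, with
exponent below `-1`. -/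
lemma isTraceClass_sumRankOne (hn : n ≠ 0) (hθ : θᵀ = -θ) (hq : q.re < -n)
    (hρ : IsClassicalSymbol θ q ρ) :
    IsTraceClass (sumRankOne (basisH hθ) (symbolVec hθ hρ)) := by
  have hf := summable_symbolVec hθ hq hρ
  refine ⟨isCompactOperator_sumRankOne _ hf, ?_⟩
  obtain ⟨C, hC0, hC⟩ := exists_norm_coef_symbol_le hθ hρ (n + 1)
  let b : (Fin n → ℤ) → ℝ := fun m => C * (1 + ‖latt m‖) ^ (-((n + 1 : ℕ) : ℝ))
  have hb : Summable b :=
    (summable_latt (n := n) (r := ((n + 1 : ℕ) : ℝ)) (by push_cast; linarith)).mul_left C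
  have hb0 : ∀ m, 0 ≤ b m := fun m => by positivity
  have hB : 0 ≤ ∑' m, b m := tsum_nonneg hb0
  have hn0 : (0 : ℝ) < n := by exact_mod_cast Nat.pos_of_ne_zero hn
  have key : ∀ k : ℕ, charValue (sumRankOne (basisH hθ) (symbolVec hθ hρ)) (k + 1) ≤
      (∑' m, b m) * (2 ^ (-q.re) * ((k + 1 : ℕ) : ℝ) ^ (q.re / n)) := by
    intro k
    obtain ⟨s, hs, hs'⟩ := exists_finset_latt hn (k + 1) k.succ_ne_zero
    have hD : (((k + 1 : ℕ) : ℝ) ^ (n : ℝ)⁻¹ / 2) ^ q.re =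
        2 ^ (-q.re) * ((k + 1 : ℕ) : ℝ) ^ (q.re / n) := by
      rw [Real.div_rpow (by positivity) (by positivity), ← Real.rpow_mul (by positivity),
        Real.rpow_neg (by positivity), div_eq_inv_mul, inv_mul_eq_div (n : ℝ)]
    rw [← hD, ← hs]
    refine charValue_le (basisH hθ).orthonormal _ s (by positivity) fun x hx => ?_
    rw [mul_comm (∑' m, b m), hs]
    refine norm_sumRankOne_apply_le (basisH hθ) hf (hasSum_symbolVec hθ hρ)
      (w := fun l => (1 + ‖latt l‖) ^ q.re) (fun l m => ?_) hb0 hb (by positivity)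
      fun l hl => ?_
    · rw [norm_mul, norm_cocycle, mul_one]
      exact hC l m
    · exact Real.rpow_le_rpow_of_nonpos (by positivity) (hs' l fun h => hl (hx l h))
        (by linarith)
  -- Dropping the index `0` does not affect summability, and the choice of lattice points needs `k ≠
  -- 0`.
  rw [← summable_nat_add_iff 1]
  have h1 : Summable fun k : ℕ => (k : ℝ) ^ (q.re / n) :=
    Real.summable_nat_rpow.2 (by rw [div_lt_iff₀ hn0]; linarith)
  exact ((((summable_nat_add_iff 1).2 h1).mul_left _).mul_left _).of_nonneg_of_le
    (fun k => charValue_nonneg _ _) key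

lemma IsNormalized.integrable_τ (hρ : IsNormalized ρ) : Integrable fun ξ => τ (ρ ξ) :=
  (τL n).integrable_comp hρ.1

lemma IsNormalized.tsum_τ (hρ : IsNormalized ρ) :
    ∑' k : Fin n → ℤ, τ (ρ (latt k)) = ∫ ξ, τ (ρ ξ) :=
  ((τL n).hasSum hρ.2).tsum_eq.trans ((τL n).integral_comp_comm hρ.1).symm

lemma hasTrace_of_isNormalized (hn : n ≠ 0) (hθ : θᵀ = -θ) (hq : q.re < -n)
    (hρ : IsClassicalSymbol θ q ρ) (hN : IsNormalized ρ) :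
    HasTrace (sumRankOne (basisH hθ) (symbolVec hθ hρ)) (∫ ξ, τ (ρ ξ)) := by
  refine ⟨isTraceClass_sumRankOne hn hθ hq hρ, fun ι e => ?_⟩
  have h := hasSum_trace_sumRankOne (basisH hθ) (summable_symbolVec hθ hq hρ) e
  simp only [inner_symbolVec] at h
  rwa [hN.tsum_τ] at h

end Hilbert

end NCTorus
end

/-! ### The main theorem -/

theorem mainTheorem12 (n : ℕ) (hn : 2 ≤ n) (θ : Matrix (Fin n) (Fin n) ℝ) (hθ : θᵀ = -θ)
    (q : ℂ) (hq : q.re < -(n : ℝ)) (P : NCTorus.SA θ →ₗ[ℂ] NCTorus.SA θ)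
    (hP : P ∈ NCTorus.PsiDO θ q) :
    -- Meyer-type functions exist
    (∃ φ : 𝓢(NCTorus.E n, ℂ), NCTorus.IsMeyer φ) ∧
    -- interpolating any symbol of `P` gives a normalized classical symbol of `P`
    (∀ φ : 𝓢(NCTorus.E n, ℂ), NCTorus.IsMeyer φ →
      ∀ ρ : NCTorus.E n → NCTorus.B n,
        NCTorus.IsClassicalSymbol θ q ρ → NCTorus.IsSymbolOf ρ P →
          (∀ ξ, Summable fun k : Fin n → ℤ =>
            φ (ξ - NCTorus.latt k) • ρ (NCTorus.latt k)) ∧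
          NCTorus.IsClassicalSymbol θ q (NCTorus.interpolate φ ρ) ∧
          NCTorus.IsSymbolOf (NCTorus.interpolate φ ρ) P ∧
          NCTorus.IsNormalized (NCTorus.interpolate φ ρ)) ∧
    -- `P` extends uniquely to a bounded operator on `ℋ_θ`, which is trace-class, and the trace
    -- formula holds for every normalized symbol
    (∃! T : NCTorus.H θ →L[ℂ] NCTorus.H θ, NCTorus.Extends T P) ∧
    ∀ T : NCTorus.H θ →L[ℂ] NCTorus.H θ, NCTorus.Extends T P →
      NCTorus.IsTraceClass T ∧
      ∀ ρ : NCTorus.E n → NCTorus.B n,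
        NCTorus.IsClassicalSymbol θ q ρ → NCTorus.IsSymbolOf ρ P → NCTorus.IsNormalized ρ →
          Integrable (fun ξ => NCTorus.τ (ρ ξ)) ∧
          NCTorus.HasTrace T (∫ ξ, NCTorus.τ (ρ ξ)) := by
  have hn0 : n ≠ 0 := by omega
  obtain ⟨ρ₀, hρ₀, hP₀⟩ := hP
  have hT₀ := NCTorus.extends_sumRankOne hθ hq hρ₀ hP₀
  refine ⟨NCTorus.exists_isMeyer n, fun φ hφ ρ hρ hρP => ⟨fun ξ => ?_, ?_, ?_, ?_⟩,
    ⟨_, hT₀, fun T hT => hT.unique hθ hT₀⟩, fun T hT => ⟨?_, fun ρ hρ hρP hN => ?_⟩⟩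
  · exact NCTorus.summable_smul_translate φ (hρ.symbolBound_self.summable hq) ξ
  · exact NCTorus.isClassicalSymbol_interpolate hθ hq hφ hρ
  · exact NCTorus.isSymbolOf_interpolate hθ hq hφ hρ hρP
  · exact NCTorus.isNormalized_interpolate hθ hq hφ hρ
  · rw [hT.unique hθ hT₀]
    exact NCTorus.isTraceClass_sumRankOne hn0 hθ hq hρ₀
  -- By uniqueness the extension may be rebuilt from the given normalized symbol instead of `ρ₀`, so
  -- the trace is read off from that symbol.
  · rw [hT.unique hθ (NCTorus.extends_sumRankOne hθ hq hρ hρP)]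
    exact ⟨hN.integrable_τ, NCTorus.hasTrace_of_isNormalized hn0 hθ hq hρ hN⟩
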